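/- Let $m\ge 2$, let $(\mathcal N,h)$ be a connected smooth $2$-dimensional Lorentzian manifold of signature $(-,+)$, let $f:\mathcal N\to(0,\infty)$ be smooth, and let $g=h+f^2 g_{\mathbb S^m}$ be the warped product metric on $\mathcal M=\mathcal N\times\mathbb S^m$, where $g_{\mathbb S^m}$ is the standard metric of the unit sphere $\mathbb S^m\subset\mathbb R^{m+1}$. Assume that the Killing algebra of $(\mathcal M,g)$ has dimension at least $\tfrac12 m(m+1)+1$. Then the Killing algebra of $(\mathcal N,h)$ has finite dimension $\mathfrak n\ge 1$. Let $X_1,\dots,X_{\mathfrak n}$ be any basis of it, and put $W_a:=X_a+f^2\,\nabla\big(X_a(\ln f)\big)$, where $\nabla$ is the gradient with respect to $h$. Linear (in)dependence of vector fields is over $\mathbb R$. **Case A.** If the $W_a$ are linearly independent, then there are constants $\alpha^a\in\mathbb R$, not all zero, such that $\xi=\sum_a\alpha^aX_a$ satisfies $\xi(f)=0$ on $\mathcal N$. **Case B.** If the $W_a$ are linearly dependent, then the Killing algebra of $(\mathcal M,g)$ has dimension at least $\tfrac12(m+1)(m+2)$. Moreover, let $\sigma^a\in\mathbb R$, not all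 zero, be any constants with $\sum_a\sigma^aW_a=0$, and put $X=\sum_a\sigma^aX_a$. Let $Y^i$ ($1\le i\le m+1$) be the restrictions to $\mathbb S^m$ of the Cartesian coordinates of $\mathbb R^{m+1}$, and let $Z^i=\nabla^{\mathbb S^m}Y^i$ be their gradients. Then the vector fields $$\xi^i=Y^iX+\frac{X(f)}{f}Z^i\quad(1\le i\le m+1),\qquad \zeta^{ij}=Y^iZ^j-Y^jZ^i\quad(1\le i<j\le m+1)$$ on $\mathcal M$ are Killing vector fields of $g$ and are linearly independent. If $U\subseteq\mathcal N$ is open and $X$ is spacelike on $U$, i.e. $h(X,X)>0$ there, then $(U\times\mathbb S^m,g)$ is locally isometric to an FLRW spacetime: every point has an open neighbourhood that is isometric to an open subset of a spacetime with metric $-dt^2+a(t)^2\big(d\chi^2+S_k(\chi)^2g_{\mathbb S^m}\big)$, $t\in J$, $0<\chi<\pi/\sqrt k$ (with $\pi/\sqrt k=\infty$ if $k\le0$), for some open interval $J$, some smooth $a:J\to(0,\infty)$ and some constant $k\in\mathbb R$. Here $S_k(\chi)$ is $\sin(\sqrt k\,\chi)/\sqrt k$, $\chi$, or $\sinh(\sqrt{-k}\,\chi)/\sqrt{-k}$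 for $k>0$, $k=0$, $k<0$ respectively. -/

import Mathlib

open scoped Manifold ContDiff

noncomputable section

namespace WarpedKilling

section General

variable {E : Type*} [NormedAddCommGroup E] [NormedSpace ℝ E]
  {H : Type*} [TopologicalSpace H] (I : ModelWithCorners ℝ E H)
  {M : Type*} [TopologicalSpace M] [ChartedSpace H M]
  {E' : Type*} [NormedAddCommGroup E'] [NormedSpace ℝ E']
  {H' : Type*} [TopologicalSpace H'] (I' : ModelWithCorners ℝ E' H')
  {M' : Type*} [TopologicalSpace M'] [ChartedSpace H' M']

/-- A vector field on `M` (no smoothness required). -/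
abbrev VField (M : Type*) [TopologicalSpace M] [ChartedSpace H M] : Type _ :=
  (x : M) → TangentSpace I x

/-- A covariant 2-tensor field on `M` (no symmetry or smoothness required). -/
abbrev Tensor2 (M : Type*) [TopologicalSpace M] [ChartedSpace H M] : Type _ :=
  (x : M) → TangentSpace I x →L[ℝ] TangentSpace I x →L[ℝ] ℝ

/-- The vector field `X` is smooth at the point `x`. -/
def SmoothFieldAt [IsManifold I ∞ M] (X : VField I M) (x : M) : Prop :=
  ContMDiffAt I (I.prod 𝓘(ℝ, E)) ∞ (fun y => (⟨y, X y⟩ : TangentBundle I M)) x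

/-- `g` is a smooth Lorentzian metric, with signature `(-, +, ..., +)`. -/
structure IsLorentzian [IsManifold I ∞ M] (g : Tensor2 I M) : Prop where
  smooth : ContMDiff I (I.prod 𝓘(ℝ, E →L[ℝ] E →L[ℝ] ℝ)) ∞
    (fun x => Bundle.TotalSpace.mk' (E →L[ℝ] E →L[ℝ] ℝ)
      (E := fun x : M => TangentSpace I x →L[ℝ] TangentSpace I x →L[ℝ] ℝ) x (g x))
  symm : ∀ x v w, g x v w = g x w v
  signature : ∀ x, ∃ v, g x v v < 0 ∧ ∀ w, g x v w = 0 → w ≠ 0 → 0 < g x w w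

/-- The derivative `X(u)` of the function `u` along the vector field `X`. -/
def dirDeriv (X : VField I M) (u : M → ℝ) : M → ℝ :=
  fun x => mvfderiv I u x (X x)

/-- `X` is a Killing vector field of `g`: it is smooth and the Lie derivative `L_X g` vanishes,
i.e. `X(g(Y, Z)) = g([X, Y], Z) + g(Y, [X, Z])` for all (locally defined) smooth `Y`, `Z`. -/
def IsKilling [IsManifold I ∞ M] (g : Tensor2 I M) (X : VField I M) : Prop :=
  (∀ x, SmoothFieldAt I X x) ∧
  ∀ (Y Z : VField I M) (x : M), SmoothFieldAt I Y x → SmoothFieldAt I Z x →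
    dirDeriv I X (fun y => g y (Y y) (Z y)) x =
      g x (VectorField.mlieBracket I X Y x) (Z x) +
        g x (Y x) (VectorField.mlieBracket I X Z x)

variable {I} in
theorem SmoothFieldAt.mdifferentiableAt [IsManifold I ∞ M] {X : VField I M} {x : M} (h : SmoothFieldAt I X x) :
    MDifferentiableAt I (I.prod 𝓘(ℝ, E)) (fun y => (⟨y, X y⟩ : TangentBundle I M)) x :=
  ContMDiffAt.mdifferentiableAt h (by simp)

/-- The vector space of all Killing vector fields of `g`. -/
def killingAlgebra [CompleteSpace E] [IsManifold I ∞ M] (g : Tensor2 I M) :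
    Submodule ℝ (VField I M) where
  carrier := {X | IsKilling I g X}
  zero_mem' := by
    refine ⟨fun x => Bundle.contMDiff_zeroSection ℝ (TangentSpace I : M → Type _) x, ?_⟩
    intro Y Z x _ _
    simp [dirDeriv]
  add_mem' := by
    intro X₁ X₂ h₁ h₂
    have : IsManifold I 2 M := IsManifold.of_le (n := ∞) (by norm_cast)
    refine ⟨fun x => ContMDiffAt.add_section (h₁.1 x) (h₂.1 x), ?_⟩
    intro Y Z x hY hZ
    have e₁ := h₁.2 Y Z x hY hZ
    have e₂ := h₂.2 Y Z x hY hZ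
    rw [VectorField.mlieBracket_add_left (h₁.1 x).mdifferentiableAt (h₂.1 x).mdifferentiableAt,
      VectorField.mlieBracket_add_left (h₁.1 x).mdifferentiableAt (h₂.1 x).mdifferentiableAt]
    simp only [dirDeriv] at e₁ e₂ ⊢
    simp only [Pi.add_apply, map_add, _root_.add_apply, e₁, e₂]
    ring
  smul_mem' := by
    intro c X h
    have : IsManifold I 2 M := IsManifold.of_le (n := ∞) (by norm_cast)
    refine ⟨fun x => ContMDiffAt.const_smul_section (h.1 x), ?_⟩
    intro Y Z x hY hZ
    have e := h.2 Y Z x hY hZ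
    rw [VectorField.mlieBracket_const_smul_left (h.1 x).mdifferentiableAt,
      VectorField.mlieBracket_const_smul_left (h.1 x).mdifferentiableAt]
    simp only [dirDeriv] at e ⊢
    simp only [Pi.smul_apply, map_smul, _root_.smul_apply, smul_eq_mul, e]
    ring

/-- The gradient of `u` with respect to `g`: the vector field `∇u` with `g(∇u, w) = du(w)`
for all `w`. -/
def grad (g : Tensor2 I M) (u : M → ℝ) : VField I M :=
  fun x => Classical.epsilon fun v : TangentSpace I x => ∀ w, g x v w = mvfderiv I u x w

/-- Where `g` is nondegenerate, the gradient exists and is characterized by its defining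
property. -/
theorem grad_spec [FiniteDimensional ℝ E] (g : Tensor2 I M) (u : M → ℝ) (x : M)
    (hg : ∀ v, (∀ w, g x v w = 0) → v = 0) (v : TangentSpace I x) :
    v = grad I g u x ↔ ∀ w, g x v w = mvfderiv I u x w := by
  have : FiniteDimensional ℝ (TangentSpace I x) := inferInstanceAs (FiniteDimensional ℝ E)
  let L : TangentSpace I x →ₗ[ℝ] Module.Dual ℝ (TangentSpace I x) :=
    { toFun := fun v => (g x v : TangentSpace I x →ₗ[ℝ] ℝ)
      map_add' := by intro a b; ext; simp
      map_smul' := by intro a b; ext; simp }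
  have hinj : Function.Injective L := by
    rw [injective_iff_map_eq_zero]
    intro a ha
    exact hg a fun w => LinearMap.congr_fun ha w
  have hsurj : Function.Surjective L :=
    (LinearMap.injective_iff_surjective_of_finrank_eq_finrank
      (Subspace.dual_finrank_eq).symm).1 hinj
  have hex : ∃ v : TangentSpace I x, ∀ w, g x v w = mvfderiv I u x w := by
    obtain ⟨v, hv⟩ := hsurj (mvfderiv I u x : TangentSpace I x →ₗ[ℝ] ℝ)
    exact ⟨v, fun w => LinearMap.congr_fun hv w⟩
  have hs : ∀ w, g x (grad I g u x) w = mvfderiv I u x w := Classical.epsilon_spec hex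
  refine ⟨fun h => h ▸ hs, fun h => ?_⟩
  rw [← sub_eq_zero]
  exact hg _ fun w => by simp [h, hs]

/-- The pullback of a covariant 2-tensor along a map. -/
def pullback (φ : M → M') (g : Tensor2 I' M') : Tensor2 I M :=
  fun x => (ContinuousLinearMap.precomp ℝ (mfderiv I I' φ x)).comp
    ((g (φ x)).comp (mfderiv I I' φ x))

theorem pullback_apply (φ : M → M') (g : Tensor2 I' M') (x : M) (v w : TangentSpace I x) :
    pullback I I' φ g x v w = g (φ x) (mfderiv I I' φ x v) (mfderiv I I' φ x w) := rfl

/-- The warped product tensor `h + f² γ` on `M × M'`, where `f` is a function on `M`. -/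
def warped (h : Tensor2 I M) (f : M → ℝ) (γ : Tensor2 I' M') : Tensor2 (I.prod I') (M × M') :=
  fun x => pullback (I.prod I') I Prod.fst h x
    + (f x.1) ^ 2 • pullback (I.prod I') I' Prod.snd γ x

theorem warped_apply (h : Tensor2 I M) (f : M → ℝ) (γ : Tensor2 I' M') (x : M × M')
    (v w : TangentSpace (I.prod I') x) :
    warped I I' h f γ x v w = h x.1 v.1 w.1 + (f x.1) ^ 2 * γ x.2 v.2 w.2 := by
  have e : warped I I' h f γ x v w =
      pullback (I.prod I') I Prod.fst h x v w
        + (f x.1) ^ 2 * pullback (I.prod I') I' Prod.snd γ x v w := rfl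
  rw [e, pullback_apply, pullback_apply, mfderiv_fst, mfderiv_snd]
  rfl

/-- The vector field on `M × M'` with components `A` tangent to `M` and `B` tangent to `M'`. -/
def prodField (A : (x : M × M') → TangentSpace I x.1) (B : (x : M × M') → TangentSpace I' x.2) :
    VField (I.prod I') (M × M') :=
  fun x => ((A x, B x) : TangentSpace I x.1 × TangentSpace I' x.2)

/-- `W_X = X + f² ∇(X(ln f))`. -/
def wField (h : Tensor2 I M) (f : M → ℝ) (X : VField I M) : VField I M :=
  X + fun x => (f x) ^ 2 • grad I h (dirDeriv I X (fun y => Real.log (f y))) x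

end General

/-- The unit sphere `S^m` in `ℝ^(m+1)`. -/
abbrev Sph (m : ℕ) : Type := Metric.sphere (0 : EuclideanSpace ℝ (Fin (m + 1))) 1

/-- The Euclidean metric on `ℝ^d`. -/
def euclid (d : ℕ) : Tensor2 (𝓡 d) (EuclideanSpace ℝ (Fin d)) :=
  fun _ => (innerSL ℝ : EuclideanSpace ℝ (Fin d) →L[ℝ] EuclideanSpace ℝ (Fin d) →L[ℝ] ℝ)

/-- The standard metric of `S^m`, induced by the Euclidean metric. -/
def roundMetric (m : ℕ) : Tensor2 (𝓡 m) (Sph m) :=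
  pullback (𝓡 m) (𝓡 (m + 1)) (fun q : Sph m => (q : EuclideanSpace ℝ (Fin (m + 1))))
    (euclid (m + 1))

/-- The Cartesian coordinate `Y^i` restricted to `S^m`. -/
def sphY (m : ℕ) (i : Fin (m + 1)) : Sph m → ℝ :=
  fun q => (q : EuclideanSpace ℝ (Fin (m + 1))) i

/-- `Z^i = ∇Y^i` on `S^m`. -/
def sphZ (m : ℕ) (i : Fin (m + 1)) : VField (𝓡 m) (Sph m) :=
  grad (𝓡 m) (roundMetric m) (sphY m i)

/-- `ζ^{ij} = Y^i ∇Y^j - Y^j ∇Y^i` on `S^m`. -/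
def sphZeta (m : ℕ) (i j : Fin (m + 1)) : VField (𝓡 m) (Sph m) :=
  fun q => sphY m i q • sphZ m j q - sphY m j q • sphZ m i q

section Base

variable {N : Type*} [TopologicalSpace N] [ChartedSpace (EuclideanSpace ℝ (Fin 2)) N]

/-- The metric `g = h + f² γ` on `N × S^m`, with `γ` the standard metric of `S^m`. -/
def spherical (m : ℕ) (h : Tensor2 (𝓡 2) N) (f : N → ℝ) :
    Tensor2 ((𝓡 2).prod (𝓡 m)) (N × Sph m) :=
  warped (𝓡 2) (𝓡 m) h f (roundMetric m)

/-- `ξ^i = Y^i X + (X(f)/f) Z^i` on `N × S^m`. -/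
def xiField (m : ℕ) (f : N → ℝ) (X : VField (𝓡 2) N) (i : Fin (m + 1)) :
    VField ((𝓡 2).prod (𝓡 m)) (N × Sph m) :=
  prodField (𝓡 2) (𝓡 m) (fun x => sphY m i x.2 • X x.1)
    (fun x => (dirDeriv (𝓡 2) X f x.1 / f x.1) • sphZ m i x.2)

/-- The rotation field `ζ^{ij}`, as a vector field on `N × S^m`. -/
def zetaField (N : Type*) [TopologicalSpace N] [ChartedSpace (EuclideanSpace ℝ (Fin 2)) N]
    (m : ℕ) (i j : Fin (m + 1)) : VField ((𝓡 2).prod (𝓡 m)) (N × Sph m) :=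
  prodField (𝓡 2) (𝓡 m) (fun _ => 0) (fun x => sphZeta m i j x.2)

/-- The family consisting of all `ξ^i` and of all `ζ^{ij}` with `i < j`. -/
def xiZeta (m : ℕ) (f : N → ℝ) (X : VField (𝓡 2) N) :
    (Fin (m + 1) ⊕ {p : Fin (m + 1) × Fin (m + 1) // p.1 < p.2}) →
      VField ((𝓡 2).prod (𝓡 m)) (N × Sph m) :=
  Sum.elim (xiField m f X) (fun p => zetaField N m p.1.1 p.1.2)

end Base

/-- The function `S_k`: `sin(√k χ)/√k`, `χ` or `sinh(√(-k) χ)/√(-k)` according to the sign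
of `k`. -/
def Sk (k χ : ℝ) : ℝ :=
  if 0 < k then Real.sin (√k * χ) / √k
  else if k = 0 then χ
  else Real.sinh (√(-k) * χ) / √(-k)

/-- The tensor `-dt² + a(t)² dχ²` in the coordinates `(t, χ)`. -/
def flrwBase (a : ℝ → ℝ) : Tensor2 𝓘(ℝ, ℝ × ℝ) (ℝ × ℝ) :=
  fun p =>
    (-((ContinuousLinearMap.fst ℝ ℝ ℝ).smulRight (ContinuousLinearMap.fst ℝ ℝ ℝ))
      + (a p.1) ^ 2 • ((ContinuousLinearMap.snd ℝ ℝ ℝ).smulRight (ContinuousLinearMap.snd ℝ ℝ ℝ)) :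
      (ℝ × ℝ) →L[ℝ] (ℝ × ℝ) →L[ℝ] ℝ)

/-- The FLRW metric `-dt² + a(t)² (dχ² + S_k(χ)² γ)` of dimension `m + 2`. -/
def flrw (m : ℕ) (a : ℝ → ℝ) (k : ℝ) :
    Tensor2 (𝓘(ℝ, ℝ × ℝ).prod (𝓡 m)) ((ℝ × ℝ) × Sph m) :=
  warped 𝓘(ℝ, ℝ × ℝ) (𝓡 m) (flrwBase a) (fun p => a p.1 * Sk k p.2) (roundMetric m)

/-- The domain `t ∈ J`, `0 < χ < π/√k` (with `π/√k = ∞` if `k ≤ 0`) of the coordinates. -/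
def flrwDomain (m : ℕ) (J : Set ℝ) (k : ℝ) : Set ((ℝ × ℝ) × Sph m) :=
  {x | x.1.1 ∈ J ∧ 0 < x.1.2 ∧ (0 < k → x.1.2 < Real.pi / √k)}

/-- On the open set `V`, the tensor `g` is locally isometric to FLRW: every point of `V` has an
open neighbourhood in `V` with a diffeomorphism onto an open subset of an FLRW spacetime that is
an isometry. As FLRW spacetimes are spatially homogeneous, leaving out the centre `χ = 0` of the
polar coordinates makes no difference. -/
def LocallyFLRWOn {E : Type*} [NormedAddCommGroup E] [NormedSpace ℝ E]
    {H : Type*} [TopologicalSpace H] (I : ModelWithCorners ℝ E H)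
    {M : Type*} [TopologicalSpace M] [ChartedSpace H M] (m : ℕ)
    (g : Tensor2 I M) (V : Set M) : Prop :=
  ∀ x ∈ V, ∃ (J : Set ℝ) (a : ℝ → ℝ) (k : ℝ) (φ : OpenPartialHomeomorph M ((ℝ × ℝ) × Sph m)),
    IsOpen J ∧ J.OrdConnected ∧ ContDiffOn ℝ ∞ a J ∧ (∀ t ∈ J, 0 < a t) ∧
    x ∈ φ.source ∧ φ.source ⊆ V ∧ φ.target ⊆ flrwDomain m J k ∧
    ContMDiffOn I (𝓘(ℝ, ℝ × ℝ).prod (𝓡 m)) ∞ φ φ.source ∧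
    ContMDiffOn (𝓘(ℝ, ℝ × ℝ).prod (𝓡 m)) I ∞ φ.symm φ.target ∧
    ∀ y ∈ φ.source, pullback I (𝓘(ℝ, ℝ × ℝ).prod (𝓡 m)) φ (flrw m a k) y = g y

end WarpedKilling

end

open WarpedKilling

/-!
All computations take place in charts: extended charts of `N`, stereographic charts of the sphere,
where the round metric is `(1 + |y|² / 4)⁻²` times the Euclidean one, and products of the two. In
such a chart the Killing equation is a first-order linear system (`CoordKilling`), and for a warped
product it splits into a base block, a mixed block and a spherical block
(`coordKilling_warped_iff`).

*The algebra is finite-dimensional.* The second derivative of a Killing field is a linear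
expression in its first-order jet (`abs_metric_second_deriv_le`), so Grönwall's inequality along
segments shows that a field with vanishing jet at a point is zero (`eq_zero_of_killing_equation`,
`IsKilling.eq_zero`): the algebra embeds into the space of jets.

*The base has a nonzero Killing field.* Let `A_b` be the component tangent to `N` of a Killing field
of `g` along `N × {b}`. The base block says that `A_b` is Killing for `h` (`isKilling_baseSlice`).
If `A_b = 0` for every `b`, the field is determined by the value and the skew-symmetric derivative
of its spherical part at one point, which are `m (m + 1) / 2` numbers (`sphereJet_eq_zero`). The
dimension assumption thus yields a Killing field with `A_b ≠ 0` for some `b`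
(`exists_baseSlice_ne_zero`).

*`W_{A_b}` does not depend on `b`.* By the mixed block, the derivative of the spherical part along
a vector `u` of the base is minus the gradient on the sphere of `Y = f⁻² h(A_b, u)`, as a function
of `b`; the derivative along `u` of the spherical block then becomes `Hess Y = G γ` on the sphere,
where `γ` is the round metric and `G = d(A_b(ln f))(u)`. The integrability condition of this
equation, which needs `m ≥ 2`, is that `Y + G` is constant (`concircular_add_const`,
`slice_form_const`), and `f² (Y + G) = h(W_{A_b}, u)` (`wField_baseSlice_eq`).

*Independent `W_a`.* Then `X ↦ W_X` is injective on Killing fields of the base, so `A_b = ξ` is the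
same field for all `b`. The spherical block now says that the spherical part is a homothetic field
of the round sphere with factor `-ξ(ln f)`. Homothetic fields of the sphere are Killing
(`homothety_factor_eq_zero`), hence `ξ(f) = 0` (`exists_killing_dirDeriv_eq_zero`).

*Dependent `W_a`.* If `W_X = 0`, that is `h(X, ·) = -f² d(X(ln f))`, the Killing equation for `ξ^i`
follows from the conformal equation of `Z^i`, whose factor is `-Y^i` (`isKilling_xiField`, from the
more general `isKilling_prodField`). Evaluation at the coordinate points of the sphere gives the
linear independence (`linearIndependent_xiZeta`), and counting gives the dimension
(`le_rank_killingAlgebra`).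

*FLRW form.* Where `X` is spacelike, put `u = X(f) / f`. Since `X` is Killing with
`h(X, ·) = -f² du`, the function `h(X, X) / f² - u²` is a constant `k`
(`IsSpacelikeData.exists_curvature`). The unit one-form annihilating `X` is closed, and its
primitive is the time `t` (`IsSpacelikeData.exists_time`). Let `χ` be the function of `u` with
`S_k(χ) = 1 / √(k + u²)` and `dχ² = du² / (k + u²)²` (`exists_radius`). With `a² = h(X, X)`, which
depends on `t` only because it is constant along `X`, one finds `h = -dt² + a² dχ²` and
`f = a S_k(χ)`. The inverse function theorem makes `(t, χ)` a chart
(`IsSpacelikeData.exists_flrw_chart`, `locallyFLRWOn_of_spacelike`).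
-/

noncomputable section

namespace WarpedKilling

set_option maxSynthPendingDepth 3
set_option synthInstance.maxHeartbeats 100000

/-! ### Vector fields and metrics in charts -/

section Coord

variable {E : Type*} [NormedAddCommGroup E] [NormedSpace ℝ E]
  {H : Type*} [TopologicalSpace H] {I : ModelWithCorners ℝ E H}
  {M : Type*} [TopologicalSpace M] [ChartedSpace H M]

variable (I) in
/-- The frame of coordinate vectors of the chart at `x₀`: it sends a coordinate vector at `e` to
the tangent vector of `M` that it represents. -/
def frame (x₀ : M) (e : E) : E →L[ℝ] TangentSpace I ((extChartAt I x₀).symm e) :=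
  mfderiv 𝓘(ℝ, E) I (extChartAt I x₀).symm e

variable (I) in
/-- The coordinates of tangent vectors at `x` in the chart at `x₀`. -/
def coframe (x₀ x : M) : TangentSpace I x →L[ℝ] E :=
  mfderiv I 𝓘(ℝ, E) (extChartAt I x₀) x

variable (I) in
/-- The coordinate expression of the vector field `X` in the chart at `x₀`. -/
def coordField (x₀ : M) (X : VField I M) : E → E :=
  fun e => coframe I x₀ ((extChartAt I x₀).symm e) (X ((extChartAt I x₀).symm e))

variable (I) in
/-- The coordinate expression of the tensor `g` in the chart at `x₀`. -/
def coordMetric (x₀ : M) (g : Tensor2 I M) : E → E →L[ℝ] E →L[ℝ] ℝ :=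
  fun e => pullback 𝓘(ℝ, E) I (extChartAt I x₀).symm g e

variable (I) in
/-- The field on `M` whose coordinate expression in the chart at `x₀` is the constant `u`. -/
def constField (x₀ : M) (u : E) : VField I M :=
  fun x => mfderiv 𝓘(ℝ, E) I (extChartAt I x₀).symm (extChartAt I x₀ x) u

theorem coordMetric_apply (x₀ : M) (g : Tensor2 I M) (e u v : E) :
    coordMetric I x₀ g e u v = g ((extChartAt I x₀).symm e) (frame I x₀ e u) (frame I x₀ e v) :=
  rfl

variable [I.Boundaryless] [IsManifold I ∞ M]

theorem coframe_frame (x₀ : M) {e : E} (he : e ∈ (extChartAt I x₀).target) (u : E) :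
    coframe I x₀ ((extChartAt I x₀).symm e) (frame I x₀ e u) = u := by
  have : IsManifold I 1 M := IsManifold.of_le (n := ∞) (by norm_cast)
  have h := mfderiv_extChartAt_comp_mfderivWithin_extChartAt_symm (I := I) he
  rw [I.range_eq_univ, mfderivWithin_univ] at h
  exact DFunLike.congr_fun h u

theorem frame_coframe (x₀ : M) {e : E} (he : e ∈ (extChartAt I x₀).target)
    (v : TangentSpace I ((extChartAt I x₀).symm e)) :
    frame I x₀ e (coframe I x₀ ((extChartAt I x₀).symm e) v) = v := by
  have : IsManifold I 1 M := IsManifold.of_le (n := ∞) (by norm_cast)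
  have h := mfderivWithin_extChartAt_symm_comp_mfderiv_extChartAt (I := I) he
  rw [I.range_eq_univ, mfderivWithin_univ] at h
  exact DFunLike.congr_fun h v

theorem frame_coordField (x₀ : M) {e : E} (he : e ∈ (extChartAt I x₀).target) (X : VField I M) :
    frame I x₀ e (coordField I x₀ X e) = X ((extChartAt I x₀).symm e) :=
  frame_coframe x₀ he _

omit [I.Boundaryless] [IsManifold I ∞ M] in
theorem constField_symm (x₀ : M) {e : E} (he : e ∈ (extChartAt I x₀).target) (u : E) :
    constField I x₀ u ((extChartAt I x₀).symm e) = frame I x₀ e u := by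
  have h : ∀ e' : E, e' = e → (mfderiv 𝓘(ℝ, E) I (extChartAt I x₀).symm e' u : E) =
      mfderiv 𝓘(ℝ, E) I (extChartAt I x₀).symm e u := by rintro _ rfl; rfl
  exact h _ ((extChartAt I x₀).right_inv he)

theorem coordField_constField (x₀ : M) {e : E} (he : e ∈ (extChartAt I x₀).target) (u : E) :
    coordField I x₀ (constField I x₀ u) e = u := by
  rw [coordField, constField_symm x₀ he, coframe_frame x₀ he]

theorem coordMetric_coordField (x₀ : M) (g : Tensor2 I M) {e : E}
    (he : e ∈ (extChartAt I x₀).target) (X Y : VField I M) :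
    coordMetric I x₀ g e (coordField I x₀ X e) (coordField I x₀ Y e) =
      g ((extChartAt I x₀).symm e) (X _) (Y _) := by
  rw [coordMetric_apply, frame_coordField x₀ he, frame_coordField x₀ he]

theorem contMDiffAt_extChartAt_symm (x₀ : M) {e : E} (he : e ∈ (extChartAt I x₀).target) :
    ContMDiffAt 𝓘(ℝ, E) I ∞ (extChartAt I x₀).symm e :=
  (contMDiffOn_extChartAt_symm x₀).contMDiffAt ((isOpen_extChartAt_target x₀).mem_nhds he)

theorem contMDiffAt_iff_contDiffAt_comp_symm {F : Type*} [NormedAddCommGroup F] [NormedSpace ℝ F]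
    {n : ℕ∞} (x₀ : M) {e : E} (he : e ∈ (extChartAt I x₀).target) (u : M → F) :
    ContMDiffAt I 𝓘(ℝ, F) n u ((extChartAt I x₀).symm e) ↔
      ContDiffAt ℝ n (fun e' => u ((extChartAt I x₀).symm e')) e := by
  have hn : (n : ℕ∞ω) ≤ ∞ := by exact_mod_cast le_top
  have hs := (extChartAt I x₀).map_target he
  constructor
  · intro h
    exact (h.comp e ((contMDiffAt_extChartAt_symm x₀ he).of_le hn)).contDiffAt
  · intro h
    have h2 : ContMDiffAt I 𝓘(ℝ, E) ∞ (extChartAt I x₀) ((extChartAt I x₀).symm e) :=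
      contMDiffAt_extChartAt' (by rwa [← extChartAt_source I])
    have h3 : ContMDiffAt 𝓘(ℝ, E) 𝓘(ℝ, F) n (fun e' => u ((extChartAt I x₀).symm e'))
        (extChartAt I x₀ ((extChartAt I x₀).symm e)) := by
      rw [(extChartAt I x₀).right_inv he]; exact h.contMDiffAt
    refine (h3.comp _ (h2.of_le hn)).congr_of_eventuallyEq ?_
    filter_upwards [extChartAt_source_mem_nhds' hs] with x hx
    simp only [Function.comp_apply, (extChartAt I x₀).left_inv hx]

theorem mvfderiv_apply_eq_fderiv (x₀ : M) {e : E} (he : e ∈ (extChartAt I x₀).target) (u : M → ℝ)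
    (hu : MDifferentiableAt I 𝓘(ℝ, ℝ) u ((extChartAt I x₀).symm e)) (w : E) :
    mvfderiv I u ((extChartAt I x₀).symm e) (frame I x₀ e w) =
      fderiv ℝ (fun e' => u ((extChartAt I x₀).symm e')) e w := by
  have h := mvfderiv_comp_apply (I' := 𝓘(ℝ, E)) (f := (extChartAt I x₀).symm) e hu
    ((contMDiffAt_extChartAt_symm x₀ he).mdifferentiableAt (by simp)) w
  refine h.symm.trans ?_
  simp only [mvfderiv, mfderiv_eq_fderiv]
  rfl

theorem dirDeriv_eq_fderiv (x₀ : M) {e : E} (he : e ∈ (extChartAt I x₀).target) (u : M → ℝ)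
    (hu : MDifferentiableAt I 𝓘(ℝ, ℝ) u ((extChartAt I x₀).symm e)) (X : VField I M) :
    dirDeriv I X u ((extChartAt I x₀).symm e) =
      fderiv ℝ (fun e' => u ((extChartAt I x₀).symm e')) e (coordField I x₀ X e) := by
  rw [← mvfderiv_apply_eq_fderiv x₀ he u hu, frame_coordField x₀ he]
  rfl

theorem smoothFieldAt_iff (x₀ : M) {e : E} (he : e ∈ (extChartAt I x₀).target) (X : VField I M) :
    SmoothFieldAt I X ((extChartAt I x₀).symm e) ↔ ContDiffAt ℝ ∞ (coordField I x₀ X) e := by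
  have : IsManifold I 1 M := IsManifold.of_le (n := ∞) (by norm_cast)
  have hs := (extChartAt I x₀).map_target he
  have hs' := hs
  rw [extChartAt_source] at hs'
  have h1 := (trivializationAt E (TangentSpace I) x₀).contMDiffAt_section_iff (n := ∞) (IB := I)
    (s := X) (x₀ := (extChartAt I x₀).symm e) (by simpa using hs')
  unfold SmoothFieldAt
  rw [h1, contMDiffAt_iff_contDiffAt_comp_symm x₀ he]
  refine (fun hE => ⟨fun h => h.congr_of_eventuallyEq hE.symm, fun h => h.congr_of_eventuallyEq hE⟩ :
    (_ =ᶠ[nhds e] _) → _) ?_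
  filter_upwards [(isOpen_extChartAt_target x₀).mem_nhds he] with e' he'
  have hs2 := (extChartAt I x₀).map_target he'
  rw [extChartAt_source] at hs2
  have h2 := TangentBundle.continuousLinearMapAt_trivializationAt (𝕜 := ℝ) (I := I) hs2
  have h3 := DFunLike.congr_fun h2 (X ((extChartAt I x₀).symm e'))
  refine Eq.trans ?_ h3
  rw [Bundle.Trivialization.continuousLinearMapAt_apply, Bundle.Trivialization.linearMapAt_apply,
    if_pos (by simpa using hs2)]

theorem smoothFieldAt_iff_self (x₀ : M) (X : VField I M) :
    SmoothFieldAt I X x₀ ↔ ContDiffAt ℝ ∞ (coordField I x₀ X) (extChartAt I x₀ x₀) := by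
  have h := smoothFieldAt_iff x₀ (mem_extChartAt_target (I := I) x₀) X
  rwa [extChartAt_to_inv] at h

theorem smoothFieldAt_constField (x₀ : M) {e : E} (he : e ∈ (extChartAt I x₀).target) (u : E) :
    SmoothFieldAt I (constField I x₀ u) ((extChartAt I x₀).symm e) := by
  rw [smoothFieldAt_iff x₀ he]
  refine (contDiffAt_const (c := u)).congr_of_eventuallyEq ?_
  filter_upwards [(isOpen_extChartAt_target x₀).mem_nhds he] with e' he'
  exact coordField_constField x₀ he' u

theorem mpullback_extChartAt_symm (x₀ : M) {e : E} (he : e ∈ (extChartAt I x₀).target)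
    (X : VField I M) :
    VectorField.mpullback 𝓘(ℝ, E) I (extChartAt I x₀).symm X e = coordField (E := E) I x₀ X e := by
  have : IsManifold I 1 M := IsManifold.of_le (n := ∞) (by norm_cast)
  have hinv := isInvertible_mfderivWithin_extChartAt_symm (I := I) he
  rw [I.range_eq_univ, mfderivWithin_univ] at hinv
  rw [VectorField.mpullback_apply, ← frame_coordField x₀ he X]
  exact hinv.inverse_apply_eq.2 rfl

omit [IsManifold I ∞ M] [I.Boundaryless] in
theorem mlieBracket_modelSpace (V W : (x : E) → TangentSpace 𝓘(ℝ, E) x) (e : E) :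
    VectorField.mlieBracket 𝓘(ℝ, E) V W e =
      fderiv ℝ (W : E → E) e (V e) - fderiv ℝ (V : E → E) e (W e) := by
  rw [← VectorField.mlieBracketWithin_univ, VectorField.mlieBracketWithin_eq_lieBracketWithin]
  exact congrFun (VectorField.lieBracketWithin_univ (𝕜 := ℝ) (V := (V : E → E)) (W := (W : E → E))) e

/-- The Lie bracket in a chart. -/
theorem mlieBracket_eq_frame [CompleteSpace E] (x₀ : M) {e : E}
    (he : e ∈ (extChartAt I x₀).target) (X Y : VField I M)
    (hX : SmoothFieldAt I X ((extChartAt I x₀).symm e))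
    (hY : SmoothFieldAt I Y ((extChartAt I x₀).symm e)) :
    VectorField.mlieBracket I X Y ((extChartAt I x₀).symm e) =
      frame I x₀ e (fderiv ℝ (coordField I x₀ Y) e (coordField I x₀ X e) -
          fderiv ℝ (coordField I x₀ X) e (coordField I x₀ Y e)) := by
  have : IsManifold I (minSmoothness ℝ 2) M := by
    rw [minSmoothness_of_isRCLikeNormedField]; exact IsManifold.of_le (n := ∞) (by norm_cast)
  have h := VectorField.mpullback_mlieBracket hX.mdifferentiableAt hY.mdifferentiableAt
    (contMDiffAt_extChartAt_symm x₀ he)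
    (by rw [minSmoothness_of_isRCLikeNormedField]; norm_cast)
  have hEq : ∀ Z : VField I M, VectorField.mpullback 𝓘(ℝ, E) I (extChartAt I x₀).symm Z
      =ᶠ[nhds e] coordField (E := E) I x₀ Z := by
    intro Z
    filter_upwards [(isOpen_extChartAt_target x₀).mem_nhds he] with e' he'
    exact mpullback_extChartAt_symm x₀ he' Z
  rw [(hEq X).mlieBracket_vectorField_eq (hEq Y), mpullback_extChartAt_symm x₀ he]
    at h
  rw [← frame_coordField x₀ he (VectorField.mlieBracket I X Y)]
  exact congrArg (frame I x₀ e) (h.trans (mlieBracket_modelSpace _ _ e))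

/-- The tensor `g` is smooth in charts: each chart has smooth metric coefficients. -/
def IsSmoothMetric (g : Tensor2 I M) : Prop :=
  ∀ (x₀ : M) (u v : E),
    ContDiffOn ℝ ∞ (fun e => coordMetric I x₀ g e u v) (extChartAt I x₀).target

/-- The Killing equation in the chart at `x₀`, at the point with coordinates `e`. -/
def CoordKilling (x₀ : M) (g : Tensor2 I M) (X : VField I M) (e : E) : Prop :=
  ∀ u v : E,
    fderiv ℝ (fun e' => coordMetric I x₀ g e' u v) e (coordField I x₀ X e) +
      coordMetric I x₀ g e (fderiv ℝ (coordField I x₀ X) e u) v +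
      coordMetric I x₀ g e u (fderiv ℝ (coordField I x₀ X) e v) = 0

omit [I.Boundaryless] [IsManifold I ∞ M] in
theorem IsSmoothMetric.contDiffOn [FiniteDimensional ℝ E] {g : Tensor2 I M}
    (hg : IsSmoothMetric g) (x₀ : M) :
    ContDiffOn ℝ ∞ (coordMetric I x₀ g) (extChartAt I x₀).target := by
  rw [contDiffOn_clm_apply]
  intro u
  rw [contDiffOn_clm_apply]
  exact hg x₀ u

/-- A Killing field satisfies the Killing equation in every chart: apply the invariant equation to
fields with constant coordinates. -/
theorem IsKilling.coordKilling [CompleteSpace E] {g : Tensor2 I M} (hg : IsSmoothMetric g)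
    {X : VField I M} (hX : IsKilling I g X) (x₀ : M) {e : E} (he : e ∈ (extChartAt I x₀).target) :
    CoordKilling x₀ g X e := by
  intro u v
  have hu := smoothFieldAt_constField x₀ he u
  have hv := smoothFieldAt_constField x₀ he v
  have h := hX.2 _ _ _ hu hv
  have hEq : (fun e' => g ((extChartAt I x₀).symm e') (constField I x₀ u _) (constField I x₀ v _))
      =ᶠ[nhds e] fun e' => coordMetric I x₀ g e' u v := by
    filter_upwards [(isOpen_extChartAt_target x₀).mem_nhds he] with e' he'
    rw [constField_symm x₀ he', constField_symm x₀ he', coordMetric_apply]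
  have hsm : ContDiffAt ℝ ∞ (fun e' => coordMetric I x₀ g e' u v) e :=
    (hg x₀ u v).contDiffAt ((isOpen_extChartAt_target x₀).mem_nhds he)
  have hconst : ∀ w : E, fderiv ℝ (coordField I x₀ (constField I x₀ w)) e = 0 := by
    intro w
    have : coordField I x₀ (constField I x₀ w) =ᶠ[nhds e] fun _ => w := by
      filter_upwards [(isOpen_extChartAt_target x₀).mem_nhds he] with e' he'
      exact coordField_constField x₀ he' w
    rw [this.fderiv_eq]; simp
  rw [dirDeriv_eq_fderiv x₀ he, hEq.fderiv_eq,
    mlieBracket_eq_frame x₀ he _ _ (hX.1 _) hu, mlieBracket_eq_frame x₀ he _ _ (hX.1 _) hv,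
    hconst, hconst, constField_symm x₀ he, constField_symm x₀ he, ← coordMetric_apply,
    ← coordMetric_apply, coordField_constField x₀ he, coordField_constField x₀ he] at h
  · rw [h]
    simp
  · have := (contMDiffAt_iff_contDiffAt_comp_symm (n := ⊤) x₀ he
      (fun x => g x (constField I x₀ u x) (constField I x₀ v x))).2
        (hsm.congr_of_eventuallyEq hEq)
    exact this.mdifferentiableAt (by simp)

/-- The Killing equation at one point of a chart gives the invariant Killing equation there, for all
smooth fields `Y` and `Z`. -/
theorem lieDerivative_eq_of_coordKilling [FiniteDimensional ℝ E] [CompleteSpace E]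
    {g : Tensor2 I M} (hg : IsSmoothMetric g) {X : VField I M} (x₀ : M) {e : E}
    (he : e ∈ (extChartAt I x₀).target) (hX : SmoothFieldAt I X ((extChartAt I x₀).symm e))
    (hK : CoordKilling x₀ g X e) (Y Z : VField I M)
    (hY : SmoothFieldAt I Y ((extChartAt I x₀).symm e))
    (hZ : SmoothFieldAt I Z ((extChartAt I x₀).symm e)) :
    dirDeriv I X (fun y => g y (Y y) (Z y)) ((extChartAt I x₀).symm e) =
      g _ (VectorField.mlieBracket I X Y ((extChartAt I x₀).symm e)) (Z _) +
        g _ (Y _) (VectorField.mlieBracket I X Z ((extChartAt I x₀).symm e)) := by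
  have hEq : (fun e' => g ((extChartAt I x₀).symm e') (Y _) (Z _))
      =ᶠ[nhds e] fun e' => coordMetric I x₀ g e' (coordField I x₀ Y e') (coordField I x₀ Z e') := by
    filter_upwards [(isOpen_extChartAt_target x₀).mem_nhds he] with e' he'
    rw [coordMetric_coordField x₀ g he']
  have hgc : ContDiffAt ℝ ∞ (coordMetric I x₀ g) e :=
    (hg.contDiffOn x₀).contDiffAt ((isOpen_extChartAt_target x₀).mem_nhds he)
  have hYc := (smoothFieldAt_iff x₀ he Y).1 hY
  have hZc := (smoothFieldAt_iff x₀ he Z).1 hZ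
  have hsm : ContDiffAt ℝ ∞
      (fun e' => coordMetric I x₀ g e' (coordField I x₀ Y e') (coordField I x₀ Z e')) e :=
    (hgc.clm_apply hYc).clm_apply hZc
  have hgd := (hgc.differentiableAt (by simp)).hasFDerivAt
  have hYd := (hYc.differentiableAt (by simp)).hasFDerivAt
  have hZd := (hZc.differentiableAt (by simp)).hasFDerivAt
  have hD := ((hgd.clm_apply hYd).clm_apply hZd).fderiv
  have hk := hK (coordField I x₀ Y e) (coordField I x₀ Z e)
  have hgk := (((hgd.clm_apply (hasFDerivAt_const (coordField I x₀ Y e) e))).clm_apply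
    (hasFDerivAt_const (coordField I x₀ Z e) e)).fderiv
  rw [hgk] at hk
  rw [dirDeriv_eq_fderiv x₀ he, hEq.fderiv_eq,
    mlieBracket_eq_frame x₀ he _ _ hX hY, mlieBracket_eq_frame x₀ he _ _ hX hZ,
    ← frame_coordField x₀ he Y, ← frame_coordField x₀ he Z, ← coordMetric_apply,
    ← coordMetric_apply, hD]
  · simp at hk ⊢
    linarith
  · have := (contMDiffAt_iff_contDiffAt_comp_symm (n := ⊤) x₀ he
      (fun x => g x (Y x) (Z x))).2 (hsm.congr_of_eventuallyEq hEq)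
    exact this.mdifferentiableAt (by simp)

/-- A smooth field is Killing as soon as it satisfies the Killing equation at the centre of each
chart. -/
theorem isKilling_of_coordKilling [FiniteDimensional ℝ E] [CompleteSpace E]
    {g : Tensor2 I M} (hg : IsSmoothMetric g) {X : VField I M} (hX : ∀ x, SmoothFieldAt I X x)
    (hK : ∀ x, CoordKilling x g X (extChartAt I x x)) : IsKilling I g X := by
  refine ⟨hX, fun Y Z x hY hZ => ?_⟩
  have hx := extChartAt_to_inv (I := I) x
  have h := lieDerivative_eq_of_coordKilling hg x (mem_extChartAt_target (I := I) x)
    (by rw [hx]; exact hX x) (hK x) Y Z (by rw [hx]; exact hY) (by rw [hx]; exact hZ)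
  rwa [hx] at h

end Coord

/-! ### Killing fields are determined by their first-order jet at a point -/

section Prolongation

variable {E : Type*} [NormedAddCommGroup E] [NormedSpace ℝ E] [FiniteDimensional ℝ E]

/-- On a compact set, a continuous family of nondegenerate bilinear forms is uniformly
nondegenerate. -/
theorem exists_norm_le_mul_norm_of_nondegenerate {K : Set E} (hK : IsCompact K)
    {G : E → E →L[ℝ] E →L[ℝ] ℝ} (hG : ContinuousOn G K)
    (hnd : ∀ e ∈ K, ∀ v, (∀ w, G e v w = 0) → v = 0) :
    ∃ C : ℝ, 0 ≤ C ∧ ∀ e ∈ K, ∀ w, ‖w‖ ≤ C * ‖G e w‖ := by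
  have hpos : ∀ p ∈ K ×ˢ Metric.sphere (0 : E) 1, 0 < ‖G p.1 p.2‖ := by
    rintro ⟨e, w⟩ ⟨he, hw⟩
    rw [norm_pos_iff]
    intro h0
    have hw0 : w = 0 := hnd e he w (fun z => by
      have : G e w = 0 := h0
      simp [this])
    simp [hw0] at hw
  have hcont : ContinuousOn (fun p : E × E => ‖G p.1 p.2‖) (K ×ˢ Metric.sphere (0 : E) 1) :=
    ((hG.comp continuousOn_fst (fun p hp => hp.1)).clm_apply continuousOn_snd).norm
  rcases (K ×ˢ Metric.sphere (0 : E) 1).eq_empty_or_nonempty with hem | hne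
  · refine ⟨0, le_rfl, fun e he w => ?_⟩
    by_contra hcon
    have hw : w ≠ 0 := by rintro rfl; simp at hcon
    have : (e, ‖w‖⁻¹ • w) ∈ K ×ˢ Metric.sphere (0 : E) 1 := by
      refine ⟨he, ?_⟩
      simp [norm_smul, hw]
    rw [hem] at this
    exact this
  · obtain ⟨p, hp, hmin⟩ := (hK.prod (isCompact_sphere (0 : E) 1)).exists_isMinOn hne hcont
    have hc := hpos p hp
    refine ⟨‖G p.1 p.2‖⁻¹, (inv_pos.2 hc).le, fun e he w => ?_⟩
    rcases eq_or_ne w 0 with rfl | hw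
    · simp
    have hw' : 0 < ‖w‖ := norm_pos_iff.2 hw
    have hmem : (e, ‖w‖⁻¹ • w) ∈ K ×ˢ Metric.sphere (0 : E) 1 := by
      refine ⟨he, ?_⟩
      simp [norm_smul, hw]
    have hmin' : ∀ q ∈ K ×ˢ Metric.sphere (0 : E) 1, ‖G p.1 p.2‖ ≤ ‖G q.1 q.2‖ := hmin
    have h1 := hmin' (e, ‖w‖⁻¹ • w) hmem
    dsimp only at h1
    rw [map_smul, norm_smul, norm_inv, norm_norm] at h1
    rw [inv_mul_eq_div, le_div_iff₀ hc]
    rw [inv_mul_eq_div, le_div_iff₀ hw'] at h1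
    linarith

omit [FiniteDimensional ℝ E] in
/-- The prolonged Killing equation: the second derivative of a solution of the Killing equation is
controlled by the solution and its first derivative. As for the Levi-Civita connection, three
cyclic permutations of the differentiated equation isolate `G (D²X (w, u), v)`. -/
theorem abs_metric_second_deriv_le {U : Set E} (hU : IsOpen U)
    {G : E → E →L[ℝ] E →L[ℝ] ℝ} (hG : ContDiffOn ℝ ∞ G U) (hsymm : ∀ e ∈ U, ∀ v w, G e v w = G e w v)
    {X : E → E} (hX : ContDiffOn ℝ ∞ X U)
    (hK : ∀ e ∈ U, ∀ u v, fderiv ℝ G e (X e) u v + G e (fderiv ℝ X e u) v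
      + G e u (fderiv ℝ X e v) = 0) {e : E} (he : e ∈ U) (u v w : E) :
    |G e (fderiv ℝ (fderiv ℝ X) e w u) v| ≤
      (3 / 2) * (‖fderiv ℝ (fderiv ℝ G) e‖ * ‖X e‖ + 3 * (‖fderiv ℝ G e‖ * ‖fderiv ℝ X e‖)) *
        (‖u‖ * ‖v‖ * ‖w‖) := by
  have hUe := hU.mem_nhds he
  have hGe := hG.contDiffAt hUe
  have hXe := hX.contDiffAt hUe
  have hG1 := (hGe.differentiableAt (by simp)).hasFDerivAt
  have hX1 := (hXe.differentiableAt (by simp)).hasFDerivAt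
  have hG2 := ((hGe.fderiv_right (m := ∞) (by simp)).differentiableAt (by simp)).hasFDerivAt
  have hX2 := ((hXe.fderiv_right (m := ∞) (by simp)).differentiableAt (by simp)).hasFDerivAt
  have hsym2 : ∀ a b, fderiv ℝ (fderiv ℝ X) e a b = fderiv ℝ (fderiv ℝ X) e b a := fun a b =>
    (hXe.isSymmSndFDerivAt (by
      rw [minSmoothness_of_isRCLikeNormedField]; norm_cast)) a b
  set A := fderiv ℝ (fderiv ℝ G) e with hA
  set B := fderiv ℝ G e with hB
  set D := fderiv ℝ X e with hD
  set T := fderiv ℝ (fderiv ℝ X) e with hT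
  have key : ∀ w u v : E, A w (X e) u v + B (D w) u v + (B w (D u) v + G e (T w u) v)
      + (B w u (D v) + G e u (T w v)) = 0 := by
    intro w u v
    have hc : ∀ z : E, HasFDerivAt (fun _ : E => z) (0 : E →L[ℝ] E) e := fun z =>
      hasFDerivAt_const z e
    have h1 := ((hG2.clm_apply hX1).clm_apply (hc u)).clm_apply (hc v)
    have h2 := (hG1.clm_apply (hX2.clm_apply (hc u))).clm_apply (hc v)
    have h3 := (hG1.clm_apply (hc u)).clm_apply (hX2.clm_apply (hc v))
    have h := ((h1.add h2).add h3).fderiv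
    have hz : (fun e' => fderiv ℝ G e' (X e') u v) + (fun e' => G e' (fderiv ℝ X e' u) v)
        + (fun e' => G e' u (fderiv ℝ X e' v)) =ᶠ[nhds e] fun _ => (0 : ℝ) := by
      filter_upwards [hUe] with e' he'
      exact hK e' he' u v
    rw [hz.fderiv_eq] at h
    have h' := DFunLike.congr_fun h w
    simp at h'
    linarith
  have hbound : ∀ w u v : E, |A w (X e) u v + B (D w) u v + B w (D u) v + B w u (D v)| ≤
      (‖A‖ * ‖X e‖ + 3 * (‖B‖ * ‖D‖)) * (‖u‖ * ‖v‖ * ‖w‖) := by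
    intro w u v
    have b1 : |A w (X e) u v| ≤ ‖A‖ * ‖X e‖ * (‖u‖ * ‖v‖ * ‖w‖) := by
      calc |A w (X e) u v| ≤ ‖A w (X e)‖ * ‖u‖ * ‖v‖ := (A w (X e)).le_opNorm₂ u v
        _ ≤ (‖A‖ * ‖w‖ * ‖X e‖) * ‖u‖ * ‖v‖ := by gcongr; exact A.le_opNorm₂ w (X e)
        _ = _ := by ring
    have bB : ∀ a b c : E, |B a b c| ≤ ‖B‖ * ‖a‖ * ‖b‖ * ‖c‖ := fun a b c =>
      calc |B a b c| ≤ ‖B a‖ * ‖b‖ * ‖c‖ := (B a).le_opNorm₂ b c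
        _ ≤ _ := by gcongr; exact B.le_opNorm a
    have b2 : |B (D w) u v| ≤ ‖B‖ * ‖D‖ * (‖u‖ * ‖v‖ * ‖w‖) := by
      calc |B (D w) u v| ≤ _ := bB _ _ _
        _ ≤ ‖B‖ * (‖D‖ * ‖w‖) * ‖u‖ * ‖v‖ := by gcongr; exact D.le_opNorm w
        _ = _ := by ring
    have b3 : |B w (D u) v| ≤ ‖B‖ * ‖D‖ * (‖u‖ * ‖v‖ * ‖w‖) := by
      calc |B w (D u) v| ≤ _ := bB _ _ _
        _ ≤ ‖B‖ * ‖w‖ * (‖D‖ * ‖u‖) * ‖v‖ := by gcongr; exact D.le_opNorm u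
        _ = _ := by ring
    have b4 : |B w u (D v)| ≤ ‖B‖ * ‖D‖ * (‖u‖ * ‖v‖ * ‖w‖) := by
      calc |B w u (D v)| ≤ _ := bB _ _ _
        _ ≤ ‖B‖ * ‖w‖ * ‖u‖ * (‖D‖ * ‖v‖) := by gcongr; exact D.le_opNorm v
        _ = _ := by ring
    calc _ ≤ |A w (X e) u v| + |B (D w) u v| + |B w (D u) v| + |B w u (D v)| :=
          (abs_add_le _ _).trans (by gcongr; exact (abs_add_le _ _).trans (by gcongr; exact abs_add_le _ _))
      _ ≤ _ := by linarith
  have k1 := key w u v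
  have k2 := key v w u
  have k3 := key u v w
  rw [hsymm e he u (T w v)] at k1
  rw [hsymm e he w (T v u)] at k2
  rw [hsymm e he v (T u w)] at k3
  have s1 := hsym2 w v
  have s2 := hsym2 u v
  have s3 := hsym2 u w
  rw [s1] at k1
  rw [s2, s3] at k3
  have c1 := abs_le.1 (hbound w u v)
  have c2 := abs_le.1 (hbound v w u)
  have c3 := abs_le.1 (hbound u v w)
  have e2 : ‖w‖ * ‖u‖ * ‖v‖ = ‖u‖ * ‖v‖ * ‖w‖ := by ring
  have e3 : ‖v‖ * ‖w‖ * ‖u‖ = ‖u‖ * ‖v‖ * ‖w‖ := by ring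
  rw [e2] at c2
  rw [e3] at c3
  rw [abs_le]
  constructor <;> linarith [c1.1, c1.2, c2.1, c2.2, c3.1, c3.2]

/-- A solution of the Killing equation on a convex open set vanishes if its first-order jet
vanishes at one point: along a segment the jet satisfies a linear differential inequality. -/
theorem eq_zero_of_killing_equation {U : Set E} (hU : IsOpen U) (hconv : Convex ℝ U)
    {G : E → E →L[ℝ] E →L[ℝ] ℝ} (hG : ContDiffOn ℝ ∞ G U) (hsymm : ∀ e ∈ U, ∀ v w, G e v w = G e w v)
    (hnd : ∀ e ∈ U, ∀ v, (∀ w, G e v w = 0) → v = 0)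
    {X : E → E} (hX : ContDiffOn ℝ ∞ X U)
    (hK : ∀ e ∈ U, ∀ u v, fderiv ℝ G e (X e) u v + G e (fderiv ℝ X e u) v
      + G e u (fderiv ℝ X e v) = 0) {e : E} (he : e ∈ U) (h0 : X e = 0) (h1 : fderiv ℝ X e = 0) :
    ∀ z ∈ U, X z = 0 := by
  intro z hz
  set γ : ℝ → E := fun t => e + t • (z - e) with hγ
  have hγU : ∀ t ∈ Set.Icc (0 : ℝ) 1, γ t ∈ U := fun t ht => hconv.add_smul_sub_mem he hz ht
  have hγd : ∀ t, HasDerivAt γ (z - e) t := fun t => by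
    have h := ((hasDerivAt_id t).smul_const (z - e)).const_add e
    rw [one_smul] at h
    exact h
  have hγc : Continuous γ := continuous_iff_continuousAt.2 fun t => (hγd t).continuousAt
  set K := γ '' Set.Icc 0 1 with hKdef
  have hKc : IsCompact K := isCompact_Icc.image hγc
  have hKU : K ⊆ U := by rintro _ ⟨t, ht, rfl⟩; exact hγU t ht
  have hG1 : ContDiffOn ℝ ∞ (fderiv ℝ G) U := hG.fderiv_of_isOpen hU (by simp)
  have hG2 : ContDiffOn ℝ ∞ (fderiv ℝ (fderiv ℝ G)) U := hG1.fderiv_of_isOpen hU (by simp)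
  have hX1 : ContDiffOn ℝ ∞ (fderiv ℝ X) U := hX.fderiv_of_isOpen hU (by simp)
  obtain ⟨C, hC0, hC⟩ := exists_norm_le_mul_norm_of_nondegenerate hKc (hG.continuousOn.mono hKU)
    (fun e he => hnd e (hKU he))
  have hbound : ∀ {F : Type _} [NormedAddCommGroup F] {f : E → F}, ContinuousOn f K →
      ∃ a, 0 ≤ a ∧ ∀ p ∈ K, ‖f p‖ ≤ a := fun hf => by
    obtain ⟨a, ha⟩ := hKc.exists_bound_of_continuousOn hf
    exact ⟨|a|, abs_nonneg a, fun p hp => (ha p hp).trans (le_abs_self a)⟩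
  obtain ⟨a, ha0, ha⟩ := hbound (hG2.continuousOn.mono hKU)
  obtain ⟨b, hb0, hb⟩ := hbound (hG1.continuousOn.mono hKU)
  have hbd : ∀ p ∈ K, ∀ w, ‖fderiv ℝ (fderiv ℝ X) p w‖ ≤
      C * ((3 / 2) * (a * ‖X p‖ + 3 * (b * ‖fderiv ℝ X p‖)) * ‖w‖) := by
    intro p hp w
    refine ContinuousLinearMap.opNorm_le_bound _ (by positivity) fun u => ?_
    refine (hC p hp _).trans ?_
    rw [mul_assoc C]
    gcongr
    refine ContinuousLinearMap.opNorm_le_bound _ (by positivity) fun v => ?_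
    rw [Real.norm_eq_abs]
    refine (abs_metric_second_deriv_le hU hG hsymm hX hK (hKU hp) u v w).trans ?_
    have : 3 / 2 * (a * ‖X p‖ + 3 * (b * ‖fderiv ℝ X p‖)) * ‖w‖ * ‖u‖ * ‖v‖ =
      3 / 2 * (a * ‖X p‖ + 3 * (b * ‖fderiv ℝ X p‖)) * (‖u‖ * ‖v‖ * ‖w‖) := by ring
    rw [this]
    gcongr
    · exact ha p hp
    · exact hb p hp
  have hJ : ∀ t ∈ Set.Icc (0 : ℝ) 1, HasDerivAt (fun t => (X (γ t), fderiv ℝ X (γ t)))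
      (fderiv ℝ X (γ t) (z - e), fderiv ℝ (fderiv ℝ X) (γ t) (z - e)) t := by
    intro t ht
    have hn := hU.mem_nhds (hγU t ht)
    have d1 := ((hX.contDiffAt hn).differentiableAt (by simp)).hasFDerivAt.comp_hasDerivAt t (hγd t)
    have d2 := ((hX1.contDiffAt hn).differentiableAt (by simp)).hasFDerivAt.comp_hasDerivAt t (hγd t)
    exact d1.prodMk d2
  -- Grönwall's inequality for the jet `(X, DX)` along the segment from `e` to `z`
  have hz0 := eq_zero_of_abs_deriv_le_mul_abs_self_of_eq_zero_right
    (f := fun t => (X (γ t), fderiv ℝ X (γ t)))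
    (K := (1 + C * ((3 / 2) * (a + 3 * b))) * ‖z - e‖) (a := 0) (b := 1)
    (fun t ht => (hJ t ht).continuousAt.continuousWithinAt)
    (fun t ht => (hJ t ⟨ht.1, ht.2.le⟩).hasDerivWithinAt) (by simp [hγ, h0, h1]) ?_ 1 (by simp)
  · have := congrArg Prod.fst hz0
    simpa [hγ] using this
  · intro t ht
    have hp : γ t ∈ K := ⟨t, ⟨ht.1, ht.2.le⟩, rfl⟩
    have n1 : ‖X (γ t)‖ ≤ ‖(X (γ t), fderiv ℝ X (γ t))‖ := by
      rw [Prod.norm_mk]; exact le_max_left _ _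
    have n2 : ‖fderiv ℝ X (γ t)‖ ≤ ‖(X (γ t), fderiv ℝ X (γ t))‖ := by
      rw [Prod.norm_mk]; exact le_max_right _ _
    set n := ‖(X (γ t), fderiv ℝ X (γ t))‖
    rw [Prod.norm_mk]
    refine max_le ?_ ?_
    · calc _ ≤ ‖fderiv ℝ X (γ t)‖ * ‖z - e‖ := ContinuousLinearMap.le_opNorm _ _
        _ ≤ n * ‖z - e‖ := by gcongr
        _ ≤ _ := by
          have : 0 ≤ C * ((3 / 2) * (a + 3 * b)) * (‖z - e‖ * n) := by positivity
          nlinarith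
    · calc _ ≤ _ := hbd _ hp (z - e)
        _ ≤ C * ((3 / 2) * (a * n + 3 * (b * n)) * ‖z - e‖) := by gcongr
        _ ≤ _ := by
          have : 0 ≤ ‖z - e‖ * n := by positivity
          nlinarith

end Prolongation

section Rigidity

variable {E : Type*} [NormedAddCommGroup E] [NormedSpace ℝ E] [FiniteDimensional ℝ E]
  {H : Type*} [TopologicalSpace H] {I : ModelWithCorners ℝ E H}
  {M : Type*} [TopologicalSpace M] [ChartedSpace H M] [I.Boundaryless] [IsManifold I ∞ M]

omit [FiniteDimensional ℝ E] in
theorem coordMetric_nondegenerate {g : Tensor2 I M} (hnd : ∀ x v, (∀ w, g x v w = 0) → v = 0)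
    (x₀ : M) {e : E} (he : e ∈ (extChartAt I x₀).target) (v : E)
    (hv : ∀ w, coordMetric I x₀ g e v w = 0) : v = 0 := by
  have h := hnd ((extChartAt I x₀).symm e) (frame I x₀ e v) (fun w => by
    have := hv (coframe I x₀ _ w)
    rwa [coordMetric_apply, frame_coframe x₀ he] at this)
  rw [← coframe_frame x₀ he v, h, map_zero]

theorem IsKilling.eqOn_zero_of_convex [CompleteSpace E] {g : Tensor2 I M} (hg : IsSmoothMetric g)
    (hsymm : ∀ x v w, g x v w = g x w v) (hnd : ∀ x v, (∀ w, g x v w = 0) → v = 0)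
    {X : VField I M} (hX : IsKilling I g X) (x₀ : M) {U : Set E} (hU : IsOpen U)
    (hconv : Convex ℝ U) (hUt : U ⊆ (extChartAt I x₀).target) {e : E} (he : e ∈ U)
    (h0 : coordField I x₀ X e = 0) (h1 : fderiv ℝ (coordField I x₀ X) e = 0) :
    ∀ z ∈ U, coordField I x₀ X z = 0 := by
  have hGs := hg.contDiffOn x₀
  refine eq_zero_of_killing_equation hU hconv (hGs.mono hUt) (fun e he v w => hsymm _ _ _)
    (fun e he => coordMetric_nondegenerate hnd x₀ (hUt he))
    (fun z hz => ((smoothFieldAt_iff x₀ (hUt hz) X).1 (hX.1 _)).contDiffWithinAt) ?_ he h0 h1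
  intro z hz u v
  have h := hX.coordKilling hg x₀ (hUt hz) u v
  have hd := ((hGs.contDiffAt ((isOpen_extChartAt_target x₀).mem_nhds (hUt hz))).differentiableAt
    (by simp)).hasFDerivAt
  have hd2 := ((hd.clm_apply (hasFDerivAt_const u z)).clm_apply (hasFDerivAt_const v z)).fderiv
  rw [hd2] at h
  simpa using h

/-- A Killing field of a nondegenerate metric on a connected manifold is zero as soon as its
first-order jet vanishes at one point. -/
theorem IsKilling.eq_zero [CompleteSpace E] [PreconnectedSpace M] {g : Tensor2 I M}
    (hg : IsSmoothMetric g)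
    (hsymm : ∀ x v w, g x v w = g x w v) (hnd : ∀ x v, (∀ w, g x v w = 0) → v = 0)
    {X : VField I M} (hX : IsKilling I g X) (x₀ : M) {e : E} (he : e ∈ (extChartAt I x₀).target)
    (h0 : coordField I x₀ X e = 0) (h1 : fderiv ℝ (coordField I x₀ X) e = 0) : X = 0 := by
  -- the vanishing of the jet at one point of a chart spreads to a ball, hence to a neighbourhood
  have hloc : ∀ (x₁ : M) (r : ℝ) (c : E), Metric.ball c r ⊆ (extChartAt I x₁).target →
      ∀ e ∈ Metric.ball c r, coordField I x₁ X e = 0 → fderiv ℝ (coordField I x₁ X) e = 0 →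
      ∀ᶠ x in nhds ((extChartAt I x₁).symm c), X x = 0 := by
    intro x₁ r c hr e he h0 h1
    have hz := hX.eqOn_zero_of_convex hg hsymm hnd x₁ Metric.isOpen_ball (convex_ball c r) hr he h0 h1
    have hc : c ∈ Metric.ball c r :=
      Metric.mem_ball_self (dist_nonneg.trans_lt (Metric.mem_ball.1 he))
    have hs := (extChartAt I x₁).map_target (hr hc)
    have hcont : ContinuousAt (extChartAt I x₁) ((extChartAt I x₁).symm c) :=
      continuousAt_extChartAt' hs
    have hb : Metric.ball c r ∈ nhds (extChartAt I x₁ ((extChartAt I x₁).symm c)) := by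
      rw [(extChartAt I x₁).right_inv (hr hc)]
      exact Metric.isOpen_ball.mem_nhds hc
    filter_upwards [hcont.preimage_mem_nhds hb, extChartAt_source_mem_nhds' hs] with x hx hxs
    have h := frame_coordField x₁ (hr hx) X
    rw [hz _ hx, map_zero, (extChartAt I x₁).left_inv hxs] at h
    exact h.symm
  -- the points near which `X` vanishes form an open and closed set
  set S : Set M := {x | ∀ᶠ y in nhds x, X y = 0} with hS
  have hopen : IsOpen S := isOpen_setOfPred_eventually_nhds
  have hclosed : IsClosed S := by
    rw [← closure_subset_iff_isClosed]
    intro x hx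
    obtain ⟨r, hr, hball⟩ := Metric.isOpen_iff.1 (isOpen_extChartAt_target (I := I) x) _
      (mem_extChartAt_target (I := I) x)
    have hnb : (extChartAt I x) ⁻¹' (Metric.ball (extChartAt I x x) r) ∩ (extChartAt I x).source
        ∈ nhds x :=
      Filter.inter_mem ((continuousAt_extChartAt x).preimage_mem_nhds (Metric.ball_mem_nhds _ hr))
        (extChartAt_source_mem_nhds x)
    obtain ⟨y, hy, hyS⟩ := mem_closure_iff_nhds.1 hx _ hnb
    have hyt := hball hy.1
    have hzero : coordField I x X =ᶠ[nhds (extChartAt I x y)] fun _ => 0 := by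
      have hc : ContinuousAt (extChartAt I x).symm (extChartAt I x y) :=
        continuousAt_extChartAt_symm'' hyt
      have hyS' : ∀ᶠ z in nhds ((extChartAt I x).symm (extChartAt I x y)), X z = 0 := by
        rw [(extChartAt I x).left_inv hy.2]; exact hyS
      filter_upwards [hc.eventually hyS'] with e' he'
      rw [coordField, he', map_zero]
    have := hloc x r _ hball _ hy.1 hzero.self_of_nhds (by rw [hzero.fderiv_eq]; simp)
    rwa [extChartAt_to_inv] at this
  obtain ⟨r, hr, hball⟩ := Metric.isOpen_iff.1 (isOpen_extChartAt_target (I := I) x₀) _ he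
  have hne : S.Nonempty := ⟨_, hloc x₀ r e hball e (Metric.mem_ball_self hr) h0 h1⟩
  have huniv := IsClopen.eq_univ ⟨hclosed, hopen⟩ hne
  funext x
  have : x ∈ S := huniv ▸ Set.mem_univ x
  exact this.self_of_nhds

omit [FiniteDimensional ℝ E] [I.Boundaryless] [IsManifold I ∞ M] in
theorem coordField_add (x₀ : M) (X Y : VField I M) (e : E) :
    coordField I x₀ (X + Y) e = coordField I x₀ X e + coordField I x₀ Y e :=
  map_add _ _ _

omit [FiniteDimensional ℝ E] [I.Boundaryless] [IsManifold I ∞ M] in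
theorem coordField_smul (x₀ : M) (c : ℝ) (X : VField I M) (e : E) :
    coordField I x₀ (c • X) e = c • coordField I x₀ X e :=
  map_smul _ _ _

variable (I) in
/-- The first-order jet of Killing fields at the point with coordinates `e`, in the chart at
`x₀`. -/
def killingJet [CompleteSpace E] (g : Tensor2 I M) (x₀ : M) {e : E}
    (he : e ∈ (extChartAt I x₀).target) : killingAlgebra I g →ₗ[ℝ] E × (E →L[ℝ] E) where
  toFun X := (coordField I x₀ X e, fderiv ℝ (coordField I x₀ X) e)
  map_add' X Y := by
    have hd : ∀ X : killingAlgebra I g, DifferentiableAt ℝ (coordField I x₀ (X : VField I M)) e :=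
      fun X => ((smoothFieldAt_iff x₀ he _).1 (X.2.1 _)).differentiableAt (by simp)
    have h : coordField I x₀ ((X + Y : killingAlgebra I g) : VField I M) =
        coordField I x₀ (X : VField I M) + coordField I x₀ (Y : VField I M) :=
      funext fun e' => coordField_add x₀ _ _ e'
    rw [h, fderiv_add (hd X) (hd Y)]
    rfl
  map_smul' c X := by
    have h : coordField I x₀ ((c • X : killingAlgebra I g) : VField I M) =
        c • coordField I x₀ (X : VField I M) :=
      funext fun e' => coordField_smul x₀ c _ e'
    rw [h, fderiv_const_smul_field]
    rfl

theorem killingJet_injective [CompleteSpace E] [PreconnectedSpace M] {g : Tensor2 I M}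
    (hg : IsSmoothMetric g)
    (hsymm : ∀ x v w, g x v w = g x w v) (hnd : ∀ x v, (∀ w, g x v w = 0) → v = 0)
    (x₀ : M) {e : E} (he : e ∈ (extChartAt I x₀).target) :
    Function.Injective (killingJet I g x₀ he) := by
  rw [injective_iff_map_eq_zero]
  intro X hX
  exact Subtype.ext (X.2.eq_zero hg hsymm hnd x₀ he (congrArg Prod.fst hX) (congrArg Prod.snd hX))

theorem finiteDimensional_killingAlgebra [CompleteSpace E] [ConnectedSpace M] {g : Tensor2 I M}
    (hg : IsSmoothMetric g)
    (hsymm : ∀ x v w, g x v w = g x w v) (hnd : ∀ x v, (∀ w, g x v w = 0) → v = 0) :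
    FiniteDimensional ℝ (killingAlgebra I g) := by
  obtain ⟨x₀⟩ := (inferInstance : Nonempty M)
  exact Module.Finite.of_injective _
    (killingJet_injective hg hsymm hnd x₀ (mem_extChartAt_target (I := I) x₀))

end Rigidity

section Lorentzian

variable {E : Type*} [NormedAddCommGroup E] [NormedSpace ℝ E]
  {H : Type*} [TopologicalSpace H] {I : ModelWithCorners ℝ E H}
  {M : Type*} [TopologicalSpace M] [ChartedSpace H M] [IsManifold I ∞ M]

theorem IsLorentzian.nondegenerate {g : Tensor2 I M} (hg : IsLorentzian I g) (x : M)
    (v : TangentSpace I x) (hv : ∀ w, g x v w = 0) : v = 0 := by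
  obtain ⟨t, ht, hs⟩ := hg.signature x
  by_contra h0
  have := hs v (by rw [hg.symm]; exact hv t) h0
  rw [hv v] at this
  exact lt_irrefl _ this

theorem IsLorentzian.isSmoothMetric [I.Boundaryless] {g : Tensor2 I M} (hg : IsLorentzian I g) :
    IsSmoothMetric g := by
  have : IsManifold I 1 M := IsManifold.of_le (n := ∞) (by norm_cast)
  intro x₀ u v e he
  refine ContDiffAt.contDiffWithinAt ?_
  have hu := smoothFieldAt_constField x₀ he u
  have hv := smoothFieldAt_constField x₀ he v
  have h : ContMDiffAt I (I.prod 𝓘(ℝ)) ∞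
      (fun x ↦ Bundle.TotalSpace.mk' ℝ (E := Bundle.Trivial M ℝ) x
        (g x (constField I x₀ u x) (constField I x₀ v x))) ((extChartAt I x₀).symm e) := by
    apply ContMDiffAt.clm_bundle_apply₂ (F₁ := E) (F₂ := E)
    · exact hg.smooth.contMDiffAt
    · exact hu
    · exact hv
  simp only [Bundle.contMDiffAt_totalSpace] at h
  have h2 := (contMDiffAt_iff_contDiffAt_comp_symm (n := ⊤) x₀ he
      (fun x => g x (constField I x₀ u x) (constField I x₀ v x))).1 h.2
  refine h2.congr_of_eventuallyEq ?_
  filter_upwards [(isOpen_extChartAt_target x₀).mem_nhds he] with e' he'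
  rw [constField_symm x₀ he', constField_symm x₀ he', coordMetric_apply]

end Lorentzian

/-! ### The round sphere in stereographic coordinates -/

section Sphere

open scoped InnerProductSpace

/-- The conformal factor of the stereographic chart: the round metric is `stereoFactor⁻²` times the
Euclidean metric. -/
def stereoFactor {m : ℕ} (y : EuclideanSpace ℝ (Fin m)) : ℝ := 1 + ‖y‖ ^ 2 / 4

theorem stereoFactor_pos {m : ℕ} (y : EuclideanSpace ℝ (Fin m)) : 0 < stereoFactor y := by
  unfold stereoFactor; positivity

theorem hasFDerivAt_stereoFactor {m : ℕ} (y : EuclideanSpace ℝ (Fin m)) :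
    HasFDerivAt (stereoFactor (m := m)) ((1 / 2 : ℝ) • innerSL ℝ y) y := by
  have h := ((hasStrictFDerivAt_norm_sq y).hasFDerivAt.const_mul (1 / 4 : ℝ)).const_add 1
  have h1 : (fun x : EuclideanSpace ℝ (Fin m) => 1 + 1 / 4 * ‖x‖ ^ 2) = stereoFactor := by
    funext z; unfold stereoFactor; ring
  rw [h1] at h
  refine h.congr_fderiv ?_
  ext w; simp; ring

theorem contDiff_stereoFactor {m : ℕ} : ContDiff ℝ ∞ (stereoFactor (m := m)) := by
  unfold stereoFactor
  exact contDiff_const.add ((contDiff_norm_sq ℝ).div_const 4)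

theorem extChartAt_sphere_target {m : ℕ} (q : Sph m) : (extChartAt (𝓡 m) q).target = Set.univ := by
  have := Fact.mk (@finrank_euclideanSpace_fin ℝ _ (m + 1))
  have h : (chartAt (EuclideanSpace ℝ (Fin m)) q).target = Set.univ :=
    stereographic'_target (n := m) (-q)
  rw [extChartAt_target, h]
  simp

/-- The stereographic parametrization of the sphere that is inverse to the chart at `q`. -/
def stereoParam {m : ℕ} (q : Sph m) (y : EuclideanSpace ℝ (Fin m)) :
    EuclideanSpace ℝ (Fin (m + 1)) :=
  ((extChartAt (𝓡 m) q).symm y : Sph m)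

/-- The stereographic parametrization, with `n` the projection point `-q` and `L` an isometry onto
the orthogonal complement of `n`. -/
theorem exists_stereoParam_eq {m : ℕ} (q : Sph m) :
    ∃ (L : EuclideanSpace ℝ (Fin m) →ₗᵢ[ℝ] EuclideanSpace ℝ (Fin (m + 1)))
      (n : EuclideanSpace ℝ (Fin (m + 1))), ‖n‖ = 1 ∧ (∀ y, ⟪L y, n⟫_ℝ = 0) ∧
      ∀ y, stereoParam q y = n + (stereoFactor y)⁻¹ • (L y - (2 : ℝ) • n) := by
  have := Fact.mk (@finrank_euclideanSpace_fin ℝ _ (m + 1))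
  let U := (OrthonormalBasis.fromOrthogonalSpanSingleton (𝕜 := ℝ) m
    (ne_zero_of_mem_unit_sphere (-q))).repr
  refine ⟨(Submodule.subtypeₗᵢ _).comp U.symm.toLinearIsometry, ((-q : Sph m) : _),
    norm_eq_of_mem_sphere (-q), fun y => ?_, fun y => ?_⟩
  · have h := (U.symm y).2
    rw [Submodule.mem_orthogonal_singleton_iff_inner_left] at h
    exact h
  · have h : stereoParam q y = _ := stereographic'_symm_apply (n := m) (-q) y
    rw [h]
    have hn : ‖((U.symm y : _) : EuclideanSpace ℝ (Fin (m + 1)))‖ = ‖y‖ := by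
      rw [Submodule.norm_coe, LinearIsometryEquiv.norm_map]
    change (‖((U.symm y : _) : EuclideanSpace ℝ (Fin (m + 1)))‖ ^ 2 + 4)⁻¹ • (4 : ℝ) • _ +
      (‖((U.symm y : _) : EuclideanSpace ℝ (Fin (m + 1)))‖ ^ 2 + 4)⁻¹ •
        (‖((U.symm y : _) : EuclideanSpace ℝ (Fin (m + 1)))‖ ^ 2 - 4) • _ = _
    rw [hn]
    change _ = ((-q : Sph m) : EuclideanSpace ℝ (Fin (m + 1))) + (stereoFactor y)⁻¹ •
      (((U.symm y : _) : EuclideanSpace ℝ (Fin (m + 1))) -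
        (2 : ℝ) • ((-q : Sph m) : EuclideanSpace ℝ (Fin (m + 1))))
    have hf : stereoFactor y = (‖y‖ ^ 2 + 4) / 4 := by unfold stereoFactor; ring
    have h0 : ‖y‖ ^ 2 + 4 ≠ 0 := by positivity
    rw [hf]
    match_scalars
    · field_simp
    · field_simp
      ring

theorem hasFDerivAt_stereoFactor_inv {m : ℕ} (y : EuclideanSpace ℝ (Fin m)) :
    HasFDerivAt (fun y => (stereoFactor (m := m) y)⁻¹)
      (-((stereoFactor y ^ 2)⁻¹ * (1 / 2 : ℝ)) • innerSL ℝ y) y := by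
  have h := (hasDerivAt_inv (stereoFactor_pos y).ne').comp_hasFDerivAt y (hasFDerivAt_stereoFactor y)
  refine h.congr_fderiv ?_
  ext w; simp; ring

theorem contDiff_stereoFactor_inv {m : ℕ} : ContDiff ℝ ∞ (fun y => (stereoFactor (m := m) y)⁻¹) :=
  contDiff_stereoFactor.inv fun y => (stereoFactor_pos y).ne'

/-- Stereographic projection is conformal. -/
theorem inner_fderiv_stereoParam {m : ℕ} (q : Sph m) (y u v : EuclideanSpace ℝ (Fin m)) :
    ⟪fderiv ℝ (stereoParam q) y u, fderiv ℝ (stereoParam q) y v⟫_ℝ =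
      (stereoFactor y ^ 2)⁻¹ * ⟪u, v⟫_ℝ := by
  obtain ⟨L, n, hn, hLn, h⟩ := exists_stereoParam_eq q
  have hd : ∀ w, fderiv ℝ (stereoParam q) y w = (stereoFactor y)⁻¹ • L w
      - ((stereoFactor y ^ 2)⁻¹ * (1 / 2) * ⟪y, w⟫_ℝ) • (L y - (2 : ℝ) • n) := by
    intro w
    have h1 := ((hasFDerivAt_stereoFactor_inv y).smul
      (L.toContinuousLinearMap.hasFDerivAt.sub_const ((2 : ℝ) • n))).const_add n
    rw [show stereoParam q = _ from funext h]
    have h2 := DFunLike.congr_fun h1.fderiv w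
    refine h2.trans ?_
    simp
    module
  have hnL : ∀ y, ⟪n, L y⟫_ℝ = 0 := fun y => by rw [real_inner_comm]; exact hLn y
  rw [hd, hd]
  simp only [inner_sub_left, inner_sub_right, real_inner_smul_left, real_inner_smul_right,
    L.inner_map_map, hLn, hnL, real_inner_self_eq_norm_sq, hn]
  rw [real_inner_comm y u]
  have hf : ‖y‖ ^ 2 = 4 * (stereoFactor y - 1) := by unfold stereoFactor; ring
  have h0 := (stereoFactor_pos y).ne'
  rw [hf]
  field_simp
  ring

theorem contMDiff_sphere_coe (m : ℕ) :
    ContMDiff (𝓡 m) (𝓡 (m + 1)) ∞ (fun q : Sph m => (q : EuclideanSpace ℝ (Fin (m + 1)))) := by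
  have := Fact.mk (@finrank_euclideanSpace_fin ℝ _ (m + 1))
  exact contMDiff_coe_sphere

/-- The differential of the inclusion of the sphere. -/
def sphIncl {m : ℕ} (q : Sph m) : TangentSpace (𝓡 m) q →L[ℝ] EuclideanSpace ℝ (Fin (m + 1)) :=
  mfderiv (𝓡 m) (𝓡 (m + 1)) (fun q : Sph m => (q : EuclideanSpace ℝ (Fin (m + 1)))) q

theorem sphIncl_injective {m : ℕ} (q : Sph m) : Function.Injective (sphIncl q) := by
  have := Fact.mk (@finrank_euclideanSpace_fin ℝ _ (m + 1))
  exact injective_mvfderiv_subtypeVal_sphere q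

theorem roundMetric_apply {m : ℕ} (q : Sph m) (v w : TangentSpace (𝓡 m) q) :
    roundMetric m q v w = ⟪sphIncl q v, sphIncl q w⟫_ℝ := rfl

theorem roundMetric_symm {m : ℕ} (q : Sph m) (v w : TangentSpace (𝓡 m) q) :
    roundMetric m q v w = roundMetric m q w v := by
  rw [roundMetric_apply, roundMetric_apply, real_inner_comm]

theorem roundMetric_nondegenerate {m : ℕ} (q : Sph m) (v : TangentSpace (𝓡 m) q)
    (hv : ∀ w, roundMetric m q v w = 0) : v = 0 := by
  have h := hv v
  rw [roundMetric_apply, inner_self_eq_zero] at h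
  exact sphIncl_injective q (by rw [h, map_zero])

theorem mem_sphere_target {m : ℕ} (q : Sph m) (y : EuclideanSpace ℝ (Fin m)) :
    y ∈ (extChartAt (𝓡 m) q).target := by
  rw [extChartAt_sphere_target]; trivial

theorem sphIncl_frame {m : ℕ} (q : Sph m) (y u : EuclideanSpace ℝ (Fin m)) :
    sphIncl ((extChartAt (𝓡 m) q).symm y) (frame (𝓡 m) q y u) = fderiv ℝ (stereoParam q) y u := by
  have h := mfderiv_comp_apply (I := 𝓡 m) (I' := 𝓡 m) (I'' := 𝓡 (m + 1)) y
    (g := fun q : Sph m => (q : EuclideanSpace ℝ (Fin (m + 1)))) (f := (extChartAt (𝓡 m) q).symm)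
    ((contMDiff_sphere_coe m).mdifferentiableAt (by simp))
    ((contMDiffAt_extChartAt_symm q (mem_sphere_target q y)).mdifferentiableAt (by simp)) u
  refine h.symm.trans ?_
  rw [mfderiv_eq_fderiv]
  rfl

/-- The round metric in a stereographic chart. -/
theorem coordMetric_roundMetric {m : ℕ} (q : Sph m) (y u v : EuclideanSpace ℝ (Fin m)) :
    coordMetric (𝓡 m) q (roundMetric m) y u v = (stereoFactor y ^ 2)⁻¹ * ⟪u, v⟫_ℝ := by
  rw [coordMetric_apply, roundMetric_apply, sphIncl_frame, sphIncl_frame, inner_fderiv_stereoParam]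

end Sphere

/-! ### Warped products in product charts -/

section Warped

variable {E : Type*} [NormedAddCommGroup E] [NormedSpace ℝ E]
  {H : Type*} [TopologicalSpace H] {I : ModelWithCorners ℝ E H}
  {M : Type*} [TopologicalSpace M] [ChartedSpace H M]
  {E' : Type*} [NormedAddCommGroup E'] [NormedSpace ℝ E']
  {H' : Type*} [TopologicalSpace H'] {I' : ModelWithCorners ℝ E' H'}
  {M' : Type*} [TopologicalSpace M'] [ChartedSpace H' M']

theorem mem_extChartAt_prod_target {p : M} {q : M'} {x : E} {y : E'} :
    (x, y) ∈ (extChartAt (I.prod I') (p, q)).target ↔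
      x ∈ (extChartAt I p).target ∧ y ∈ (extChartAt I' q).target := by
  rw [extChartAt_prod]; rfl

variable [I.Boundaryless] [IsManifold I ∞ M] [I'.Boundaryless] [IsManifold I' ∞ M']

theorem frame_prod {p : M} {q : M'} {x : E} {y : E'} (hx : x ∈ (extChartAt I p).target)
    (hy : y ∈ (extChartAt I' q).target) (u : E × E') :
    frame (I.prod I') (p, q) (x, y) u =
      ((frame I p x u.1, frame I' q y u.2) : TangentSpace I _ × TangentSpace I' _) := by
  have h := mfderiv_prodMap (I := 𝓘(ℝ, E)) (J := I) (I' := 𝓘(ℝ, E')) (J' := I') (p := (x, y))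
    ((contMDiffAt_extChartAt_symm p hx).mdifferentiableAt (by simp))
    ((contMDiffAt_extChartAt_symm q hy).mdifferentiableAt (by simp))
  have e : Prod.map (extChartAt I p).symm (extChartAt I' q).symm =
      (extChartAt (I.prod I') (p, q)).symm := by
    rw [extChartAt_prod]; rfl
  rw [e, ← modelWithCornersSelf_prod, chartedSpaceSelf_prod] at h
  exact DFunLike.congr_fun h u

omit [I.Boundaryless] [I'.Boundaryless] in
theorem coframe_prod {p : M} {q : M'} {a : M} {b : M'} (ha : a ∈ (extChartAt I p).source)
    (hb : b ∈ (extChartAt I' q).source) (v : TangentSpace (I.prod I') (a, b)) :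
    coframe (I.prod I') (p, q) (a, b) v = (coframe I p a v.1, coframe I' q b v.2) := by
  have h1 : MDifferentiableAt I 𝓘(ℝ, E) (extChartAt I p) a :=
    (contMDiffAt_extChartAt' (n := ∞) (by rwa [← extChartAt_source I])).mdifferentiableAt (by simp)
  have h2 : MDifferentiableAt I' 𝓘(ℝ, E') (extChartAt I' q) b :=
    (contMDiffAt_extChartAt' (n := ∞) (by rwa [← extChartAt_source I'])).mdifferentiableAt (by simp)
  have h := mfderiv_prodMap (p := (a, b)) h1 h2
  have e : Prod.map (extChartAt I p) (extChartAt I' q) = extChartAt (I.prod I') (p, q) := by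
    rw [extChartAt_prod]; rfl
  rw [e, ← modelWithCornersSelf_prod, chartedSpaceSelf_prod] at h
  exact DFunLike.congr_fun h v

omit [I.Boundaryless] [I'.Boundaryless] in
theorem coordField_prod {p : M} {q : M'} {x : E} {y : E'} (hx : x ∈ (extChartAt I p).target)
    (hy : y ∈ (extChartAt I' q).target) (V : VField (I.prod I') (M × M')) :
    coordField (I.prod I') (p, q) V (x, y) =
      (coframe I p ((extChartAt I p).symm x) (V ((extChartAt I p).symm x, (extChartAt I' q).symm y)).1,
        coframe I' q ((extChartAt I' q).symm y) (V ((extChartAt I p).symm x, (extChartAt I' q).symm y)).2) :=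
  coframe_prod ((extChartAt I p).map_target hx) ((extChartAt I' q).map_target hy) _

/-- A warped product metric in a product chart. -/
theorem coordMetric_warped {p : M} {q : M'} {x : E} {y : E'} (hx : x ∈ (extChartAt I p).target)
    (hy : y ∈ (extChartAt I' q).target) (h : Tensor2 I M) (f : M → ℝ) (γ : Tensor2 I' M')
    (u v : E × E') :
    coordMetric (I.prod I') (p, q) (warped I I' h f γ) (x, y) u v =
      coordMetric I p h x u.1 v.1 +
        f ((extChartAt I p).symm x) ^ 2 * coordMetric I' q γ y u.2 v.2 := by
  rw [coordMetric_apply, frame_prod hx hy, frame_prod hx hy]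
  exact warped_apply I I' h f γ _ _ _

theorem IsSmoothMetric.warped {h : Tensor2 I M} (hh : IsSmoothMetric h) {f : M → ℝ}
    (hf : ContMDiff I 𝓘(ℝ, ℝ) ∞ f) {γ : Tensor2 I' M'} (hγ : IsSmoothMetric γ) :
    IsSmoothMetric (warped I I' h f γ) := by
  rintro ⟨p, q⟩ u v ⟨x, y⟩ hxy
  obtain ⟨hx, hy⟩ := mem_extChartAt_prod_target.1 hxy
  have h1 : ContDiffAt ℝ ∞ (fun e : E × E' => coordMetric I p h e.1 u.1 v.1) (x, y) :=
    ((hh p u.1 v.1).contDiffAt ((isOpen_extChartAt_target p).mem_nhds hx)).comp (x, y) contDiffAt_fst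
  have h2 : ContDiffAt ℝ ∞ (fun e : E × E' => coordMetric I' q γ e.2 u.2 v.2) (x, y) :=
    ((hγ q u.2 v.2).contDiffAt ((isOpen_extChartAt_target q).mem_nhds hy)).comp (x, y) contDiffAt_snd
  have h3 : ContDiffAt ℝ ∞ (fun e : E × E' => f ((extChartAt I p).symm e.1)) (x, y) :=
    ContDiffAt.comp (f := Prod.fst) (g := fun x => f ((extChartAt I p).symm x)) (x, y)
      ((contMDiffAt_iff_contDiffAt_comp_symm (n := ⊤) p hx f).1 hf.contMDiffAt) contDiffAt_fst
  refine ((h1.add ((h3.pow 2).mul h2)).congr_of_eventuallyEq ?_).contDiffWithinAt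
  filter_upwards [(isOpen_extChartAt_target (I := I.prod I') (p, q)).mem_nhds hxy]
  rintro ⟨x', y'⟩ he
  obtain ⟨hx', hy'⟩ := mem_extChartAt_prod_target.1 he
  exact coordMetric_warped hx' hy' h f γ u v

omit [I.Boundaryless] [IsManifold I ∞ M] [I'.Boundaryless] [IsManifold I' ∞ M'] in
theorem warped_symm {h : Tensor2 I M} (hh : ∀ x v w, h x v w = h x w v) (f : M → ℝ)
    {γ : Tensor2 I' M'} (hγ : ∀ x v w, γ x v w = γ x w v) (x : M × M')
    (v w : TangentSpace (I.prod I') x) :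
    warped I I' h f γ x v w = warped I I' h f γ x w v := by
  have e : h x.1 v.1 w.1 + (f x.1) ^ 2 * γ x.2 v.2 w.2 =
      h x.1 w.1 v.1 + (f x.1) ^ 2 * γ x.2 w.2 v.2 := congrArg₂ (· + (f x.1) ^ 2 * ·)
    (hh _ _ _) (hγ _ _ _)
  exact (warped_apply I I' h f γ x v w).trans (e.trans (warped_apply I I' h f γ x w v).symm)

omit [I.Boundaryless] [IsManifold I ∞ M] [I'.Boundaryless] [IsManifold I' ∞ M'] in
theorem warped_nondegenerate {h : Tensor2 I M} (hh : ∀ x v, (∀ w, h x v w = 0) → v = 0)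
    {f : M → ℝ} (hf : ∀ x, 0 < f x)
    {γ : Tensor2 I' M'} (hγ : ∀ x v, (∀ w, γ x v w = 0) → v = 0) (x : M × M')
    (v : TangentSpace (I.prod I') x) (hv : ∀ w, warped I I' h f γ x v w = 0) : v = 0 := by
  refine Prod.ext (hh x.1 v.1 fun w => ?_) (hγ x.2 v.2 fun w => ?_)
  · have h1 : h x.1 v.1 w + (f x.1) ^ 2 * γ x.2 v.2 0 = 0 :=
      (warped_apply I I' h f γ x v ((w, 0) : E × E')).symm.trans (hv _)
    rw [map_zero, mul_zero, add_zero] at h1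
    exact h1
  · have h1 : h x.1 v.1 0 + (f x.1) ^ 2 * γ x.2 v.2 w = 0 :=
      (warped_apply I I' h f γ x v ((0, w) : E × E')).symm.trans (hv _)
    rw [map_zero, zero_add, mul_eq_zero] at h1
    exact h1.resolve_left (pow_pos (hf _) 2).ne'

/-- The Killing equation of a warped product metric in a product chart. -/
theorem coordKilling_warped_iff {h : Tensor2 I M} (hh : IsSmoothMetric h) {f : M → ℝ}
    (hf : ContMDiff I 𝓘(ℝ, ℝ) ∞ f) {γ : Tensor2 I' M'} (hγ : IsSmoothMetric γ)
    {p : M} {q : M'} {x : E} {y : E'} (hx : x ∈ (extChartAt I p).target)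
    (hy : y ∈ (extChartAt I' q).target) (V : VField (I.prod I') (M × M')) :
    CoordKilling (p, q) (WarpedKilling.warped I I' h f γ) V (x, y) ↔ ∀ u v : E × E',
      (fderiv ℝ (fun x => coordMetric I p h x u.1 v.1) x
          (coordField (I.prod I') (p, q) V (x, y)).1 +
        2 * f ((extChartAt I p).symm x) *
          fderiv ℝ (fun x => f ((extChartAt I p).symm x)) x
            (coordField (I.prod I') (p, q) V (x, y)).1 * coordMetric I' q γ y u.2 v.2 +
        f ((extChartAt I p).symm x) ^ 2 *
          fderiv ℝ (fun y => coordMetric I' q γ y u.2 v.2) y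
            (coordField (I.prod I') (p, q) V (x, y)).2) +
      (coordMetric I p h x (fderiv ℝ (coordField (I.prod I') (p, q) V) (x, y) u).1 v.1 +
        f ((extChartAt I p).symm x) ^ 2 *
          coordMetric I' q γ y (fderiv ℝ (coordField (I.prod I') (p, q) V) (x, y) u).2 v.2) +
      (coordMetric I p h x u.1 (fderiv ℝ (coordField (I.prod I') (p, q) V) (x, y) v).1 +
        f ((extChartAt I p).symm x) ^ 2 *
          coordMetric I' q γ y u.2 (fderiv ℝ (coordField (I.prod I') (p, q) V) (x, y) v).2) = 0 := by
  have hxy : (x, y) ∈ (extChartAt (I.prod I') (p, q)).target :=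
    mem_extChartAt_prod_target.2 ⟨hx, hy⟩
  refine forall_congr' fun u => forall_congr' fun v => ?_
  have h1 : HasFDerivAt (fun e : E × E' => coordMetric I p h e.1 u.1 v.1) _ (x, y) :=
    HasFDerivAt.comp (f := Prod.fst) (g := fun x => coordMetric I p h x u.1 v.1) (x, y)
      ((((hh p u.1 v.1).contDiffAt ((isOpen_extChartAt_target p).mem_nhds hx)).differentiableAt
        (by simp)).hasFDerivAt) hasFDerivAt_fst
  have h2 : HasFDerivAt (fun e : E × E' => coordMetric I' q γ e.2 u.2 v.2) _ (x, y) :=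
    HasFDerivAt.comp (f := Prod.snd) (g := fun y => coordMetric I' q γ y u.2 v.2) (x, y)
      ((((hγ q u.2 v.2).contDiffAt ((isOpen_extChartAt_target q).mem_nhds hy)).differentiableAt
        (by simp)).hasFDerivAt) hasFDerivAt_snd
  have h3 : HasFDerivAt (fun e : E × E' => f ((extChartAt I p).symm e.1)) _ (x, y) :=
    HasFDerivAt.comp (f := Prod.fst) (g := fun x => f ((extChartAt I p).symm x)) (x, y)
      ((((contMDiffAt_iff_contDiffAt_comp_symm (n := ⊤) p hx f).1 hf.contMDiffAt).differentiableAt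
        (by simp)).hasFDerivAt) hasFDerivAt_fst
  have hE : (fun e => coordMetric (I.prod I') (p, q) (WarpedKilling.warped I I' h f γ) e u v)
      =ᶠ[nhds (x, y)] fun e : E × E' => coordMetric I p h e.1 u.1 v.1 +
        f ((extChartAt I p).symm e.1) ^ 2 * coordMetric I' q γ e.2 u.2 v.2 := by
    filter_upwards [(isOpen_extChartAt_target (I := I.prod I') (p, q)).mem_nhds hxy]
    rintro ⟨x', y'⟩ he
    obtain ⟨hx', hy'⟩ := mem_extChartAt_prod_target.1 he
    exact coordMetric_warped hx' hy' h f γ u v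
  have h4 : HasFDerivAt (fun e : E × E' => coordMetric I p h e.1 u.1 v.1 +
      f ((extChartAt I p).symm e.1) ^ 2 * coordMetric I' q γ e.2 u.2 v.2) _ (x, y) :=
    h1.add ((h3.pow 2).mul h2)
  rw [hE.fderiv_eq, h4.fderiv, coordMetric_warped hx hy,
    coordMetric_warped hx hy]
  simp
  refine Eq.congr_left ?_
  ring

end Warped

/-! ### The Killing equation on `N × S^m` -/

section Spherical

open scoped InnerProductSpace

variable {N : Type*} [TopologicalSpace N] [ChartedSpace (EuclideanSpace ℝ (Fin 2)) N]

theorem isSmoothMetric_roundMetric (m : ℕ) : IsSmoothMetric (roundMetric m) := by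
  intro q u v
  simp only [coordMetric_roundMetric]
  refine ContDiff.contDiffOn ?_
  exact ((contDiff_stereoFactor.pow 2).inv fun y => (pow_pos (stereoFactor_pos y) 2).ne').mul
    contDiff_const

variable [IsManifold (𝓡 2) ∞ N] {m : ℕ} {h : Tensor2 (𝓡 2) N} {f : N → ℝ}

theorem isSmoothMetric_spherical (hh : IsSmoothMetric h) (hf : ContMDiff (𝓡 2) 𝓘(ℝ, ℝ) ∞ f) :
    IsSmoothMetric (spherical m h f) :=
  hh.warped hf (isSmoothMetric_roundMetric m)

/-- The component tangent to `N` of a vector field on `N × S^m`, along the slice `N × {b}`. -/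
def baseSlice (V : VField ((𝓡 2).prod (𝓡 m)) (N × Sph m)) (b : Sph m) : VField (𝓡 2) N :=
  fun a => (V (a, b)).1

/-- The derivative of the round metric in a stereographic chart, in the direction `b`. -/
theorem fderiv_roundMetric (q : Sph m) (y w w' b : EuclideanSpace ℝ (Fin m)) :
    fderiv ℝ (fun y => coordMetric (𝓡 m) q (roundMetric m) y w w') y b =
      -((stereoFactor y ^ 2)⁻¹ * (⟪y, b⟫_ℝ / stereoFactor y)) * ⟪w, w'⟫_ℝ := by
  simp only [coordMetric_roundMetric]
  have h := (((hasFDerivAt_stereoFactor_inv y).pow 2).mul_const ⟪w, w'⟫_ℝ)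
  have e : (fun y => (stereoFactor (m := m) y ^ 2)⁻¹ * ⟪w, w'⟫_ℝ) =
      fun y => (stereoFactor (m := m) y)⁻¹ ^ 2 * ⟪w, w'⟫_ℝ := by
    funext z; rw [inv_pow]
  rw [e, h.fderiv]
  have h0 := (stereoFactor_pos y).ne'
  simp
  field_simp

variable {V : VField ((𝓡 2).prod (𝓡 m)) (N × Sph m)}

theorem contDiffAt_coordField_of_isKilling (hV : IsKilling ((𝓡 2).prod (𝓡 m)) (spherical m h f) V)
    {p : N} (q : Sph m) {x : EuclideanSpace ℝ (Fin 2)} (hx : x ∈ (extChartAt (𝓡 2) p).target)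
    (y : EuclideanSpace ℝ (Fin m)) :
    ContDiffAt ℝ ∞ (coordField ((𝓡 2).prod (𝓡 m)) (p, q) V) (x, y) :=
  (smoothFieldAt_iff (p, q) (mem_extChartAt_prod_target.2 ⟨hx, mem_sphere_target q y⟩) V).1 (hV.1 _)

theorem coordField_baseSlice {p : N} (q : Sph m) {x : EuclideanSpace ℝ (Fin 2)}
    (hx : x ∈ (extChartAt (𝓡 2) p).target) (y : EuclideanSpace ℝ (Fin m)) :
    coordField (𝓡 2) p (baseSlice V ((extChartAt (𝓡 m) q).symm y)) x =
      (coordField ((𝓡 2).prod (𝓡 m)) (p, q) V (x, y)).1 := by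
  rw [coordField_prod hx (mem_sphere_target q y)]
  rfl

/-- The mixed components of the Killing equation. -/
theorem killing_mixed (hh : IsSmoothMetric h) (hf : ContMDiff (𝓡 2) 𝓘(ℝ, ℝ) ∞ f)
    (hV : IsKilling ((𝓡 2).prod (𝓡 m)) (spherical m h f) V)
    {p : N} (q : Sph m) {x : EuclideanSpace ℝ (Fin 2)} (hx : x ∈ (extChartAt (𝓡 2) p).target)
    (y : EuclideanSpace ℝ (Fin m)) (u : EuclideanSpace ℝ (Fin 2)) (w : EuclideanSpace ℝ (Fin m)) :
    coordMetric (𝓡 2) p h x u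
        (fderiv ℝ (coordField ((𝓡 2).prod (𝓡 m)) (p, q) V) (x, y) (0, w)).1 +
      f ((extChartAt (𝓡 2) p).symm x) ^ 2 * ((stereoFactor y ^ 2)⁻¹ *
        ⟪(fderiv ℝ (coordField ((𝓡 2).prod (𝓡 m)) (p, q) V) (x, y) (u, 0)).2, w⟫_ℝ) = 0 := by
  have hK := hV.coordKilling (isSmoothMetric_spherical hh hf) (p, q)
    (mem_extChartAt_prod_target.2 ⟨hx, mem_sphere_target q y⟩)
  have h1 := (coordKilling_warped_iff hh hf (isSmoothMetric_roundMetric m) hx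
    (mem_sphere_target q y) V).1 hK (u, 0) (0, w)
  simp only [coordMetric_roundMetric, map_zero, zero_apply, fderiv_fun_const, Pi.zero_apply,
    mul_zero, add_zero, zero_add] at h1
  linarith

/-- The components of the Killing equation tangent to the sphere. -/
theorem killing_sphere (hh : IsSmoothMetric h) (hf : ContMDiff (𝓡 2) 𝓘(ℝ, ℝ) ∞ f)
    (hf_pos : ∀ p, 0 < f p) (hV : IsKilling ((𝓡 2).prod (𝓡 m)) (spherical m h f) V)
    {p : N} (q : Sph m) {x : EuclideanSpace ℝ (Fin 2)} (hx : x ∈ (extChartAt (𝓡 2) p).target)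
    (y w w' : EuclideanSpace ℝ (Fin m)) :
    ⟪(fderiv ℝ (coordField ((𝓡 2).prod (𝓡 m)) (p, q) V) (x, y) (0, w)).2, w'⟫_ℝ +
        ⟪w, (fderiv ℝ (coordField ((𝓡 2).prod (𝓡 m)) (p, q) V) (x, y) (0, w')).2⟫_ℝ =
      (⟪y, (coordField ((𝓡 2).prod (𝓡 m)) (p, q) V (x, y)).2⟫_ℝ / stereoFactor y -
        2 * (fderiv ℝ (fun x => f ((extChartAt (𝓡 2) p).symm x)) x
          (coordField ((𝓡 2).prod (𝓡 m)) (p, q) V (x, y)).1 /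
            f ((extChartAt (𝓡 2) p).symm x))) * ⟪w, w'⟫_ℝ := by
  have hK := hV.coordKilling (isSmoothMetric_spherical hh hf) (p, q)
    (mem_extChartAt_prod_target.2 ⟨hx, mem_sphere_target q y⟩)
  have h1 := (coordKilling_warped_iff hh hf (isSmoothMetric_roundMetric m) hx
    (mem_sphere_target q y) V).1 hK (0, w) (0, w')
  rw [fderiv_roundMetric] at h1
  simp only [coordMetric_roundMetric, map_zero, zero_apply, fderiv_fun_const, Pi.zero_apply] at h1
  have h0 := (stereoFactor_pos y).ne'
  have h2 := (hf_pos ((extChartAt (𝓡 2) p).symm x)).ne'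
  have h3 : f ((extChartAt (𝓡 2) p).symm x) ^ 2 * (stereoFactor y ^ 2)⁻¹ ≠ 0 := by positivity
  apply mul_left_cancel₀ h3
  rw [← sub_eq_zero, ← h1]
  field_simp
  ring

/-- Along each slice `N × {b}`, the component tangent to `N` is a Killing field of `h`. -/
theorem isKilling_baseSlice (hh : IsSmoothMetric h) (hf : ContMDiff (𝓡 2) 𝓘(ℝ, ℝ) ∞ f)
    (hV : IsKilling ((𝓡 2).prod (𝓡 m)) (spherical m h f) V) (b : Sph m) :
    IsKilling (𝓡 2) h (baseSlice V b) := by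
  set y := extChartAt (𝓡 m) b b with hy
  have hb : (extChartAt (𝓡 m) b).symm y = b := extChartAt_to_inv b
  have hE : ∀ (p : N), ∀ x ∈ (extChartAt (𝓡 2) p).target, coordField (𝓡 2) p (baseSlice V b) =ᶠ[nhds x]
      fun x => (coordField ((𝓡 2).prod (𝓡 m)) (p, b) V (x, y)).1 := by
    intro p x hx
    filter_upwards [(isOpen_extChartAt_target p).mem_nhds hx] with x' hx'
    rw [← coordField_baseSlice b hx' y, hb]
  have hx : ∀ p : N, extChartAt (𝓡 2) p p ∈ (extChartAt (𝓡 2) p).target :=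
    fun p => mem_extChartAt_target (I := 𝓡 2) p
  refine isKilling_of_coordKilling hh (fun p => ?_) (fun p => ?_)
  · rw [smoothFieldAt_iff_self]
    refine ContDiffAt.congr_of_eventuallyEq ?_ (hE p _ (hx p))
    have h1 := contDiffAt_coordField_of_isKilling hV b (hx p) y
    exact (h1.comp (extChartAt (𝓡 2) p p) (f := fun x => (x, y))
      (contDiffAt_id.prodMk contDiffAt_const)).fst
  · intro u v
    have h1 := contDiffAt_coordField_of_isKilling hV b (hx p) y
    have hd := ((h1.differentiableAt (by simp)).hasFDerivAt.comp (extChartAt (𝓡 2) p p)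
      (f := fun x => (x, y)) ((hasFDerivAt_id _).prodMk (hasFDerivAt_const y _))).fst
    have hd' : HasFDerivAt (fun x => (coordField ((𝓡 2).prod (𝓡 m)) (p, b) V (x, y)).1) _
      (extChartAt (𝓡 2) p p) := hd
    have hK := hV.coordKilling (isSmoothMetric_spherical hh hf) (p, b)
      (mem_extChartAt_prod_target.2 ⟨hx p, mem_sphere_target b y⟩)
    have h2 := (coordKilling_warped_iff hh hf (isSmoothMetric_roundMetric m) (hx p)
      (mem_sphere_target b y) V).1 hK (u, 0) (v, 0)
    rw [(hE p _ (hx p)).fderiv_eq, (hE p _ (hx p)).self_of_nhds, hd'.fderiv]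
    simp only [map_zero, zero_apply, fderiv_fun_const, Pi.zero_apply, mul_zero, add_zero] at h2
    simpa using h2

end Spherical

/-! ### Conformal fields and concircular functions in stereographic coordinates -/

section Flat

open scoped InnerProductSpace

variable {m : ℕ}

theorem exists_norm_one_orthogonal (hm : 2 ≤ m) (w : EuclideanSpace ℝ (Fin m)) :
    ∃ u : EuclideanSpace ℝ (Fin m), ‖u‖ = 1 ∧ ⟪u, w⟫_ℝ = 0 := by
  have h : (ℝ ∙ w)ᗮ ≠ ⊥ := by
    intro h0
    have h1 := Submodule.finrank_add_finrank_orthogonal (ℝ ∙ w)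
    rw [h0, finrank_bot, finrank_euclideanSpace_fin] at h1
    have h2 : Module.finrank ℝ (ℝ ∙ w) ≤ 1 := (finrank_span_le_card ({w} : Set _)).trans (by simp)
    omega
  obtain ⟨z, hz, hz0⟩ := Submodule.exists_mem_ne_zero_of_ne_bot h
  rw [Submodule.mem_orthogonal_singleton_iff_inner_left] at hz
  refine ⟨‖z‖⁻¹ • z, ?_, ?_⟩
  · simp [norm_smul, hz0]
  · rw [real_inner_smul_left, hz, mul_zero]

variable {E : Type*} [NormedAddCommGroup E] [NormedSpace ℝ E]

/-- The derivative of `F` in the constant direction `u`. -/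
def dd (u : E) (F : E → ℝ) : E → ℝ := fun y => fderiv ℝ F y u

theorem contDiff_dd {F : E → ℝ} (hF : ContDiff ℝ ∞ F) (u : E) : ContDiff ℝ ∞ (dd u F) :=
  (hF.fderiv_right (m := ∞) (by simp)).clm_apply contDiff_const

theorem dd_dd {F : E → ℝ} (hF : ContDiff ℝ ∞ F) (u v y : E) :
    dd u (dd v F) y = fderiv ℝ (fderiv ℝ F) y u v := by
  have h := ((((hF.fderiv_right (m := ∞) (by simp)).differentiable (by simp)) y).hasFDerivAt.clm_apply
    (hasFDerivAt_const v y)).fderiv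
  unfold dd
  rw [h]
  simp

theorem dd_comm {F : E → ℝ} (hF : ContDiff ℝ ∞ F) (u v : E) : dd u (dd v F) = dd v (dd u F) := by
  funext y
  rw [dd_dd hF, dd_dd hF]
  exact (hF.contDiffAt.isSymmSndFDerivAt (by
    rw [minSmoothness_of_isRCLikeNormedField]; norm_cast)) u v

theorem dd_neg (u : E) (F : E → ℝ) : dd u (fun y => -F y) = fun y => -dd u F y := by
  funext y; simp [dd]

theorem dd_const (u : E) (c : ℝ) : dd u (fun _ : E => c) = fun _ => 0 := by
  funext y; simp [dd]

theorem dd_mul {F G : E → ℝ} (hF : ContDiff ℝ ∞ F) (hG : ContDiff ℝ ∞ G) (u : E) :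
    dd u (fun y => F y * G y) = fun y => F y * dd u G y + dd u F y * G y := by
  funext y
  have h := ((hF.differentiable (by simp) y).hasFDerivAt.mul
    (hG.differentiable (by simp) y).hasFDerivAt)
  have h' : HasFDerivAt (fun y => F y * G y) _ y := h
  unfold dd
  rw [h'.fderiv]
  simp
  ring

theorem dd_add {F G : E → ℝ} (hF : ContDiff ℝ ∞ F) (hG : ContDiff ℝ ∞ G) (u : E) :
    dd u (fun y => F y + G y) = fun y => dd u F y + dd u G y := by
  funext y
  have h := ((hF.differentiable (by simp) y).hasFDerivAt.add
    (hG.differentiable (by simp) y).hasFDerivAt)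
  have h' : HasFDerivAt (fun y => F y + G y) _ y := h
  unfold dd
  rw [h'.fderiv]
  simp

theorem dd_const_mul {F : E → ℝ} (hF : ContDiff ℝ ∞ F) (c : ℝ) (u : E) :
    dd u (fun y => c * F y) = fun y => c * dd u F y := by
  funext y
  have h := ((hF.differentiable (by simp) y).hasFDerivAt.const_mul c).fderiv
  unfold dd
  rw [h]
  simp

theorem dd_stereoFactor (u : EuclideanSpace ℝ (Fin m)) :
    dd u (stereoFactor (m := m)) = fun y => (1 / 2) * ⟪y, u⟫_ℝ := by
  funext y
  unfold dd
  rw [(hasFDerivAt_stereoFactor y).fderiv]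
  simp

theorem contDiff_inner_const (u : EuclideanSpace ℝ (Fin m)) :
    ContDiff ℝ ∞ (fun y : EuclideanSpace ℝ (Fin m) => ⟪y, u⟫_ℝ) :=
  contDiff_id.inner ℝ contDiff_const

theorem dd_inner_const (u v : EuclideanSpace ℝ (Fin m)) :
    dd u (fun y : EuclideanSpace ℝ (Fin m) => ⟪y, v⟫_ℝ) = fun _ => ⟪u, v⟫_ℝ := by
  funext y
  have h := ((hasFDerivAt_id y).inner ℝ (hasFDerivAt_const v y)).fderiv
  have e : (fun y : EuclideanSpace ℝ (Fin m) => ⟪y, v⟫_ℝ) = fun y => ⟪id y, v⟫_ℝ := rfl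
  unfold dd
  rw [e, h]
  simp

/-- A homothetic field of the round sphere is Killing. In stereographic coordinates the symmetrized
derivative of the field is `σ` times the Euclidean metric; the integrability condition
`∂ᵤ∂ᵤσ + ∂ᵥ∂ᵥσ = 0` for orthonormal `u`, `v` fails at the centre of the chart unless `κ = 0`. -/
theorem homothety_factor_eq_zero (hm : 2 ≤ m)
    {b : EuclideanSpace ℝ (Fin m) → EuclideanSpace ℝ (Fin m)} (hb : ContDiff ℝ ∞ b) (κ : ℝ)
    (h : ∀ y w w', ⟪fderiv ℝ b y w, w'⟫_ℝ + ⟪w, fderiv ℝ b y w'⟫_ℝ =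
      (⟪y, b y⟫_ℝ / stereoFactor y - 2 * κ) * ⟪w, w'⟫_ℝ) : κ = 0 := by
  obtain ⟨u, hu, -⟩ := exists_norm_one_orthogonal hm (0 : EuclideanSpace ℝ (Fin m))
  obtain ⟨v, hv, hvu⟩ := exists_norm_one_orthogonal hm u
  set σ : EuclideanSpace ℝ (Fin m) → ℝ :=
    fun y => (1 / 2) * (⟪y, b y⟫_ℝ * (stereoFactor y)⁻¹) + -κ with hσ
  have hs : ContDiff ℝ ∞ (fun y => ⟪y, b y⟫_ℝ) := contDiff_id.inner ℝ hb
  have hσs : ContDiff ℝ ∞ σ :=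
    (contDiff_const.mul (hs.mul contDiff_stereoFactor_inv)).add contDiff_const
  have hcomp : ∀ w, ContDiff ℝ ∞ (fun y => ⟪b y, w⟫_ℝ) := fun w => hb.inner ℝ contDiff_const
  have hdd : ∀ w z, dd w (fun y => ⟪b y, z⟫_ℝ) = fun y => ⟪fderiv ℝ b y w, z⟫_ℝ := by
    intro w z
    funext y
    have h1 := ((hb.differentiable (by simp) y).hasFDerivAt.inner ℝ (hasFDerivAt_const z y)).fderiv
    unfold dd
    rw [h1]
    simp
  have hdiag : ∀ w, ‖w‖ = 1 → dd w (fun y => ⟪b y, w⟫_ℝ) = σ := by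
    intro w hw
    rw [hdd]
    funext y
    have h1 := h y w w
    rw [real_inner_self_eq_norm_sq, hw] at h1
    simp only [hσ]
    rw [div_eq_mul_inv] at h1
    have hc := real_inner_comm w (fderiv ℝ b y w)
    linarith
  have hoff : dd v (fun y => ⟪b y, u⟫_ℝ) = fun y => -dd u (fun y => ⟪b y, v⟫_ℝ) y := by
    rw [hdd, hdd]
    funext y
    have h1 := h y v u
    rw [hvu, mul_zero, real_inner_comm (fderiv ℝ b y u)] at h1
    linarith
  have hint : dd v (dd v σ) = fun y => -dd u (dd u σ) y := by
    calc dd v (dd v σ) = dd v (dd v (dd u fun y => ⟪b y, u⟫_ℝ)) := by rw [hdiag u hu]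
      _ = dd u (dd v (dd v fun y => ⟪b y, u⟫_ℝ)) := by
        rw [dd_comm (hcomp u) v u, dd_comm (contDiff_dd (hcomp u) v) v u]
      _ = fun y => -dd u (dd v (dd u fun y => ⟪b y, v⟫_ℝ)) y := by
        rw [hoff, dd_neg, dd_neg]
      _ = fun y => -dd u (dd u σ) y := by
        rw [dd_comm (hcomp v) v u, hdiag v hv]
  have hprod : (fun y => stereoFactor y * (2 * (σ y + κ))) = fun y => ⟪y, b y⟫_ℝ := by
    funext y
    have h0 := (stereoFactor_pos y).ne'
    simp only [hσ]
    field_simp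
    ring
  have hσκ : ContDiff ℝ ∞ (fun y => 2 * (σ y + κ)) := contDiff_const.mul (hσs.add contDiff_const)
  have hσ0 : σ 0 = -κ := by simp [hσ]
  have hcenter : ∀ w, ‖w‖ = 1 → dd w (dd w σ) 0 = -κ := by
    intro w hw
    have hdσ : dd w (fun y => 2 * (σ y + κ)) = fun y => 2 * dd w σ y := by
      rw [dd_const_mul (hσs.add contDiff_const), dd_add hσs contDiff_const, dd_const]
      simp
    have h1 : dd w (dd w (fun y => ⟪y, b y⟫_ℝ)) 0 = 2 * dd w (dd w σ) 0 := by
      rw [← hprod, dd_mul contDiff_stereoFactor hσκ, dd_stereoFactor, hdσ]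
      rw [dd_add (contDiff_stereoFactor.mul (contDiff_const.mul (contDiff_dd hσs w)))
        ((contDiff_const.mul (contDiff_inner_const w)).mul hσκ),
        dd_mul contDiff_stereoFactor (contDiff_const.mul (contDiff_dd hσs w)),
        dd_mul (contDiff_const.mul (contDiff_inner_const w)) hσκ,
        dd_const_mul (contDiff_dd hσs w), dd_stereoFactor,
        dd_const_mul (contDiff_inner_const w), dd_inner_const]
      simp [hσ0, stereoFactor]
    have h2 : dd w (fun y => ⟪y, b y⟫_ℝ) = fun y => ⟪y, fderiv ℝ b y w⟫_ℝ + ⟪b y, w⟫_ℝ := by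
      funext y
      have h3 := ((hasFDerivAt_id y).inner ℝ (hb.differentiable (by simp) y).hasFDerivAt).fderiv
      have e : (fun y : EuclideanSpace ℝ (Fin m) => ⟪y, b y⟫_ℝ) = fun y => ⟪id y, b y⟫_ℝ := rfl
      unfold dd
      rw [e, h3]
      simp [real_inner_comm]
    have hDb : ContDiff ℝ ∞ (fun y => fderiv ℝ b y w) :=
      (hb.fderiv_right (m := ∞) (by simp)).clm_apply contDiff_const
    have h4 : dd w (fun y => ⟪y, fderiv ℝ b y w⟫_ℝ) 0 = σ 0 := by
      have h3 := ((hasFDerivAt_id (0 : EuclideanSpace ℝ (Fin m))).inner ℝ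
        (hDb.differentiable (by simp) 0).hasFDerivAt).fderiv
      have e : (fun y : EuclideanSpace ℝ (Fin m) => ⟪y, fderiv ℝ b y w⟫_ℝ) =
        fun y => ⟪id y, fderiv ℝ b y w⟫_ℝ := rfl
      have h5 := congrFun (hdiag w hw) 0
      rw [hdd] at h5
      unfold dd
      rw [e, h3, ← h5]
      simp [real_inner_comm]
    have hs' : ContDiff ℝ ∞ (fun y => ⟪y, fderiv ℝ b y w⟫_ℝ) := contDiff_id.inner ℝ hDb
    rw [h2, dd_add hs' (hcomp w), hdiag w hw] at h1
    beta_reduce at h1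
    rw [h4, hσ0] at h1
    linarith
  have := congrFun hint 0
  beta_reduce at this
  rw [hcenter u hu, hcenter v hv] at this
  linarith

/-- If `Y` satisfies the concircular equation of the round sphere with right-hand side `G`, written
in stereographic coordinates, then `Y + G` is constant: `stereoFactor * Y` has a Hessian
proportional to the Euclidean metric, with constant factor in dimension at least two. -/
theorem concircular_add_const (hm : 2 ≤ m) {Y G : EuclideanSpace ℝ (Fin m) → ℝ}
    (hY : ContDiff ℝ ∞ Y) (hG : ContDiff ℝ ∞ G)
    (h : ∀ y w, dd w (fun y => stereoFactor y ^ 2 * dd w Y y) y =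
      (G y + stereoFactor y * (fderiv ℝ Y y y) / 2) * ‖w‖ ^ 2) :
    ∀ y z, Y y + G y = Y z + G z := by
  set P : EuclideanSpace ℝ (Fin m) → ℝ := fun y => stereoFactor y * Y y with hP
  have hPs : ContDiff ℝ ∞ P := contDiff_stereoFactor.mul hY
  have hDYs : ContDiff ℝ ∞ (fun y => fderiv ℝ Y y y) :=
    (hY.fderiv_right (m := ∞) (by simp)).clm_apply contDiff_id
  set l : EuclideanSpace ℝ (Fin m) → ℝ := fun y =>
    (1 / 2) * Y y + (stereoFactor y)⁻¹ * G y + (1 / 2) * fderiv ℝ Y y y with hl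
  have hls : ContDiff ℝ ∞ l :=
    ((contDiff_const.mul hY).add (contDiff_stereoFactor_inv.mul hG)).add (contDiff_const.mul hDYs)
  have hDP : ∀ w, dd w P = fun y => stereoFactor y * dd w Y y + (1 / 2) * ⟪y, w⟫_ℝ * Y y := by
    intro w
    rw [hP, dd_mul contDiff_stereoFactor hY, dd_stereoFactor]
  have hdiag : ∀ y w, dd w (dd w P) y = l y * ‖w‖ ^ 2 := by
    intro y w
    have h1 := h y w
    have hi : ContDiff ℝ ∞ (fun y : EuclideanSpace ℝ (Fin m) => (1 / 2) * ⟪y, w⟫_ℝ) :=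
      contDiff_const.mul (contDiff_inner_const w)
    have hsq : dd w (fun y => stereoFactor (m := m) y ^ 2) =
        fun y => stereoFactor y * ⟪y, w⟫_ℝ := by
      have e : (fun y => stereoFactor (m := m) y ^ 2) = fun y => stereoFactor y * stereoFactor y := by
        funext z; ring
      rw [e, dd_mul contDiff_stereoFactor contDiff_stereoFactor, dd_stereoFactor]
      funext z; ring
    rw [dd_mul (contDiff_stereoFactor.pow 2) (contDiff_dd hY w), hsq] at h1
    rw [hDP, dd_add (contDiff_stereoFactor.mul (contDiff_dd hY w)) (hi.mul hY),
      dd_mul contDiff_stereoFactor (contDiff_dd hY w), dd_mul hi hY, dd_stereoFactor,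
      dd_const_mul (contDiff_inner_const w), dd_inner_const]
    have h0 := (stereoFactor_pos y).ne'
    simp only [hl, real_inner_self_eq_norm_sq] at h1 ⊢
    apply mul_left_cancel₀ h0
    have e : stereoFactor y * ((1 / 2 * Y y + (stereoFactor y)⁻¹ * G y + 1 / 2 * fderiv ℝ Y y y) *
        ‖w‖ ^ 2) = stereoFactor y * Y y / 2 * ‖w‖ ^ 2 +
          (G y + stereoFactor y * (fderiv ℝ Y y y) / 2) * ‖w‖ ^ 2 := by field_simp; ring
    rw [e, ← h1]
    ring
  have hpol : ∀ u v, dd u (dd v P) = fun y => l y * ⟪u, v⟫_ℝ := by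
    intro u v
    funext y
    have h1 := hdiag y (u + v)
    have h2 := hdiag y u
    have h3 := hdiag y v
    have h4 := congrFun (dd_comm hPs u v) y
    simp only [dd_dd hPs, map_add, _root_.add_apply] at h1 h2 h3 h4 ⊢
    rw [norm_add_sq_real] at h1
    linarith
  have hlc : ∀ y w, fderiv ℝ l y w = 0 := by
    intro y w
    obtain ⟨u, hu, huw⟩ := exists_norm_one_orthogonal hm w
    have h1 : dd w (dd u (dd u P)) = dd u (dd w (dd u P)) := dd_comm (contDiff_dd hPs u) w u
    rw [hpol u u, hpol w u, real_inner_self_eq_norm_sq, hu, real_inner_comm, huw] at h1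
    simp only [one_pow, mul_one, mul_zero, dd_const] at h1
    exact congrFun h1 y
  set K : EuclideanSpace ℝ (Fin m) → ℝ := fun y => Y y + G y with hK
  have hKeq : K = fun y => stereoFactor y * l y + (1 / 2) * P y + (-1 / 2) * fderiv ℝ P y y := by
    funext y
    have h0 := (stereoFactor_pos y).ne'
    have h1 := congrFun (hDP y) y
    simp only [dd] at h1
    rw [h1, real_inner_self_eq_norm_sq]
    have hf : ‖y‖ ^ 2 = 4 * (stereoFactor y - 1) := by unfold stereoFactor; ring
    rw [hf]
    simp only [hK, hl, hP]
    field_simp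
    ring
  have hKd : Differentiable ℝ K := (hY.add hG).differentiable (by simp)
  have hKz : ∀ y, fderiv ℝ K y = 0 := by
    intro y
    ext w
    have hPd := (hPs.differentiable (by simp) y).hasFDerivAt
    have hP2 := ((hPs.fderiv_right (m := ∞) (by simp)).differentiable (by simp) y).hasFDerivAt
    have hld := (hls.differentiable (by simp) y).hasFDerivAt
    have h1 : HasFDerivAt (fun y => stereoFactor y * l y + (1 / 2) * P y +
        (-1 / 2) * fderiv ℝ P y y) _ y := ((((hasFDerivAt_stereoFactor y).mul hld).add
      (hPd.const_mul (1 / 2))).add ((hP2.clm_apply (hasFDerivAt_id y)).const_mul (-1 / 2)))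
    rw [hKeq, h1.fderiv]
    have h2 : fderiv ℝ (fderiv ℝ P) y w y = l y * ⟪w, y⟫_ℝ := by
      rw [← dd_dd hPs, hpol]
    simp [hlc, h2, real_inner_comm]
    ring
  intro y z
  exact is_const_of_fderiv_eq_zero hKd hKz y z

end Flat

/-! ### Existence of Killing fields on the base -/

section Base

open scoped InnerProductSpace

/-- There are `m (m - 1) / 2` pairs of indices `i < j`. -/
theorem card_pairs (m : ℕ) :
    Fintype.card {p : Fin m × Fin m // p.1 < p.2} = m * (m - 1) / 2 := by
  rw [Fintype.card_subtype]
  have h1 : (Finset.univ.filter fun p : Fin m × Fin m => p.1 < p.2) =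
      ((Finset.univ : Finset (Fin m)).sigma (fun j : Fin m => Finset.univ.filter (· < j))).map
        ⟨fun s => (s.2, s.1), by rintro ⟨a, b⟩ ⟨c, d⟩ h; simp at h; simp [h]⟩ := by
    ext ⟨i, j⟩
    simp only [Finset.mem_filter, Finset.mem_univ, true_and, Finset.mem_map, Finset.mem_sigma]
    constructor
    · exact fun hij => ⟨⟨j, i⟩, hij, rfl⟩
    · rintro ⟨⟨a, b⟩, hab, e⟩
      obtain ⟨rfl, rfl⟩ := Prod.ext_iff.1 e
      exact hab
  rw [h1, Finset.card_map, Finset.card_sigma]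
  have h2 : ∀ j : Fin m, (Finset.univ.filter (· < j)).card = (j : ℕ) := by
    intro j
    rw [← Fin.card_Iio j]
    congr 1
    ext i
    simp
  simp only [h2]
  rw [Fin.sum_univ_eq_sum_range (fun i => i), Finset.sum_range_id]

instance (m : ℕ) [NeZero m] : ConnectedSpace (Sph m) := by
  have : 1 < Module.rank ℝ (EuclideanSpace ℝ (Fin (m + 1))) := by
    rw [rank_eq_card_basis (EuclideanSpace.basisFun (Fin (m+1)) ℝ).toBasis]
    have := NeZero.pos m
    rw [Fintype.card_fin]
    exact_mod_cast (by omega : 1 < m + 1)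
  exact isConnected_iff_connectedSpace.1 (isConnected_sphere this 0 zero_le_one)

variable {N : Type*} [TopologicalSpace N] [ChartedSpace (EuclideanSpace ℝ (Fin 2)) N]
variable [IsManifold (𝓡 2) ∞ N] {m : ℕ} {h : Tensor2 (𝓡 2) N} {f : N → ℝ}

/-- The part of the jet of a Killing field that is tangent to the sphere, in the chart at `(p, q)`:
the value and the entries of the derivative above the diagonal. For a field tangent to the spheres
whose value vanishes there, the derivative is skew-symmetric, so that these entries determine it. -/
def sphereJet (h : Tensor2 (𝓡 2) N) (f : N → ℝ) (p : N) (q : Sph m) :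
    killingAlgebra ((𝓡 2).prod (𝓡 m)) (spherical m h f) →ₗ[ℝ]
      EuclideanSpace ℝ (Fin m) × ({p : Fin m × Fin m // p.1 < p.2} → ℝ) :=
  (LinearMap.prodMap (LinearMap.snd ℝ _ _)
    { toFun := fun A s => (A ((0 : EuclideanSpace ℝ (Fin 2)), EuclideanSpace.single s.1.1 (1:ℝ))).2 s.1.2
      map_add' := fun A B => by ext s; simp
      map_smul' := fun c A => by ext s; simp }) ∘ₗ
  killingJet ((𝓡 2).prod (𝓡 m)) (spherical m h f) (p, q) (mem_extChartAt_target _)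

/-- A Killing field of `N × S^m` which is tangent to the spheres is a Killing field of the sphere,
so that these fields form a space of dimension at most `m (m + 1) / 2`. -/
theorem sphereJet_eq_zero [ConnectedSpace N] [NeZero m] (hh : IsLorentzian (𝓡 2) h)
    (hf : ContMDiff (𝓡 2) 𝓘(ℝ, ℝ) ∞ f) (hf_pos : ∀ p, 0 < f p) (p : N) (q : Sph m)
    (V : killingAlgebra ((𝓡 2).prod (𝓡 m)) (spherical m h f))
    (hV : ∀ b, baseSlice (V : VField _ (N × Sph m)) b = 0) (h0 : sphereJet h f p q V = 0) : V = 0 := by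
  have hx : extChartAt (𝓡 2) p p ∈ (extChartAt (𝓡 2) p).target := mem_extChartAt_target p
  set x := extChartAt (𝓡 2) p p with hxd
  set y := extChartAt (𝓡 m) q q with hyd
  have hxy : (x, y) ∈ (extChartAt ((𝓡 2).prod (𝓡 m)) (p, q)).target :=
    mem_extChartAt_prod_target.2 ⟨hx, mem_sphere_target q y⟩
  have hs := hh.isSmoothMetric
  have h1 : (coordField ((𝓡 2).prod (𝓡 m)) (p, q) (V : VField _ (N × Sph m)) (x, y)).2 = 0 :=
    congrArg Prod.fst h0
  have h2 : ∀ s : {p : Fin m × Fin m // p.1 < p.2},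
      (fderiv ℝ (coordField ((𝓡 2).prod (𝓡 m)) (p, q) (V : VField _ (N × Sph m))) (x, y)
        (0, EuclideanSpace.single s.1.1 (1:ℝ))).2 s.1.2 = 0 :=
    fun s => congrFun (congrArg Prod.snd h0) s
  set F := coordField ((𝓡 2).prod (𝓡 m)) (p, q) (V : VField _ (N × Sph m)) with hF
  have hd : DifferentiableAt ℝ F (x, y) :=
    (contDiffAt_coordField_of_isKilling V.2 q hx y).differentiableAt (by simp)
  have hz : ∀ x' ∈ (extChartAt (𝓡 2) p).target, ∀ y', (F (x', y')).1 = 0 := by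
    intro x' hx' y'
    rw [hF, ← coordField_baseSlice q hx' y', hV]
    exact map_zero _
  have hA : (fun e => (F e).1) =ᶠ[nhds (x, y)] fun _ => 0 := by
    filter_upwards [(isOpen_extChartAt_target (I := (𝓡 2).prod (𝓡 m)) (p, q)).mem_nhds hxy]
    rintro ⟨x', y'⟩ he
    exact hz x' (mem_extChartAt_prod_target.1 he).1 y'
  have hA' : ∀ u, (fderiv ℝ F (x, y) u).1 = 0 := by
    intro u
    have h3 : HasFDerivAt (fun e => (F e).1) _ (x, y) := hd.hasFDerivAt.fst
    have h4 := h3.fderiv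
    rw [hA.fderiv_eq] at h4
    have h5 := DFunLike.congr_fun h4 u
    simpa using h5.symm
  have hB : ∀ u, (fderiv ℝ F (x, y) (u, 0)).2 = 0 := by
    intro u
    refine ext_inner_right ℝ fun w => ?_
    have h3 := killing_mixed hs hf V.2 q hx y u w
    rw [hA', map_zero, zero_add] at h3
    have h4 := hf_pos ((extChartAt (𝓡 2) p).symm x)
    have h5 := stereoFactor_pos y
    rw [inner_zero_left]
    have h6 : f ((extChartAt (𝓡 2) p).symm x) ^ 2 ≠ 0 := by positivity
    have h7 : (stereoFactor y ^ 2)⁻¹ ≠ 0 := by positivity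
    exact (mul_eq_zero.1 ((mul_eq_zero.1 h3).resolve_left h6)).resolve_left h7
  have hC : ∀ i j, (fderiv ℝ F (x, y) (0, EuclideanSpace.single i (1:ℝ))).2 j +
      (fderiv ℝ F (x, y) (0, EuclideanSpace.single j (1:ℝ))).2 i = 0 := by
    intro i j
    have h3 := killing_sphere hs hf hf_pos V.2 q hx y (EuclideanSpace.single i (1:ℝ))
      (EuclideanSpace.single j (1:ℝ))
    rw [← hF, h1, hz x hx y, EuclideanSpace.inner_single_right, EuclideanSpace.inner_single_left]
      at h3
    simpa using h3
  have hD : ∀ i, (fderiv ℝ F (x, y) (0, EuclideanSpace.single i (1:ℝ))).2 = 0 := by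
    intro i
    ext j
    rcases lt_trichotomy i j with hij | rfl | hij
    · exact h2 ⟨(i, j), hij⟩
    · have := hC i i
      change _ = (0:ℝ)
      linarith
    · have h3 := hC i j
      rw [h2 ⟨(j, i), hij⟩, add_zero] at h3
      exact h3
  have hE : ∀ w, (fderiv ℝ F (x, y) (0, w)).2 = 0 := by
    intro w
    have h3 : ((ContinuousLinearMap.snd ℝ _ _).comp ((fderiv ℝ F (x, y)).comp
        (ContinuousLinearMap.inr ℝ _ _))).toLinearMap = 0 := by
      refine (EuclideanSpace.basisFun (Fin m) ℝ).toBasis.ext fun i => ?_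
      simpa using hD i
    exact DFunLike.congr_fun h3 w
  refine Subtype.ext (IsKilling.eq_zero (isSmoothMetric_spherical hs hf)
    (warped_symm hh.symm f roundMetric_symm)
    (warped_nondegenerate hh.nondegenerate hf_pos roundMetric_nondegenerate) V.2 (p, q) hxy
    (Prod.ext (hz x hx y) h1) ?_)
  refine ContinuousLinearMap.ext fun u => Prod.ext (hA' u) ?_
  have h3 : u = (u.1, 0) + (0, u.2) := by simp
  rw [h3, map_add]
  change (fderiv ℝ F (x, y) (u.1, 0)).2 + (fderiv ℝ F (x, y) (0, u.2)).2 = 0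
  rw [hB, hE, add_zero]

/-- More than `m (m + 1) / 2` independent Killing fields cannot all be tangent to the spheres. -/
theorem exists_baseSlice_ne_zero [ConnectedSpace N] [NeZero m] (hh : IsLorentzian (𝓡 2) h)
    (hf : ContMDiff (𝓡 2) 𝓘(ℝ, ℝ) ∞ f) (hf_pos : ∀ p, 0 < f p)
    (hdim : ((m * (m + 1) / 2 + 1 : ℕ) : Cardinal) ≤
      Module.rank ℝ (killingAlgebra ((𝓡 2).prod (𝓡 m)) (spherical m h f))) :
    ∃ V : VField ((𝓡 2).prod (𝓡 m)) (N × Sph m),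
      IsKilling ((𝓡 2).prod (𝓡 m)) (spherical m h f) V ∧ ∃ b, baseSlice V b ≠ 0 := by
  by_contra! hno
  obtain ⟨p⟩ := (inferInstance : Nonempty N)
  obtain ⟨q⟩ := (inferInstance : Nonempty (Sph m))
  have hinj : Function.Injective (sphereJet h f p q) := by
    rw [injective_iff_map_eq_zero]
    intro V h0
    exact sphereJet_eq_zero hh hf hf_pos p q V (hno V V.2) h0
  have hfin := Module.Finite.of_injective _ hinj
  have h1 := LinearMap.finrank_le_finrank_of_injective hinj
  rw [← Module.finrank_eq_rank, Nat.cast_le] at hdim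
  rw [Module.finrank_prod, finrank_euclideanSpace_fin, Module.finrank_fintype_fun_eq_card,
    card_pairs] at h1
  have h2 : m + m * (m - 1) / 2 = m * (m + 1) / 2 := by
    obtain ⟨k, rfl⟩ := Nat.exists_eq_succ_of_ne_zero (NeZero.ne m)
    have : k.succ * (k.succ + 1) = k.succ * (k.succ - 1) + 2 * k.succ := by
      simp only [Nat.succ_eq_add_one, Nat.add_sub_cancel]; ring
    omega
  omega

end Base

/-! ### The fields `W_X` -/

section General

variable {E : Type*} [NormedAddCommGroup E] [NormedSpace ℝ E]
  {H : Type*} [TopologicalSpace H] {I : ModelWithCorners ℝ E H} [I.Boundaryless]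
  {M : Type*} [TopologicalSpace M] [ChartedSpace H M] [IsManifold I ∞ M]

/-- The coordinate expression of `X(ln f)`. -/
theorem dirDeriv_log_eq (x₀ : M) {e : E} (he : e ∈ (extChartAt I x₀).target) {f : M → ℝ}
    (hf : ContMDiff I 𝓘(ℝ, ℝ) ∞ f) (hf_pos : ∀ p, 0 < f p) (X : VField I M) :
    dirDeriv I X (fun y => Real.log (f y)) ((extChartAt I x₀).symm e) =
      fderiv ℝ (fun e => f ((extChartAt I x₀).symm e)) e (coordField I x₀ X e) /
        f ((extChartAt I x₀).symm e) := by
  have h1 : DifferentiableAt ℝ (fun e => f ((extChartAt I x₀).symm e)) e :=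
    ((contMDiffAt_iff_contDiffAt_comp_symm (n := ⊤) x₀ he f).1 hf.contMDiffAt).differentiableAt
      (by simp)
  have h2 : MDifferentiableAt I 𝓘(ℝ, ℝ) (fun y => Real.log (f y)) ((extChartAt I x₀).symm e) :=
    ((contMDiffAt_iff_contDiffAt_comp_symm (n := ⊤) x₀ he _).2
      (((contMDiffAt_iff_contDiffAt_comp_symm (n := ⊤) x₀ he f).1 hf.contMDiffAt).log
        (hf_pos _).ne')).mdifferentiableAt (by simp)
  rw [dirDeriv_eq_fderiv x₀ he _ h2, (h1.hasFDerivAt.log (hf_pos _).ne').fderiv]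
  simp
  ring

theorem dirDeriv_log_eq_div {f : M → ℝ} (hf : ContMDiff I 𝓘(ℝ, ℝ) ∞ f) (hf_pos : ∀ p, 0 < f p)
    (X : VField I M) (p : M) :
    dirDeriv I X (fun y => Real.log (f y)) p = dirDeriv I X f p / f p := by
  have he := mem_extChartAt_target (I := I) p
  have h1 := dirDeriv_log_eq p he hf hf_pos X
  rw [← dirDeriv_eq_fderiv p he f ((hf _).mdifferentiableAt (by simp)), extChartAt_to_inv] at h1
  exact h1

theorem contDiffAt_fderiv_coordField (x₀ : M) {e : E} (he : e ∈ (extChartAt I x₀).target)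
    {f : M → ℝ} (hf : ContMDiff I 𝓘(ℝ, ℝ) ∞ f) :
    ContDiffAt ℝ ∞ (fderiv ℝ (fun e => f ((extChartAt I x₀).symm e))) e :=
  ((contMDiffAt_iff_contDiffAt_comp_symm (n := ⊤) x₀ he f).1 hf.contMDiffAt).fderiv_right (by simp)

theorem contMDiff_dirDeriv {X : VField I M} (hX : ∀ x, SmoothFieldAt I X x) {f : M → ℝ}
    (hf : ContMDiff I 𝓘(ℝ, ℝ) ∞ f) : ContMDiff I 𝓘(ℝ, ℝ) ∞ (dirDeriv I X f) := by
  intro p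
  have he := mem_extChartAt_target (I := I) p
  have hp := extChartAt_to_inv (I := I) p
  have h1 := (contMDiffAt_iff_contDiffAt_comp_symm (n := ⊤) p he (dirDeriv I X f)).2
    ((((contDiffAt_fderiv_coordField p he hf).clm_apply
      ((smoothFieldAt_iff p he X).1 (hX _)))).congr_of_eventuallyEq (by
        filter_upwards [(isOpen_extChartAt_target (I := I) p).mem_nhds he] with e' he'
        exact dirDeriv_eq_fderiv p he' f ((hf _).mdifferentiableAt (by simp)) X))
  rwa [hp] at h1

omit [I.Boundaryless] [IsManifold I ∞ M] in
/-- `h(W_X, ·) = h(X, ·) + f² d(X(ln f))`, the defining property of the gradient. -/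
theorem wField_apply [FiniteDimensional ℝ E] {h : Tensor2 I M}
    (hnd : ∀ x v, (∀ w, h x v w = 0) → v = 0) (f : M → ℝ) (X : VField I M) (p : M)
    (w : TangentSpace I p) :
    h p (wField I h f X p) w = h p (X p) w +
      f p ^ 2 * mvfderiv I (dirDeriv I X (fun y => Real.log (f y))) p w := by
  have h1 := (grad_spec I h (dirDeriv I X (fun y => Real.log (f y))) p (hnd p) _).1 rfl w
  rw [← h1]
  unfold wField
  simp

omit [I.Boundaryless] [IsManifold I ∞ M] in
theorem contMDiff_log {f : M → ℝ} (hf : ContMDiff I 𝓘(ℝ, ℝ) ∞ f) (hf_pos : ∀ p, 0 < f p) :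
    ContMDiff I 𝓘(ℝ, ℝ) ∞ (fun y => Real.log (f y)) := by
  intro p
  exact ContMDiffAt.comp (I' := 𝓘(ℝ, ℝ)) p (Real.contDiffAt_log.2 (hf_pos p).ne').contMDiffAt (hf p)

theorem wField_linear_combination [FiniteDimensional ℝ E] {h : Tensor2 I M}
    (hnd : ∀ x v, (∀ w, h x v w = 0) → v = 0)
    {f : M → ℝ} (hf : ContMDiff I 𝓘(ℝ, ℝ) ∞ f) (hf_pos : ∀ p, 0 < f p)
    {X Y : VField I M} (hX : ∀ x, SmoothFieldAt I X x) (hY : ∀ x, SmoothFieldAt I Y x) (c : ℝ) :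
    wField I h f (X + c • Y) = wField I h f X + c • wField I h f Y := by
  funext p
  rw [← sub_eq_zero]
  refine hnd p _ fun w => ?_
  have hl := contMDiff_log hf hf_pos
  have h1 := (contMDiff_dirDeriv hX hl).mdifferentiableAt (x := p) (by simp)
  have h2 := (contMDiff_dirDeriv hY hl).mdifferentiableAt (x := p) (by simp)
  have h3 : dirDeriv I (X + c • Y) (fun y => Real.log (f y)) =
      dirDeriv I X (fun y => Real.log (f y)) + c • dirDeriv I Y (fun y => Real.log (f y)) := by
    funext y
    simp [dirDeriv]
  rw [map_sub, Pi.add_apply, Pi.smul_apply, map_add, map_smul]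
  simp only [_root_.sub_apply, _root_.add_apply, _root_.smul_apply, wField_apply hnd]
  have h4 : mvfderiv I (c • dirDeriv I Y (fun y => Real.log (f y))) p =
      c • mvfderiv I (dirDeriv I Y (fun y => Real.log (f y))) p := by
    have := mvfderiv_smul (I := I) (a := fun _ => c) (x := p) mdifferentiableAt_const h2
    rw [mvfderiv_const] at this
    refine this.trans ?_
    ext
    simp
  rw [h3, mvfderiv_add h1 (h2.const_smul c), h4]
  have h5 : h p ((X + c • Y) p) w = h p (X p) w + c * h p (Y p) w := by simp
  rw [h5]
  simp
  ring

/-- The linear map `X ↦ W_X` on Killing fields. -/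
def wLinear [FiniteDimensional ℝ E] [CompleteSpace E] (h : Tensor2 I M)
    (hnd : ∀ x v, (∀ w, h x v w = 0) → v = 0) {f : M → ℝ}
    (hf : ContMDiff I 𝓘(ℝ, ℝ) ∞ f) (hf_pos : ∀ p, 0 < f p) :
    killingAlgebra I h →ₗ[ℝ] VField I M where
  toFun X := wField I h f X
  map_add' X Y := by
    have := wField_linear_combination hnd hf hf_pos X.2.1 Y.2.1 1
    simpa using this
  map_smul' c Y := by
    have h1 := wField_linear_combination hnd hf hf_pos (0 : killingAlgebra I h).2.1 Y.2.1 c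
    have h2 := wField_linear_combination hnd hf hf_pos (0 : killingAlgebra I h).2.1 (0 : killingAlgebra I h).2.1 1
    simp only [ZeroMemClass.coe_zero, one_smul, add_zero, zero_add] at h1 h2
    rw [left_eq_add.1 h2, zero_add] at h1
    exact h1

end General

/-! ### Base components of Killing fields of the warped product -/

section BaseComponents

open scoped InnerProductSpace

variable {N : Type*} [TopologicalSpace N] [ChartedSpace (EuclideanSpace ℝ (Fin 2)) N]
  [IsManifold (𝓡 2) ∞ N] {m : ℕ} {h : Tensor2 (𝓡 2) N} {f : N → ℝ}
  {V : VField ((𝓡 2).prod (𝓡 m)) (N × Sph m)}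

/-- In a chart at `q`, the one-form `f⁻² h(A_b, ·) + d(A_b (ln f))` at a point of `N` does not
depend on `b`, where `A_b` is the component tangent to `N` at `b`. -/
theorem slice_form_const (hm : 2 ≤ m) (hh : IsLorentzian (𝓡 2) h)
    (hf : ContMDiff (𝓡 2) 𝓘(ℝ, ℝ) ∞ f)
    (hf_pos : ∀ p, 0 < f p) (hV : IsKilling ((𝓡 2).prod (𝓡 m)) (spherical m h f) V)
    {p : N} (q : Sph m) {x : EuclideanSpace ℝ (Fin 2)} (hx : x ∈ (extChartAt (𝓡 2) p).target)
    (u : EuclideanSpace ℝ (Fin 2)) (y z : EuclideanSpace ℝ (Fin m)) :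
    (f ((extChartAt (𝓡 2) p).symm x) ^ 2)⁻¹ * coordMetric (𝓡 2) p h x u
        (coordField ((𝓡 2).prod (𝓡 m)) (p, q) V (x, y)).1 +
      fderiv ℝ (fun x => fderiv ℝ (fun x => f ((extChartAt (𝓡 2) p).symm x)) x
        (coordField ((𝓡 2).prod (𝓡 m)) (p, q) V (x, y)).1 / f ((extChartAt (𝓡 2) p).symm x)) x u =
    (f ((extChartAt (𝓡 2) p).symm x) ^ 2)⁻¹ * coordMetric (𝓡 2) p h x u
        (coordField ((𝓡 2).prod (𝓡 m)) (p, q) V (x, z)).1 +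
      fderiv ℝ (fun x => fderiv ℝ (fun x => f ((extChartAt (𝓡 2) p).symm x)) x
        (coordField ((𝓡 2).prod (𝓡 m)) (p, q) V (x, z)).1 / f ((extChartAt (𝓡 2) p).symm x)) x u := by
  have hs := hh.isSmoothMetric
  have hmixed := fun y w => killing_mixed hs hf hV q hx y u w
  have hsphere := fun (x' : EuclideanSpace ℝ (Fin 2)) (hx' : x' ∈ (extChartAt (𝓡 2) p).target) y w =>
    killing_sphere hs hf hf_pos hV q hx' y w w
  have hFs := fun y => contDiffAt_coordField_of_isKilling hV q hx y
  have hφs : ContDiffAt ℝ ∞ (fun x => f ((extChartAt (𝓡 2) p).symm x)) x :=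
    (contMDiffAt_iff_contDiffAt_comp_symm (n := ⊤) p hx f).1 hf.contMDiffAt
  have hφ : 0 < f ((extChartAt (𝓡 2) p).symm x) := hf_pos _
  set F := coordField ((𝓡 2).prod (𝓡 m)) (p, q) V with hF
  set φ : EuclideanSpace ℝ (Fin 2) → ℝ := fun x => f ((extChartAt (𝓡 2) p).symm x) with hφd
  change 0 < φ x at hφ
  set κ : EuclideanSpace ℝ (Fin 2) × EuclideanSpace ℝ (Fin m) → ℝ :=
    fun e => fderiv ℝ φ e.1 (F e).1 / φ e.1 with hκ
  have hκs : ∀ y, ContDiffAt ℝ ∞ κ (x, y) := by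
    intro y
    have h1 : ContDiffAt ℝ ∞ (fun e : EuclideanSpace ℝ (Fin 2) × EuclideanSpace ℝ (Fin m) =>
        fderiv ℝ φ e.1) (x, y) :=
      ContDiffAt.comp (g := fderiv ℝ φ) (x, y) (hφs.fderiv_right (by simp)) contDiffAt_fst
    have h2 : ContDiffAt ℝ ∞ (fun e : EuclideanSpace ℝ (Fin 2) × EuclideanSpace ℝ (Fin m) =>
        φ e.1) (x, y) := ContDiffAt.comp (g := φ) (x, y) hφs contDiffAt_fst
    exact (h1.clm_apply (hFs y).fst).div h2 hφ.ne'
  have hyin : ∀ y, HasFDerivAt (𝕜 := ℝ) (fun y : EuclideanSpace ℝ (Fin m) => (x, y))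
      (ContinuousLinearMap.prod 0 (ContinuousLinearMap.id ℝ _)) y :=
    fun y => (hasFDerivAt_const x y).prodMk (hasFDerivAt_id y)
  have hxin : ∀ y : EuclideanSpace ℝ (Fin m), HasFDerivAt (𝕜 := ℝ) (fun x : EuclideanSpace ℝ (Fin 2) => (x, y))
      (ContinuousLinearMap.prod (ContinuousLinearMap.id ℝ _) 0) x :=
    fun y => (hasFDerivAt_id x).prodMk (hasFDerivAt_const y x)
  have hG : ∀ y, fderiv ℝ (fun x => κ (x, y)) x u = fderiv ℝ κ (x, y) (u, 0) := by
    intro y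
    have h1 : HasFDerivAt (fun x => κ (x, y)) _ x :=
      HasFDerivAt.comp (g := κ) (f := fun x => (x, y)) x
        ((hκs y).differentiableAt (by simp)).hasFDerivAt (hxin y)
    rw [h1.fderiv]
    simp
  set Y : EuclideanSpace ℝ (Fin m) → ℝ :=
    fun y => (φ x ^ 2)⁻¹ * coordMetric (𝓡 2) p h x u (F (x, y)).1 with hY
  set G : EuclideanSpace ℝ (Fin m) → ℝ := fun y => fderiv ℝ κ (x, y) (u, 0) with hGd
  have hYs : ContDiff ℝ ∞ Y := by
    rw [contDiff_iff_contDiffAt]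
    intro y
    have h1 : ContDiffAt ℝ ∞ (fun y => F (x, y)) y :=
      (hFs y).comp y (f := fun y => (x, y)) (contDiffAt_const.prodMk contDiffAt_id)
    exact contDiffAt_const.mul (contDiffAt_const.clm_apply h1.fst)
  have hGs : ContDiff ℝ ∞ G := by
    rw [contDiff_iff_contDiffAt]
    intro y
    have h1 : ContDiffAt ℝ ∞ (fun y => fderiv ℝ κ (x, y)) y :=
      ((hκs y).fderiv_right (m := ∞) (by simp)).comp y (f := fun y => (x, y))
        (contDiffAt_const.prodMk contDiffAt_id)
    exact h1.clm_apply contDiffAt_const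
  have hDY : ∀ y w, fderiv ℝ Y y w =
      (φ x ^ 2)⁻¹ * coordMetric (𝓡 2) p h x u (fderiv ℝ F (x, y) (0, w)).1 := by
    intro y w
    have h1 : HasFDerivAt (fun y => F (x, y)) _ y :=
      HasFDerivAt.comp (g := F) (f := fun y => (x, y)) y
        ((hFs y).differentiableAt (by simp)).hasFDerivAt (hyin y)
    have h2 : HasFDerivAt Y _ y :=
      ((coordMetric (𝓡 2) p h x u).hasFDerivAt.comp y h1.fst).const_mul ((φ x ^ 2)⁻¹)
    rw [h2.fderiv]
    simp
  have hDY' : ∀ y w, stereoFactor y ^ 2 * fderiv ℝ Y y w =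
      -⟪(fderiv ℝ F (x, y) (u, 0)).2, w⟫_ℝ := by
    intro y w
    have h1 := hmixed y w
    rw [hDY]
    have h2 := (stereoFactor_pos y).ne'
    have h3 : coordMetric (𝓡 2) p h x u (fderiv ℝ F (x, y) (0, w)).1 =
        -(φ x ^ 2 * ((stereoFactor y ^ 2)⁻¹ * ⟪(fderiv ℝ F (x, y) (u, 0)).2, w⟫_ℝ)) := by
      linarith
    rw [h3]
    field_simp
  have hF2 : ∀ y, HasFDerivAt (fderiv ℝ F) (fderiv ℝ (fderiv ℝ F) (x, y)) (x, y) := fun y =>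
    (((hFs y).fderiv_right (m := ∞) (by simp)).differentiableAt (by simp)).hasFDerivAt
  have hmain : ∀ y w, dd w (fun y => stereoFactor y ^ 2 * dd w Y y) y =
      (G y + stereoFactor y * (fderiv ℝ Y y y) / 2) * ‖w‖ ^ 2 := by
    intro y w
    have e1 : (fun y => stereoFactor y ^ 2 * dd w Y y) =
        fun y => -⟪(fderiv ℝ F (x, y) (u, 0)).2, w⟫_ℝ := funext fun y => hDY' y w
    have h1 : HasFDerivAt (fun y => fderiv ℝ F (x, y)) _ y :=
      HasFDerivAt.comp (g := fderiv ℝ F) (f := fun y => (x, y)) y (hF2 y) (hyin y)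
    have h2 : HasFDerivAt (fun y => -⟪(fderiv ℝ F (x, y) (u, 0)).2, w⟫_ℝ) _ y :=
      ((h1.clm_apply (hasFDerivAt_const (u, (0 : EuclideanSpace ℝ (Fin m))) y)).snd.inner ℝ
        (hasFDerivAt_const w y)).neg
    have e2 : dd w (fun y => stereoFactor y ^ 2 * dd w Y y) y =
        -⟪(fderiv ℝ (fderiv ℝ F) (x, y) (0, w) (u, 0)).2, w⟫_ℝ := by
      rw [e1]
      unfold dd
      rw [h2.fderiv]
      simp
    have e3 : fderiv ℝ (fderiv ℝ F) (x, y) (0, w) (u, 0) =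
        fderiv ℝ (fderiv ℝ F) (x, y) (u, 0) (0, w) :=
      ((hFs y).isSymmSndFDerivAt (by rw [minSmoothness_of_isRCLikeNormedField]; norm_cast)) _ _
    -- the derivative of the spherical components of the Killing equation in the direction `u`
    have h3 : HasFDerivAt (fun x => fderiv ℝ F (x, y)) _ x :=
      HasFDerivAt.comp (g := fderiv ℝ F) (f := fun x => (x, y)) x (hF2 y) (hxin y)
    have h4 : HasFDerivAt (fun x => ⟪(fderiv ℝ F (x, y) (0, w)).2, w⟫_ℝ) _ x :=
      (h3.clm_apply (hasFDerivAt_const ((0 : EuclideanSpace ℝ (Fin 2)), w) x)).snd.inner ℝ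
        (hasFDerivAt_const w x)
    have h5 : HasFDerivAt (fun x => F (x, y)) _ x :=
      HasFDerivAt.comp (g := F) (f := fun x => (x, y)) x
        ((hFs y).differentiableAt (by simp)).hasFDerivAt (hxin y)
    have h6 : HasFDerivAt (fun x => κ (x, y)) _ x :=
      HasFDerivAt.comp (g := κ) (f := fun x => (x, y)) x
        ((hκs y).differentiableAt (by simp)).hasFDerivAt (hxin y)
    have h7 : HasFDerivAt (fun x => ((stereoFactor y)⁻¹ * ⟪y, (F (x, y)).2⟫_ℝ - 2 * κ (x, y)) *
        (‖w‖ ^ 2 / 2)) _ x :=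
      ((((hasFDerivAt_const y x).inner ℝ h5.snd).const_mul (stereoFactor y)⁻¹).sub
        (h6.const_mul 2)).mul_const (‖w‖ ^ 2 / 2)
    have e4 : (fun x => ⟪(fderiv ℝ F (x, y) (0, w)).2, w⟫_ℝ) =ᶠ[nhds x]
        fun x => ((stereoFactor y)⁻¹ * ⟪y, (F (x, y)).2⟫_ℝ - 2 * κ (x, y)) * (‖w‖ ^ 2 / 2) := by
      filter_upwards [(isOpen_extChartAt_target p).mem_nhds hx] with x' hx'
      have h8 := hsphere x' hx' y w
      rw [real_inner_comm, real_inner_self_eq_norm_sq, div_eq_inv_mul] at h8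
      have h9 := real_inner_comm w (fderiv ℝ F (x', y) (0, w)).2
      simp only [hκ]
      linarith
    have e5 := DFunLike.congr_fun (h4.unique (h7.congr_of_eventuallyEq e4)) u
    have e6 : ⟪(fderiv ℝ (fderiv ℝ F) (x, y) (u, 0) (0, w)).2, w⟫_ℝ =
        ((stereoFactor y)⁻¹ * ⟪y, (fderiv ℝ F (x, y) (u, 0)).2⟫_ℝ - 2 * G y) * (‖w‖ ^ 2 / 2) := by
      simpa [hGd, mul_comm] using e5
    have e7 := hDY' y y
    rw [real_inner_comm] at e7
    have e8 : ⟪y, (fderiv ℝ F (x, y) (u, 0)).2⟫_ℝ = -(stereoFactor y ^ 2 * fderiv ℝ Y y y) := by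
      linarith
    rw [e2, e3, e6, e8]
    have h2 := (stereoFactor_pos y).ne'
    field_simp
    ring
  have h1 := concircular_add_const hm hYs hGs hmain y z
  have h2 := hG y
  have h3 := hG z
  simp only [hκ] at h2 h3
  rw [h2, h3]
  exact h1

/-- In a chart of the sphere, the field `W` of the component tangent to `N` does not depend on the
point of the sphere. -/
theorem wField_baseSlice_symm_eq (hm : 2 ≤ m) (hh : IsLorentzian (𝓡 2) h)
    (hf : ContMDiff (𝓡 2) 𝓘(ℝ, ℝ) ∞ f)
    (hf_pos : ∀ p, 0 < f p) (hV : IsKilling ((𝓡 2).prod (𝓡 m)) (spherical m h f) V)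
    (q : Sph m) (y z : EuclideanSpace ℝ (Fin m)) :
    wField (𝓡 2) h f (baseSlice V ((extChartAt (𝓡 m) q).symm y)) =
      wField (𝓡 2) h f (baseSlice V ((extChartAt (𝓡 m) q).symm z)) := by
  have key : ∀ (p : N) (x : EuclideanSpace ℝ (Fin 2)) (_ : x ∈ (extChartAt (𝓡 2) p).target)
      (u : EuclideanSpace ℝ (Fin 2)) (y : EuclideanSpace ℝ (Fin m)),
      h ((extChartAt (𝓡 2) p).symm x)
        (wField (𝓡 2) h f (baseSlice V ((extChartAt (𝓡 m) q).symm y)) ((extChartAt (𝓡 2) p).symm x))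
        (frame (𝓡 2) p x u) = f ((extChartAt (𝓡 2) p).symm x) ^ 2 *
      ((f ((extChartAt (𝓡 2) p).symm x) ^ 2)⁻¹ * coordMetric (𝓡 2) p h x u
        (coordField ((𝓡 2).prod (𝓡 m)) (p, q) V (x, y)).1 +
      fderiv ℝ (fun x => fderiv ℝ (fun x => f ((extChartAt (𝓡 2) p).symm x)) x
        (coordField ((𝓡 2).prod (𝓡 m)) (p, q) V (x, y)).1 / f ((extChartAt (𝓡 2) p).symm x)) x u) := by
    intro p x hx u y
    have hK := isKilling_baseSlice hh.isSmoothMetric hf hV ((extChartAt (𝓡 m) q).symm y)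
    have hφ : f ((extChartAt (𝓡 2) p).symm x) ^ 2 ≠ 0 := (pow_pos (hf_pos _) 2).ne'
    rw [wField_apply hh.nondegenerate, mvfderiv_apply_eq_fderiv p hx _
      ((contMDiff_dirDeriv hK.1 (contMDiff_log hf hf_pos)).mdifferentiableAt (by simp)),
      mul_add, mul_inv_cancel_left₀ hφ]
    have e1 : (fun x => dirDeriv (𝓡 2) (baseSlice V ((extChartAt (𝓡 m) q).symm y))
        (fun y => Real.log (f y)) ((extChartAt (𝓡 2) p).symm x)) =ᶠ[nhds x]
        fun x => fderiv ℝ (fun x => f ((extChartAt (𝓡 2) p).symm x)) x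
        (coordField ((𝓡 2).prod (𝓡 m)) (p, q) V (x, y)).1 / f ((extChartAt (𝓡 2) p).symm x) := by
      filter_upwards [(isOpen_extChartAt_target p).mem_nhds hx] with x' hx'
      rw [dirDeriv_log_eq p hx' hf hf_pos, coordField_baseSlice q hx' y]
    rw [e1.fderiv_eq]
    congr 1
    rw [hh.symm, ← frame_coordField p hx (baseSlice V ((extChartAt (𝓡 m) q).symm y)),
      ← coordMetric_apply, coordField_baseSlice q hx y]
  funext p
  rw [← sub_eq_zero]
  refine hh.nondegenerate p _ fun w => ?_
  have hx := mem_extChartAt_target (I := 𝓡 2) p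
  have hp := extChartAt_to_inv (I := 𝓡 2) p
  have h1 : ∀ p' : N, (extChartAt (𝓡 2) p).symm (extChartAt (𝓡 2) p p) = p' → ∀ w : TangentSpace (𝓡 2) p',
      h p' (wField (𝓡 2) h f (baseSlice V ((extChartAt (𝓡 m) q).symm y)) p') w =
      h p' (wField (𝓡 2) h f (baseSlice V ((extChartAt (𝓡 m) q).symm z)) p') w := by
    rintro _ rfl w
    rw [← frame_coframe p hx w, key p _ hx, key p _ hx,
      slice_form_const hm hh hf hf_pos hV q hx _ y z]
  rw [map_sub, _root_.sub_apply, h1 p hp w, sub_self]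

/-- The field `W` of the component tangent to `N` does not depend on the point of the sphere: it is
locally constant, and the sphere is connected. -/
theorem wField_baseSlice_eq [NeZero m] (hm : 2 ≤ m) (hh : IsLorentzian (𝓡 2) h)
    (hf : ContMDiff (𝓡 2) 𝓘(ℝ, ℝ) ∞ f)
    (hf_pos : ∀ p, 0 < f p) (hV : IsKilling ((𝓡 2).prod (𝓡 m)) (spherical m h f) V)
    (b c : Sph m) :
    wField (𝓡 2) h f (baseSlice V b) = wField (𝓡 2) h f (baseSlice V c) := by
  have h1 : IsLocallyConstant fun b => wField (𝓡 2) h f (baseSlice V b) := by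
    rw [IsLocallyConstant.iff_eventually_eq]
    intro q
    filter_upwards [extChartAt_source_mem_nhds (I := 𝓡 m) q] with b hb
    have h2 := wField_baseSlice_symm_eq hm hh hf hf_pos hV q (extChartAt (𝓡 m) q b)
      (extChartAt (𝓡 m) q q)
    rwa [extChartAt_to_inv, (extChartAt (𝓡 m) q).left_inv hb] at h2
  exact h1.apply_eq_of_preconnectedSpace b c

/-- If the component of a Killing field tangent to `N` does not depend on the point of the sphere,
then it preserves `f`: the component tangent to each sphere is a homothetic field. -/
theorem dirDeriv_baseSlice_eq_zero (hm : 2 ≤ m) (hh : IsLorentzian (𝓡 2) h)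
    (hf : ContMDiff (𝓡 2) 𝓘(ℝ, ℝ) ∞ f)
    (hf_pos : ∀ p, 0 < f p) (hV : IsKilling ((𝓡 2).prod (𝓡 m)) (spherical m h f) V)
    {X : VField (𝓡 2) N} (hX : ∀ b, baseSlice V b = X) (q : Sph m) (p : N) :
    dirDeriv (𝓡 2) X f p = 0 := by
  have hx := mem_extChartAt_target (I := 𝓡 2) p
  have hp := extChartAt_to_inv (I := 𝓡 2) p
  set x := extChartAt (𝓡 2) p p with hxd
  have hsphere := fun y w w' => killing_sphere hh.isSmoothMetric hf hf_pos hV q hx y w w'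
  have hFs := fun y => contDiffAt_coordField_of_isKilling hV q hx y
  have hA : ∀ y, (coordField ((𝓡 2).prod (𝓡 m)) (p, q) V (x, y)).1 = coordField (𝓡 2) p X x := by
    intro y
    rw [← coordField_baseSlice q hx y, hX]
  set F := coordField ((𝓡 2).prod (𝓡 m)) (p, q) V with hF
  have hyin : ∀ y, HasFDerivAt (𝕜 := ℝ) (fun y : EuclideanSpace ℝ (Fin m) => (x, y))
      (ContinuousLinearMap.prod 0 (ContinuousLinearMap.id ℝ _)) y :=
    fun y => (hasFDerivAt_const x y).prodMk (hasFDerivAt_id y)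
  have hb : ContDiff ℝ ∞ (fun y => (F (x, y)).2) := by
    rw [contDiff_iff_contDiffAt]
    intro y
    have h1 : ContDiffAt ℝ ∞ (fun y => F (x, y)) y :=
      (hFs y).comp y (f := fun y => (x, y)) (contDiffAt_const.prodMk contDiffAt_id)
    exact h1.snd
  have hDb : ∀ y w, fderiv ℝ (fun y => (F (x, y)).2) y w = (fderiv ℝ F (x, y) (0, w)).2 := by
    intro y w
    have h1 : HasFDerivAt (fun y => F (x, y)) _ y :=
      HasFDerivAt.comp (g := F) (f := fun y => (x, y)) y
        ((hFs y).differentiableAt (by simp)).hasFDerivAt (hyin y)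
    have h2 : HasFDerivAt (fun y => (F (x, y)).2) _ y := h1.snd
    rw [h2.fderiv]
    simp
  have h1 := homothety_factor_eq_zero hm hb
    (fderiv ℝ (fun x => f ((extChartAt (𝓡 2) p).symm x)) x (coordField (𝓡 2) p X x) /
      f ((extChartAt (𝓡 2) p).symm x)) (by
      intro y w w'
      rw [hDb, hDb, hsphere y w w', hA])
  rw [div_eq_zero_iff, or_iff_left (hf_pos _).ne', ← dirDeriv_eq_fderiv p hx f
    ((hf _).mdifferentiableAt (by simp)), hp] at h1
  exact h1

/-- If the `W_X` determine `X`, then some nonzero Killing field of the base preserves `f`. -/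
theorem exists_killing_dirDeriv_eq_zero [NeZero m] [ConnectedSpace N] (hm : 2 ≤ m)
    (hh : IsLorentzian (𝓡 2) h) (hf : ContMDiff (𝓡 2) 𝓘(ℝ, ℝ) ∞ f) (hf_pos : ∀ p, 0 < f p)
    (hV : IsKilling ((𝓡 2).prod (𝓡 m)) (spherical m h f) V) {b₀ : Sph m} (hb : baseSlice V b₀ ≠ 0)
    (hinj : Function.Injective (wLinear h hh.nondegenerate hf hf_pos)) :
    ∃ ξ : killingAlgebra (𝓡 2) h, ξ ≠ 0 ∧ ∀ p, dirDeriv (𝓡 2) (ξ : VField (𝓡 2) N) f p = 0 := by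
  have hK := isKilling_baseSlice hh.isSmoothMetric hf hV
  refine ⟨⟨baseSlice V b₀, hK b₀⟩, fun h0 => hb (congrArg Subtype.val h0), fun p => ?_⟩
  refine dirDeriv_baseSlice_eq_zero hm hh hf hf_pos hV (fun b => ?_) b₀ p
  have h1 : (⟨baseSlice V b, hK b⟩ : killingAlgebra (𝓡 2) h) = ⟨baseSlice V b₀, hK b₀⟩ :=
    hinj (wField_baseSlice_eq hm hh hf hf_pos hV b b₀)
  exact congrArg Subtype.val h1

end BaseComponents

/-! ### The fields `ξ^i` and `ζ^{ij}` -/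

section SphereFields

open scoped InnerProductSpace

variable {m : ℕ}

theorem contMDiff_sphY (i : Fin (m + 1)) : ContMDiff (𝓡 m) 𝓘(ℝ, ℝ) ∞ (sphY m i) := by
  intro q
  have h1 := contMDiff_sphere_coe m q
  exact ContMDiffAt.comp (I' := 𝓡 (m + 1)) q
    (EuclideanSpace.proj (𝕜 := ℝ) i : EuclideanSpace ℝ (Fin (m + 1)) →L[ℝ] ℝ).contDiff.contDiffAt.contMDiffAt h1

theorem mvfderiv_sphY (i : Fin (m + 1)) (q : Sph m) (w : TangentSpace (𝓡 m) q) :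
    mvfderiv (𝓡 m) (sphY m i) q w = sphIncl q w i := by
  have h1 := mvfderiv_comp_apply (I' := 𝓡 m) (I := 𝓡 (m + 1))
    (f := fun q : Sph m => (q : EuclideanSpace ℝ (Fin (m + 1))))
    (g := (EuclideanSpace.proj (𝕜 := ℝ) i : EuclideanSpace ℝ (Fin (m + 1)) →L[ℝ] ℝ)) q
    (EuclideanSpace.proj (𝕜 := ℝ) i : EuclideanSpace ℝ (Fin (m + 1)) →L[ℝ] ℝ).mdifferentiableAt
    ((contMDiff_sphere_coe m).mdifferentiableAt (by simp)) w
  refine h1.trans ?_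
  exact DFunLike.congr_fun ((EuclideanSpace.proj (𝕜 := ℝ) i :
    EuclideanSpace ℝ (Fin (m + 1)) →L[ℝ] ℝ).hasMFDerivAt
      (x := (q : EuclideanSpace ℝ (Fin (m + 1))))).mfderiv (sphIncl q w)

theorem roundMetric_sphZ (i : Fin (m + 1)) (q : Sph m) (w : TangentSpace (𝓡 m) q) :
    roundMetric m q (sphZ m i q) w = sphIncl q w i :=
  ((grad_spec (𝓡 m) (roundMetric m) (sphY m i) q (roundMetric_nondegenerate q) _).1 rfl w).trans
    (mvfderiv_sphY i q w)

/-- In a stereographic chart `Y^i` and `Z^i` are explicit rational and polynomial functions. -/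
theorem exists_sphY_sphZ_eq (q : Sph m) (i : Fin (m + 1)) :
    ∃ (l : EuclideanSpace ℝ (Fin m)) (c : ℝ),
      (∀ y, sphY m i ((extChartAt (𝓡 m) q).symm y) =
        c + (stereoFactor y)⁻¹ * (⟪l, y⟫_ℝ - 2 * c)) ∧
      ∀ y, coordField (𝓡 m) q (sphZ m i) y =
        stereoFactor y • l - ((1 / 2) * (⟪l, y⟫_ℝ - 2 * c)) • y := by
  obtain ⟨L, n, -, -, hL⟩ := exists_stereoParam_eq q
  set l := ContinuousLinearMap.adjoint L.toContinuousLinearMap (EuclideanSpace.single i (1 : ℝ))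
    with hl
  have hli : ∀ y, L y i = ⟪l, y⟫_ℝ := by
    intro y
    rw [hl, ContinuousLinearMap.adjoint_inner_left, EuclideanSpace.inner_single_left]
    simp
  have hY : ∀ y, sphY m i ((extChartAt (𝓡 m) q).symm y) =
      n i + (stereoFactor y)⁻¹ * (⟪l, y⟫_ℝ - 2 * n i) := by
    intro y
    change stereoParam q y i = _
    rw [hL, ← hli]
    simp
  refine ⟨l, n i, hY, fun y => ?_⟩
  have hy := mem_sphere_target q y
  have h1 : frame (𝓡 m) q y (stereoFactor y • l - ((1 / 2) * (⟪l, y⟫_ℝ - 2 * n i)) • y) =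
      sphZ m i ((extChartAt (𝓡 m) q).symm y) := by
    refine (grad_spec (𝓡 m) (roundMetric m) (sphY m i) _ (roundMetric_nondegenerate _) _).2
      fun w => ?_
    rw [← frame_coframe q hy w, mvfderiv_apply_eq_fderiv q hy _
      ((contMDiff_sphY i).mdifferentiableAt (by simp)), ← coordMetric_apply,
      coordMetric_roundMetric]
    set w' := coframe (𝓡 m) q ((extChartAt (𝓡 m) q).symm y) w
    have h2 : HasFDerivAt (fun y => n i + (stereoFactor y)⁻¹ * (⟪l, y⟫_ℝ - 2 * n i)) _ y :=
      ((hasFDerivAt_stereoFactor_inv y).mul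
        (((hasFDerivAt_const l y).inner ℝ (hasFDerivAt_id y)).sub_const (2 * n i))).const_add (n i)
    have h0 := (stereoFactor_pos y).ne'
    rw [show (fun y => sphY m i ((extChartAt (𝓡 m) q).symm y)) = _ from funext hY, h2.fderiv,
      inner_sub_left, real_inner_smul_left, real_inner_smul_left]
    simp
    field_simp
    ring
  unfold coordField
  rw [← h1]
  exact coframe_frame q hy _

/-- The Lie derivative of the round metric along a field `Z` of the sphere equals `2 lam` times
the round metric, in charts. -/
def ConformalAt (Z : VField (𝓡 m) (Sph m)) (q : Sph m) (y : EuclideanSpace ℝ (Fin m)) (lam : ℝ) : Prop :=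
  ∀ w w', fderiv ℝ (fun y => coordMetric (𝓡 m) q (roundMetric m) y w w') y (coordField (𝓡 m) q Z y) +
    coordMetric (𝓡 m) q (roundMetric m) y (fderiv ℝ (coordField (𝓡 m) q Z) y w) w' +
    coordMetric (𝓡 m) q (roundMetric m) y w (fderiv ℝ (coordField (𝓡 m) q Z) y w') =
      2 * lam * coordMetric (𝓡 m) q (roundMetric m) y w w'

theorem contDiff_coordField_sphZ (q : Sph m) (i : Fin (m + 1)) :
    ContDiff ℝ ∞ (coordField (𝓡 m) q (sphZ m i)) := by
  obtain ⟨l, c, -, hZ⟩ := exists_sphY_sphZ_eq q i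
  rw [show coordField (𝓡 m) q (sphZ m i) = _ from funext hZ]
  exact (contDiff_stereoFactor.smul contDiff_const).sub ((contDiff_const.mul
    ((contDiff_const.inner ℝ contDiff_id).sub contDiff_const)).smul contDiff_id)

/-- The gradient of a Cartesian coordinate is a conformal field of the sphere, with factor minus
the coordinate. -/
theorem conformalAt_sphZ (q : Sph m) (i : Fin (m + 1)) (y : EuclideanSpace ℝ (Fin m)) :
    ConformalAt (sphZ m i) q y (-sphY m i ((extChartAt (𝓡 m) q).symm y)) := by
  obtain ⟨l, c, hY, hZ⟩ := exists_sphY_sphZ_eq q i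
  intro w w'
  have h1 : HasFDerivAt (fun y => stereoFactor y • l - ((1 / 2) * (⟪l, y⟫_ℝ - 2 * c)) • y) _ y :=
    ((hasFDerivAt_stereoFactor y).smul (hasFDerivAt_const l y)).sub
      ((((((hasFDerivAt_const l y).inner ℝ (hasFDerivAt_id y)).sub_const (2 * c))).const_mul
        (1 / 2)).smul (hasFDerivAt_id y))
  have h2 : ∀ v, fderiv ℝ (coordField (𝓡 m) q (sphZ m i)) y v = (1 / 2 * ⟪y, v⟫_ℝ) • l -
      ((1 / 2 * ⟪l, v⟫_ℝ) • y + ((1 / 2) * (⟪l, y⟫_ℝ - 2 * c)) • v) := by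
    intro v
    rw [show coordField (𝓡 m) q (sphZ m i) = _ from funext hZ, h1.fderiv]
    simp
    module
  rw [fderiv_roundMetric, h2, h2, hZ, hY]
  simp only [coordMetric_roundMetric, inner_sub_left, inner_sub_right, inner_add_left,
    inner_add_right, real_inner_smul_left, real_inner_smul_right, real_inner_self_eq_norm_sq]
  rw [real_inner_comm l y, real_inner_comm l w, real_inner_comm y w]
  have hf : ‖y‖ ^ 2 = 4 * (stereoFactor y - 1) := by unfold stereoFactor; ring
  have h0 := (stereoFactor_pos y).ne'
  rw [hf]
  field_simp
  ring

theorem coordField_sphZeta (q : Sph m) (i j : Fin (m + 1)) (y : EuclideanSpace ℝ (Fin m)) :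
    coordField (𝓡 m) q (sphZeta m i j) y =
      sphY m i ((extChartAt (𝓡 m) q).symm y) • coordField (𝓡 m) q (sphZ m j) y -
        sphY m j ((extChartAt (𝓡 m) q).symm y) • coordField (𝓡 m) q (sphZ m i) y := by
  unfold coordField sphZeta
  rw [map_sub, map_smul, map_smul]

theorem contDiff_sphY_symm (q : Sph m) (i : Fin (m + 1)) :
    ContDiff ℝ ∞ (fun y => sphY m i ((extChartAt (𝓡 m) q).symm y)) := by
  rw [contDiff_iff_contDiffAt]
  intro y
  exact (contMDiffAt_iff_contDiffAt_comp_symm (n := ⊤) q (mem_sphere_target q y) _).1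
    (contMDiff_sphY i _)

/-- The rotation fields of the sphere are Killing. -/
theorem conformalAt_sphZeta (q : Sph m) (i j : Fin (m + 1)) (y : EuclideanSpace ℝ (Fin m)) :
    ConformalAt (sphZeta m i j) q y 0 := by
  intro w w'
  have hg : ∀ (i : Fin (m + 1)) v, fderiv ℝ (fun y => sphY m i ((extChartAt (𝓡 m) q).symm y)) y v =
      coordMetric (𝓡 m) q (roundMetric m) y (coordField (𝓡 m) q (sphZ m i) y) v := by
    intro i v
    rw [← mvfderiv_apply_eq_fderiv q (mem_sphere_target q y) _
      ((contMDiff_sphY i).mdifferentiableAt (by simp)), mvfderiv_sphY, ← roundMetric_sphZ,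
      coordMetric_apply, frame_coordField q (mem_sphere_target q y)]
  have hd : ∀ i j, HasFDerivAt (fun y => sphY m i ((extChartAt (𝓡 m) q).symm y) •
      coordField (𝓡 m) q (sphZ m j) y) _ y := fun i j =>
    ((contDiff_sphY_symm q i).differentiable (by simp) y).hasFDerivAt.smul
      ((contDiff_coordField_sphZ q j).differentiable (by simp) y).hasFDerivAt
  have h1 : HasFDerivAt (fun y => sphY m i ((extChartAt (𝓡 m) q).symm y) •
      coordField (𝓡 m) q (sphZ m j) y - sphY m j ((extChartAt (𝓡 m) q).symm y) •
      coordField (𝓡 m) q (sphZ m i) y) _ y := (hd i j).sub (hd j i)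
  have h2 := conformalAt_sphZ q i y w w'
  have h3 := conformalAt_sphZ q j y w w'
  have hs : ∀ a b, coordMetric (𝓡 m) q (roundMetric m) y a b =
      coordMetric (𝓡 m) q (roundMetric m) y b a := by
    intro a b
    rw [coordMetric_roundMetric, coordMetric_roundMetric, real_inner_comm]
  rw [show coordField (𝓡 m) q (sphZeta m i j) = _ from funext (coordField_sphZeta q i j), h1.fderiv]
  simp only [_root_.sub_apply, _root_.add_apply, _root_.smul_apply, ContinuousLinearMap.smulRight_apply,
    map_sub, map_add, map_smul, hg, smul_eq_mul]
  rw [hs w (coordField (𝓡 m) q (sphZ m i) y), hs w (coordField (𝓡 m) q (sphZ m j) y)]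
  linear_combination (sphY m i ((extChartAt (𝓡 m) q).symm y)) * h3 -
    (sphY m j ((extChartAt (𝓡 m) q).symm y)) * h2

end SphereFields

section ProductFields

open scoped InnerProductSpace

variable {N : Type*} [TopologicalSpace N] [ChartedSpace (EuclideanSpace ℝ (Fin 2)) N]
  [IsManifold (𝓡 2) ∞ N] {m : ℕ} {h : Tensor2 (𝓡 2) N} {f : N → ℝ}

/-- The field with components `Y X` and `u Z` is Killing if `X` is Killing on the base and `Z` is
conformal on the sphere, provided that the terms in the two diagonal blocks and in the mixed block
cancel. -/
theorem isKilling_prodField (hh : IsLorentzian (𝓡 2) h) (hf : ContMDiff (𝓡 2) 𝓘(ℝ, ℝ) ∞ f)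
    {X : VField (𝓡 2) N} (hX : IsKilling (𝓡 2) h X) {Y : Sph m → ℝ}
    (hY : ContMDiff (𝓡 m) 𝓘(ℝ, ℝ) ∞ Y) {u : N → ℝ} (hu : ContMDiff (𝓡 2) 𝓘(ℝ, ℝ) ∞ u)
    {Z : VField (𝓡 m) (Sph m)} (hZ : ∀ q, ContDiff ℝ ∞ (coordField (𝓡 m) q Z)) {lam : Sph m → ℝ}
    (hlam : ∀ q y, ConformalAt Z q y (lam ((extChartAt (𝓡 m) q).symm y)))
    (h1 : ∀ p q, Y q * dirDeriv (𝓡 2) X f p + u p * lam q * f p = 0)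
    (h2 : ∀ p q (a : TangentSpace (𝓡 2) p) (b : TangentSpace (𝓡 m) q),
      mvfderiv (𝓡 m) Y q b * h p (X p) a +
        f p ^ 2 * mvfderiv (𝓡 2) u p a * roundMetric m q (Z q) b = 0) :
    IsKilling ((𝓡 2).prod (𝓡 m)) (spherical m h f)
      (prodField (𝓡 2) (𝓡 m) (fun x => Y x.2 • X x.1) (fun x => u x.1 • Z x.2)) := by
  have hs := hh.isSmoothMetric
  set V := prodField (𝓡 2) (𝓡 m) (fun x : N × Sph m => Y x.2 • X x.1) (fun x => u x.1 • Z x.2)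
    with hV
  have hYs : ∀ q, ContDiff ℝ ∞ (fun y => Y ((extChartAt (𝓡 m) q).symm y)) := by
    intro q
    rw [contDiff_iff_contDiffAt]
    intro y
    exact (contMDiffAt_iff_contDiffAt_comp_symm (n := ⊤) q (mem_sphere_target q y) _).1 (hY _)
  have hus : ∀ p, ∀ x ∈ (extChartAt (𝓡 2) p).target,
      ContDiffAt ℝ ∞ (fun x => u ((extChartAt (𝓡 2) p).symm x)) x := fun p x hx =>
    (contMDiffAt_iff_contDiffAt_comp_symm (n := ⊤) p hx _).1 (hu _)
  have hXs : ∀ p, ∀ x ∈ (extChartAt (𝓡 2) p).target, ContDiffAt ℝ ∞ (coordField (𝓡 2) p X) x :=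
    fun p x hx => (smoothFieldAt_iff p hx X).1 (hX.1 _)
  have hcoord : ∀ p q, ∀ x ∈ (extChartAt (𝓡 2) p).target, ∀ y,
      coordField ((𝓡 2).prod (𝓡 m)) (p, q) V (x, y) =
        (Y ((extChartAt (𝓡 m) q).symm y) • coordField (𝓡 2) p X x,
          u ((extChartAt (𝓡 2) p).symm x) • coordField (𝓡 m) q Z y) := by
    intro p q x hx y
    rw [coordField_prod hx (mem_sphere_target q y)]
    exact Prod.ext (map_smul (coframe (𝓡 2) p _) _ _) (map_smul (coframe (𝓡 m) q _) _ _)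
  have hev : ∀ p q, ∀ x ∈ (extChartAt (𝓡 2) p).target, ∀ y,
      coordField ((𝓡 2).prod (𝓡 m)) (p, q) V =ᶠ[nhds (x, y)] fun e =>
        (Y ((extChartAt (𝓡 m) q).symm e.2) • coordField (𝓡 2) p X e.1,
          u ((extChartAt (𝓡 2) p).symm e.1) • coordField (𝓡 m) q Z e.2) := by
    intro p q x hx y
    filter_upwards [(isOpen_extChartAt_target (I := (𝓡 2).prod (𝓡 m)) (p, q)).mem_nhds
      (mem_extChartAt_prod_target.2 ⟨hx, mem_sphere_target q y⟩)]
    rintro ⟨x', y'⟩ he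
    exact hcoord p q x' (mem_extChartAt_prod_target.1 he).1 y'
  refine isKilling_of_coordKilling (isSmoothMetric_spherical hs hf) ?_ ?_
  · rintro ⟨p, q⟩
    rw [smoothFieldAt_iff_self]
    have hx := mem_extChartAt_target (I := 𝓡 2) p
    refine ContDiffAt.congr_of_eventuallyEq ?_ (hev p q _ hx (extChartAt (𝓡 m) q q))
    exact (((hYs q).contDiffAt.comp (g := fun y => Y ((extChartAt (𝓡 m) q).symm y))
        (extChartAt (𝓡 2) p p, extChartAt (𝓡 m) q q) contDiffAt_snd).smul
        (ContDiffAt.comp (g := coordField (𝓡 2) p X) (f := Prod.fst)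
          (extChartAt (𝓡 2) p p, extChartAt (𝓡 m) q q) (hXs p _ hx) contDiffAt_fst)).prodMk
      ((ContDiffAt.comp (g := fun x => u ((extChartAt (𝓡 2) p).symm x)) (f := Prod.fst)
          (extChartAt (𝓡 2) p p, extChartAt (𝓡 m) q q) (hus p _ hx) contDiffAt_fst).smul
        ((hZ q).contDiffAt.comp (g := coordField (𝓡 m) q Z)
          (extChartAt (𝓡 2) p p, extChartAt (𝓡 m) q q) contDiffAt_snd))
  · rintro ⟨p, q⟩
    have hx := mem_extChartAt_target (I := 𝓡 2) p
    set x := extChartAt (𝓡 2) p p with hxd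
    set y := extChartAt (𝓡 m) q q with hyd
    change CoordKilling (p, q) _ V (x, y)
    refine (coordKilling_warped_iff hs hf (isSmoothMetric_roundMetric m) hx
      (mem_sphere_target q y) V).2 ?_
    rintro ⟨a, b⟩ ⟨a', b'⟩
    have d1 : HasFDerivAt (fun e : EuclideanSpace ℝ (Fin 2) × EuclideanSpace ℝ (Fin m) =>
        Y ((extChartAt (𝓡 m) q).symm e.2)) _ (x, y) :=
      HasFDerivAt.comp (g := fun y => Y ((extChartAt (𝓡 m) q).symm y)) (f := Prod.snd) (x, y)
        ((hYs q).differentiable (by simp) y).hasFDerivAt hasFDerivAt_snd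
    have d2 : HasFDerivAt (fun e : EuclideanSpace ℝ (Fin 2) × EuclideanSpace ℝ (Fin m) =>
        coordField (𝓡 2) p X e.1) _ (x, y) :=
      HasFDerivAt.comp (g := coordField (𝓡 2) p X) (f := Prod.fst) (x, y)
        ((hXs p x hx).differentiableAt (by simp)).hasFDerivAt hasFDerivAt_fst
    have d3 : HasFDerivAt (fun e : EuclideanSpace ℝ (Fin 2) × EuclideanSpace ℝ (Fin m) =>
        u ((extChartAt (𝓡 2) p).symm e.1)) _ (x, y) :=
      HasFDerivAt.comp (g := fun x => u ((extChartAt (𝓡 2) p).symm x)) (f := Prod.fst) (x, y)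
        ((hus p x hx).differentiableAt (by simp)).hasFDerivAt hasFDerivAt_fst
    have d4 : HasFDerivAt (fun e : EuclideanSpace ℝ (Fin 2) × EuclideanSpace ℝ (Fin m) =>
        coordField (𝓡 m) q Z e.2) _ (x, y) :=
      HasFDerivAt.comp (g := coordField (𝓡 m) q Z) (f := Prod.snd) (x, y)
        ((hZ q).differentiable (by simp) y).hasFDerivAt hasFDerivAt_snd
    have d5 : HasFDerivAt (fun e : EuclideanSpace ℝ (Fin 2) × EuclideanSpace ℝ (Fin m) =>
        (Y ((extChartAt (𝓡 m) q).symm e.2) • coordField (𝓡 2) p X e.1,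
          u ((extChartAt (𝓡 2) p).symm e.1) • coordField (𝓡 m) q Z e.2)) _ (x, y) :=
      (d1.smul d2).prodMk (d3.smul d4)
    have hD : ∀ a b, fderiv ℝ (coordField ((𝓡 2).prod (𝓡 m)) (p, q) V) (x, y) (a, b) =
        (Y ((extChartAt (𝓡 m) q).symm y) • fderiv ℝ (coordField (𝓡 2) p X) x a +
          fderiv ℝ (fun y => Y ((extChartAt (𝓡 m) q).symm y)) y b • coordField (𝓡 2) p X x,
        u ((extChartAt (𝓡 2) p).symm x) • fderiv ℝ (coordField (𝓡 m) q Z) y b +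
          fderiv ℝ (fun x => u ((extChartAt (𝓡 2) p).symm x)) x a • coordField (𝓡 m) q Z y) := by
      intro a b
      rw [(hev p q x hx y).fderiv_eq, d5.fderiv]
      rfl
    have k1 := hX.coordKilling hs p hx a a'
    have k2 := hlam q y b b'
    have k3 := h1 ((extChartAt (𝓡 2) p).symm x) ((extChartAt (𝓡 m) q).symm y)
    rw [dirDeriv_eq_fderiv p hx f ((hf _).mdifferentiableAt (by simp))] at k3
    have k4 : ∀ a b, fderiv ℝ (fun y => Y ((extChartAt (𝓡 m) q).symm y)) y b *
        coordMetric (𝓡 2) p h x (coordField (𝓡 2) p X x) a +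
        f ((extChartAt (𝓡 2) p).symm x) ^ 2 *
          fderiv ℝ (fun x => u ((extChartAt (𝓡 2) p).symm x)) x a *
          coordMetric (𝓡 m) q (roundMetric m) y (coordField (𝓡 m) q Z y) b = 0 := by
      intro a b
      rw [← mvfderiv_apply_eq_fderiv q (mem_sphere_target q y) _
        ((hY _).mdifferentiableAt (by simp)), ← mvfderiv_apply_eq_fderiv p hx _
        ((hu _).mdifferentiableAt (by simp)), coordMetric_apply, coordMetric_apply,
        frame_coordField p hx, frame_coordField q (mem_sphere_target q y)]
      exact h2 _ _ _ _
    have s1 : ∀ a b, coordMetric (𝓡 m) q (roundMetric m) y a b =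
        coordMetric (𝓡 m) q (roundMetric m) y b a := by
      intro a b
      rw [coordMetric_roundMetric, coordMetric_roundMetric, real_inner_comm]
    have s2 : ∀ a b, coordMetric (𝓡 2) p h x a b = coordMetric (𝓡 2) p h x b a := by
      intro a b
      rw [coordMetric_apply, coordMetric_apply, hh.symm]
    rw [hD, hD, hcoord p q x hx y]
    simp only [map_add, map_smul, _root_.add_apply, _root_.smul_apply, smul_eq_mul]
    rw [s1 b (coordField (𝓡 m) q Z y), s2 a (coordField (𝓡 2) p X x)]
    linear_combination (Y ((extChartAt (𝓡 m) q).symm y)) * k1 +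
      f ((extChartAt (𝓡 2) p).symm x) ^ 2 * u ((extChartAt (𝓡 2) p).symm x) * k2 +
      2 * f ((extChartAt (𝓡 2) p).symm x) * coordMetric (𝓡 m) q (roundMetric m) y b b' * k3 +
      k4 a' b + k4 a b'

theorem contDiff_coordField_sphZeta (q : Sph m) (i j : Fin (m + 1)) :
    ContDiff ℝ ∞ (coordField (𝓡 m) q (sphZeta m i j)) := by
  rw [show coordField (𝓡 m) q (sphZeta m i j) = _ from funext (coordField_sphZeta q i j)]
  exact ((contDiff_sphY_symm q i).smul (contDiff_coordField_sphZ q j)).sub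
    ((contDiff_sphY_symm q j).smul (contDiff_coordField_sphZ q i))

theorem isKilling_zetaField (hh : IsLorentzian (𝓡 2) h) (hf : ContMDiff (𝓡 2) 𝓘(ℝ, ℝ) ∞ f)
    (i j : Fin (m + 1)) :
    IsKilling ((𝓡 2).prod (𝓡 m)) (spherical m h f) (zetaField N m i j) := by
  have h1 := isKilling_prodField (m := m) hh hf (X := 0) (zero_mem (killingAlgebra (𝓡 2) h)) (Y := 0)
    contMDiff_const (u := 1) contMDiff_const (Z := sphZeta m i j)
    (fun q => contDiff_coordField_sphZeta q i j) (lam := 0)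
    (fun q y => conformalAt_sphZeta q i j y) (fun p q => by simp)
    (fun p q a b => by
      have : mvfderiv (𝓡 2) (1 : N → ℝ) p = 0 := mvfderiv_const (1 : ℝ)
      rw [this, mvfderiv_zero]
      simp)
  convert h1 using 1
  funext x
  exact Prod.ext (smul_zero (A := TangentSpace (𝓡 2) x.1) ((0 : Sph m → ℝ) x.2)).symm
    (one_smul ℝ (sphZeta m i j x.2)).symm

/-- `h(X, ·) = -f² d(X(ln f))` when `W_X = 0`. -/
theorem metric_eq_of_wField_eq_zero (hh : IsLorentzian (𝓡 2) h) {X : VField (𝓡 2) N}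
    (hW : wField (𝓡 2) h f X = 0) (p : N) (w : TangentSpace (𝓡 2) p) :
    h p (X p) w = -(f p ^ 2 * mvfderiv (𝓡 2) (dirDeriv (𝓡 2) X (fun y => Real.log (f y))) p w) := by
  have h1 := wField_apply hh.nondegenerate f X p w
  rw [hW] at h1
  have h2 : h p ((0 : VField (𝓡 2) N) p) w = 0 := by simp
  linarith

/-- The mixed block of the Killing equation holds because `W_X = 0`. In the spherical block, the
change of `f` along `Y^i X` and the conformal factor of `Z^i` cancel. -/
theorem isKilling_xiField (hh : IsLorentzian (𝓡 2) h) (hf : ContMDiff (𝓡 2) 𝓘(ℝ, ℝ) ∞ f)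
    (hf_pos : ∀ p, 0 < f p) {X : VField (𝓡 2) N} (hX : IsKilling (𝓡 2) h X)
    (hW : wField (𝓡 2) h f X = 0) (i : Fin (m + 1)) :
    IsKilling ((𝓡 2).prod (𝓡 m)) (spherical m h f) (xiField m f X i) := by
  have h1 := isKilling_prodField (m := m) hh hf hX (contMDiff_sphY i)
    (contMDiff_dirDeriv hX.1 (contMDiff_log hf hf_pos))
    (Z := sphZ m i) (fun q => contDiff_coordField_sphZ q i) (lam := fun q => -sphY m i q)
    (fun q y => conformalAt_sphZ q i y) (fun p q => by
      have := (hf_pos p).ne'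
      rw [dirDeriv_log_eq_div hf hf_pos]
      field_simp
      ring)
    (fun p q a b => by
      rw [metric_eq_of_wField_eq_zero hh hW, mvfderiv_sphY, roundMetric_sphZ]
      ring)
  convert h1 using 1
  unfold xiField
  simp only [dirDeriv_log_eq_div hf hf_pos]

/-- The tangent vectors of the sphere at `q` are the vectors orthogonal to `q`. -/
theorem exists_sphIncl_eq (q : Sph m) {w : EuclideanSpace ℝ (Fin (m + 1))}
    (hw : ⟪(q : EuclideanSpace ℝ (Fin (m + 1))), w⟫_ℝ = 0) : ∃ v, sphIncl q v = w := by
  have := Fact.mk (@finrank_euclideanSpace_fin ℝ _ (m + 1))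
  have h1 : w ∈ (ℝ ∙ (q : EuclideanSpace ℝ (Fin (m + 1))))ᗮ := by
    rwa [Submodule.mem_orthogonal_singleton_iff_inner_right]
  rw [← range_mvfderiv_subtypeVal (n := m)] at h1
  exact h1

omit [IsManifold (𝓡 2) ∞ N] in
/-- At the point `e_k` of the sphere, only `ξ^k` among the `ξ^i` has a component tangent to the base
if `X` does not vanish. Once the coefficients of the `ξ^i` are known to vanish, the spherical product
with the tangent vector `e_l` at `e_k` isolates `ζ^{kl}`. -/
theorem linearIndependent_xiZeta {X : VField (𝓡 2) N} (hX : X ≠ 0) (f : N → ℝ) :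
    LinearIndependent ℝ (xiZeta m f X) := by
  rw [Fintype.linearIndependent_iff]
  intro g hg
  obtain ⟨p, hp⟩ := Function.ne_iff.1 hX
  rw [Fintype.sum_sum_type] at hg
  -- the components tangent to the base at `(p, e_k)`, where `Y^i = δ_{ik}`
  have hxi : ∀ i, g (Sum.inl i) = 0 := by
    intro k
    let b : Sph m := ⟨EuclideanSpace.single k 1, by simp⟩
    let T : VField ((𝓡 2).prod (𝓡 m)) (N × Sph m) →ₗ[ℝ] EuclideanSpace ℝ (Fin 2) :=
      { toFun := fun V => (V (p, b)).1
        map_add' := fun _ _ => rfl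
        map_smul' := fun _ _ => rfl }
    have h1 := congrArg T hg
    obtain ⟨z, hz⟩ : ∃ z : EuclideanSpace ℝ (Fin 2), X p = z := ⟨_, rfl⟩
    have hz0 : z ≠ 0 := fun h0 => hp (hz.trans h0)
    have h2 : ∀ i, T (xiZeta m f X (Sum.inl i)) = (if i = k then (1 : ℝ) else 0) • z := by
      intro i
      change sphY m i b • (X p : EuclideanSpace ℝ (Fin 2)) = _
      rw [hz]
      congr 1
      change (EuclideanSpace.single k (1 : ℝ)) i = _
      simp
    have h3 : ∀ s, T (xiZeta m f X (Sum.inr s)) = 0 := fun _ => rfl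
    rw [map_add, map_sum, map_sum, map_zero] at h1
    simp only [map_smul, h2, h3, smul_zero, Finset.sum_const_zero, add_zero, ite_smul, one_smul,
      zero_smul, smul_ite, Finset.sum_ite_eq', Finset.mem_univ, if_true] at h1
    exact (smul_eq_zero.1 h1).resolve_right hz0
  -- the components tangent to the sphere at `(p, e_k)`, paired with `e_l`
  have hzeta : ∀ s : {p : Fin (m + 1) × Fin (m + 1) // p.1 < p.2}, g (Sum.inr s) = 0 := by
    rintro ⟨⟨k, l⟩, hkl⟩
    let b : Sph m := ⟨EuclideanSpace.single k 1, by simp⟩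
    obtain ⟨v, hv⟩ := exists_sphIncl_eq b (w := EuclideanSpace.single l 1) (by
      change ⟪(EuclideanSpace.single k (1 : ℝ)), EuclideanSpace.single l (1 : ℝ)⟫_ℝ = 0
      have : l ≠ k := (ne_of_lt hkl).symm
      simp [EuclideanSpace.inner_single_left, this.symm])
    let T : VField ((𝓡 2).prod (𝓡 m)) (N × Sph m) →ₗ[ℝ] ℝ :=
      { toFun := fun V => roundMetric m b (V (p, b)).2 v
        map_add' := fun V W => DFunLike.congr_fun (map_add (roundMetric m b) _ _) v
        map_smul' := fun c V => DFunLike.congr_fun (map_smul (roundMetric m b) c _) v }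
    have h1 := congrArg T hg
    have h2 : ∀ s : {p : Fin (m + 1) × Fin (m + 1) // p.1 < p.2}, T (xiZeta m f X (Sum.inr s)) =
        if s = ⟨(k, l), hkl⟩ then 1 else 0 := by
      rintro ⟨⟨i, j⟩, hij⟩
      have e1 : T (xiZeta m f X (Sum.inr ⟨(i, j), hij⟩)) =
          sphY m i b * sphIncl b v j - sphY m j b * sphIncl b v i := by
        rw [← roundMetric_sphZ, ← roundMetric_sphZ]
        change roundMetric m b (sphY m i b • sphZ m j b - sphY m j b • sphZ m i b) v = _
        simp
      have e2 : ∀ i, sphY m i b = if i = k then 1 else 0 := by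
        intro i
        change (EuclideanSpace.single k (1 : ℝ)) i = _
        simp
      rw [e1, hv, e2, e2]
      simp only [PiLp.single_apply, Subtype.mk.injEq, Prod.mk.injEq]
      change i < j at hij
      change k < l at hkl
      by_cases h1 : i = k <;> by_cases h2 : j = l <;> by_cases h3 : j = k <;> by_cases h4 : i = l <;>
        simp [h1, h2, h3, h4] <;> omega
    rw [map_add, map_sum, map_sum, map_zero] at h1
    simp only [hxi, zero_smul, map_zero, Finset.sum_const_zero, zero_add, map_smul, h2, smul_eq_mul,
      mul_ite, mul_one, mul_zero, Finset.sum_ite_eq', Finset.mem_univ, if_true] at h1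
    exact h1
  rintro (i | s)
  · exact hxi i
  · exact hzeta s

end ProductFields

/-! ### The FLRW form of the base metric -/

section Radius

/-- A radius `χ` as a function of a real variable `v`, with `S_k(χ) = 1 / √(k + v²)` and
`χ' = ± 1 / (k + v²)`. For `k > 0` it is the inverse function of `√k cot(√k χ)`, so that all real
`v` are allowed; for `k ≤ 0` it is determined by `S_k(χ)`, on `v² > -k`. -/
theorem exists_radius (k : ℝ) : ∃ χ : ℝ → ℝ, ∀ v, 0 < k + v ^ 2 → ContDiffAt ℝ ∞ χ v ∧ 0 < χ v ∧
    (0 < k → χ v < Real.pi / √k) ∧ Sk k (χ v) = (√(k + v ^ 2))⁻¹ ∧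
    deriv χ v ^ 2 * (k + v ^ 2) ^ 2 = 1 := by
  have hr : ∀ v, 0 < k + v ^ 2 → HasDerivAt (fun v => (√(k + v ^ 2))⁻¹)
      (-(v / √(k + v ^ 2)) / √(k + v ^ 2) ^ 2) v := by
    intro v hv
    have h1 : HasDerivAt (fun v : ℝ => k + v ^ 2) (2 * v) v := by
      simpa using (hasDerivAt_pow 2 v).const_add k
    have h2 := (h1.sqrt hv.ne').fun_inv (Real.sqrt_pos.2 hv).ne'
    rwa [mul_div_mul_left _ _ two_ne_zero] at h2
  have hrs : ∀ v, 0 < k + v ^ 2 → ContDiffAt ℝ ∞ (fun v => (√(k + v ^ 2))⁻¹) v := fun v hv =>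
    ((contDiffAt_const.add (contDiffAt_id.pow 2)).sqrt hv.ne').inv (Real.sqrt_pos.2 hv).ne'
  rcases lt_trichotomy k 0 with hk | rfl | hk
  · have hκ : 0 < √(-k) := Real.sqrt_pos.2 (by linarith)
    have hκ2 : √(-k) ^ 2 = -k := Real.sq_sqrt (by linarith)
    refine ⟨fun v => Real.arsinh (√(-k) * (√(k + v ^ 2))⁻¹) / √(-k), fun v hv => ?_⟩
    have hs := Real.sqrt_pos.2 hv
    have hs2 := Real.sq_sqrt hv.le
    refine ⟨?_, ?_, fun h => absurd h hk.not_gt, ?_, ?_⟩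
    · exact ((Real.contDiff_arsinh.contDiffAt).comp v (contDiffAt_const.mul (hrs v hv))).div_const _
    · exact div_pos (Real.arsinh_pos_iff.2 (by positivity)) hκ
    · rw [Sk, if_neg hk.not_gt, if_neg hk.ne, mul_div_cancel₀ _ hκ.ne', Real.sinh_arsinh]
      field_simp
    · have h1 : HasDerivAt (fun v => Real.arsinh (√(-k) * (√(k + v ^ 2))⁻¹) / √(-k)) _ v :=
        ((Real.hasDerivAt_arsinh _).comp v ((hr v hv).const_mul (√(-k)))).div_const (√(-k))
      rw [h1.deriv]
      have h3 : 0 < 1 + (√(-k) * (√(k + v ^ 2))⁻¹) ^ 2 := by positivity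
      have h2 : 1 + (√(-k) * (√(k + v ^ 2))⁻¹) ^ 2 = v ^ 2 / (k + v ^ 2) := by
        rw [mul_pow, hκ2, inv_pow, hs2]
        field_simp
        ring
      rw [h2] at h3 ⊢
      have hv0 : v ≠ 0 := by rintro rfl; simp at h3
      have h4 := Real.sq_sqrt h3.le
      rw [div_pow, mul_pow, inv_pow, h4, hs2]
      field_simp
      rw [hs2]
  · refine ⟨fun v => (√(0 + v ^ 2))⁻¹, fun v hv => ?_⟩
    have hs := Real.sqrt_pos.2 hv
    have hs2 := Real.sq_sqrt hv.le
    refine ⟨hrs v hv, inv_pos.2 hs, fun h => absurd h (lt_irrefl _), ?_, ?_⟩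
    · rw [Sk, if_neg (lt_irrefl _), if_pos rfl]
    · rw [(hr v hv).deriv, hs2, div_pow, neg_pow, div_pow, hs2]
      have : v ^ 2 ≠ 0 := by rw [zero_add] at hv; exact hv.ne'
      have hv0 : v ≠ 0 := by rintro rfl; simp at this
      simp only [zero_add]
      field_simp
  · have hκ : 0 < √k := Real.sqrt_pos.2 hk
    have hκ2 : √k ^ 2 = k := Real.sq_sqrt hk.le
    refine ⟨fun v => (Real.pi / 2 - Real.arctan (v / √k)) / √k, fun v hv => ?_⟩
    have hs := Real.sqrt_pos.2 hv
    have hs2 := Real.sq_sqrt hv.le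
    refine ⟨?_, ?_, fun _ => ?_, ?_, ?_⟩
    · exact (contDiffAt_const.sub (Real.contDiff_arctan.contDiffAt.comp v
        (contDiffAt_id.div_const _))).div_const _
    · exact div_pos (by linarith [Real.arctan_lt_pi_div_two (v / √k)]) hκ
    · refine div_lt_div_of_pos_right ?_ hκ
      linarith [Real.neg_pi_div_two_lt_arctan (v / √k)]
    · rw [Sk, if_pos hk, mul_div_cancel₀ _ hκ.ne', Real.sin_pi_div_two_sub, Real.cos_arctan]
      have h1 : k + v ^ 2 = k * (1 + (v / √k) ^ 2) := by
        rw [div_pow, hκ2]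
        field_simp
      rw [h1, Real.sqrt_mul hk.le]
      field_simp
    · have h1 : HasDerivAt (fun v => (Real.pi / 2 - Real.arctan (v / √k)) / √k) _ v :=
        (((Real.hasDerivAt_arctan (v / √k)).comp v ((hasDerivAt_id v).div_const (√k))).const_sub
          (Real.pi / 2)).div_const (√k)
      rw [h1.deriv, div_pow v, hκ2, div_pow, hκ2]
      field_simp
      rw [hκ2]

end Radius

section Plane

/-- Coordinate data of a Killing field `X` with `W_X = 0` on an open convex set where it is
spacelike: `H`, `φ` and `u` are the coordinate expressions of the metric, of the warping function
and of `X(f)/f`. -/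
structure IsSpacelikeData (s : Set (EuclideanSpace ℝ (Fin 2)))
    (H : EuclideanSpace ℝ (Fin 2) →
      EuclideanSpace ℝ (Fin 2) →L[ℝ] EuclideanSpace ℝ (Fin 2) →L[ℝ] ℝ)
    (X : EuclideanSpace ℝ (Fin 2) → EuclideanSpace ℝ (Fin 2))
    (φ u : EuclideanSpace ℝ (Fin 2) → ℝ) : Prop where
  isOpen : IsOpen s
  convex : Convex ℝ s
  contDiffAt_H : ∀ x ∈ s, ContDiffAt ℝ ∞ H x
  contDiffAt_X : ∀ x ∈ s, ContDiffAt ℝ ∞ X x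
  contDiffAt_φ : ∀ x ∈ s, ContDiffAt ℝ ∞ φ x
  contDiffAt_u : ∀ x ∈ s, ContDiffAt ℝ ∞ u x
  symm : ∀ x ∈ s, ∀ a b, H x a b = H x b a
  pos : ∀ x ∈ s, 0 < φ x
  killing : ∀ x ∈ s, ∀ a b,
    fderiv ℝ H x (X x) a b + H x (fderiv ℝ X x a) b + H x a (fderiv ℝ X x b) = 0
  mul_eq : ∀ x ∈ s, u x * φ x = fderiv ℝ φ x (X x)
  dual : ∀ x ∈ s, ∀ a, H x (X x) a = -(φ x ^ 2 * fderiv ℝ u x a)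
  spacelike : ∀ x ∈ s, 0 < H x (X x) (X x)
  timelike : ∀ x ∈ s, ∃ v, H x v v < 0

namespace IsSpacelikeData

variable {s : Set (EuclideanSpace ℝ (Fin 2))}
  {H : EuclideanSpace ℝ (Fin 2) →
      EuclideanSpace ℝ (Fin 2) →L[ℝ] EuclideanSpace ℝ (Fin 2) →L[ℝ] ℝ}
  {X : EuclideanSpace ℝ (Fin 2) → EuclideanSpace ℝ (Fin 2)}
  {φ u : EuclideanSpace ℝ (Fin 2) → ℝ} (d : IsSpacelikeData s H X φ u)
  {x : EuclideanSpace ℝ (Fin 2)}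

include d

theorem hasFDerivAt_normSq (hx : x ∈ s) : ∃ L : EuclideanSpace ℝ (Fin 2) →L[ℝ] ℝ,
    HasFDerivAt (fun x => H x (X x) (X x)) L x ∧
    ∀ b, L b = fderiv ℝ H x b (X x) (X x) + 2 * H x (X x) (fderiv ℝ X x b) := by
  have hH := ((d.contDiffAt_H x hx).differentiableAt (by simp)).hasFDerivAt
  have hX := ((d.contDiffAt_X x hx).differentiableAt (by simp)).hasFDerivAt
  refine ⟨_, (hH.clm_apply hX).clm_apply hX, fun b => ?_⟩
  have := d.symm x hx (fderiv ℝ X x b) (X x)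
  simp
  linarith

/-- The norm of a Killing field is constant along the field. -/
theorem fderiv_normSq_self (hx : x ∈ s) : fderiv ℝ (fun x => H x (X x) (X x)) x (X x) = 0 := by
  obtain ⟨L, hL, h⟩ := d.hasFDerivAt_normSq hx
  rw [hL.fderiv, h, ← d.killing x hx (X x) (X x), d.symm x hx (fderiv ℝ X x (X x)) (X x)]
  ring

/-- The formula `d(h(X, X)) = -ι_X d(h(X, ·))` for a Killing field `X`, in the case
`h(X, ·) = -φ² du`. -/
theorem fderiv_normSq (hx : x ∈ s) (b : EuclideanSpace ℝ (Fin 2)) :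
    fderiv ℝ (fun x => H x (X x) (X x)) x b =
      2 * φ x * (fderiv ℝ φ x (X x) * fderiv ℝ u x b - fderiv ℝ φ x b * fderiv ℝ u x (X x)) := by
  obtain ⟨L, hL, h⟩ := d.hasFDerivAt_normSq hx
  have hH := ((d.contDiffAt_H x hx).differentiableAt (by simp)).hasFDerivAt
  have hX := ((d.contDiffAt_X x hx).differentiableAt (by simp)).hasFDerivAt
  have hφ := ((d.contDiffAt_φ x hx).differentiableAt (by simp)).hasFDerivAt
  have hu := (((d.contDiffAt_u x hx).fderiv_right (m := ∞) (by simp)).differentiableAt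
    (by simp)).hasFDerivAt
  have hdual : ∀ a b, fderiv ℝ H x b (X x) a + H x (fderiv ℝ X x b) a =
      -(2 * φ x * fderiv ℝ φ x b * fderiv ℝ u x a + φ x ^ 2 * fderiv ℝ (fderiv ℝ u) x b a) := by
    intro a b
    have h1 : HasFDerivAt (fun x => H x (X x) a) _ x :=
      (hH.clm_apply hX).clm_apply (hasFDerivAt_const a x)
    have h2 : HasFDerivAt (fun x => -(φ x ^ 2 * fderiv ℝ u x a)) _ x :=
      ((hφ.pow 2).mul (hu.clm_apply (hasFDerivAt_const a x))).neg
    have h3 : (fun x => H x (X x) a) =ᶠ[nhds x] fun x => -(φ x ^ 2 * fderiv ℝ u x a) := by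
      filter_upwards [d.isOpen.mem_nhds hx] with x' hx'
      exact d.dual x' hx' a
    have h4 := DFunLike.congr_fun (h1.unique (h2.congr_of_eventuallyEq h3)) b
    simp at h4
    linarith
  have hsym : fderiv ℝ (fderiv ℝ u) x (X x) b = fderiv ℝ (fderiv ℝ u) x b (X x) :=
    ((d.contDiffAt_u x hx).isSymmSndFDerivAt (by
      rw [minSmoothness_of_isRCLikeNormedField]; norm_cast)) _ _
  have h1 := hdual (X x) b
  have h2 := hdual b (X x)
  have h3 := d.killing x hx (X x) b
  have h4 := d.symm x hx (fderiv ℝ X x b) (X x)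
  rw [hL.fderiv, h]
  rw [hsym] at h2
  linear_combination h1 + h3 - h2 - h4

/-- The function `h(X, X) / φ² - u²` is constant. The constant is the curvature `k` of the spatial
slices. -/
theorem exists_curvature {x₀ : EuclideanSpace ℝ (Fin 2)} (hx₀ : x₀ ∈ s) :
    ∃ k, ∀ x ∈ s, H x (X x) (X x) = φ x ^ 2 * (k + u x ^ 2) := by
  have hd : ∀ x ∈ s, HasFDerivAt (fun x => H x (X x) (X x) * (φ x ^ 2)⁻¹ - u x ^ 2)
      (0 : EuclideanSpace ℝ (Fin 2) →L[ℝ] ℝ) x := by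
    intro x hx
    obtain ⟨L, hL, -⟩ := d.hasFDerivAt_normSq hx
    have hφ := ((d.contDiffAt_φ x hx).differentiableAt (by simp)).hasFDerivAt
    have hu := ((d.contDiffAt_u x hx).differentiableAt (by simp)).hasFDerivAt
    have hp := d.pos x hx
    have h1 := (hL.mul (((hasDerivAt_inv (pow_pos hp 2).ne').comp_hasFDerivAt x (hφ.pow 2)))).sub
      (hu.pow 2)
    refine h1.congr_fderiv ?_
    ext b
    have h2 := d.fderiv_normSq hx b
    rw [hL.fderiv] at h2
    have h3 := d.dual x hx (X x)
    have h4 := d.mul_eq x hx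
    have h5 : fderiv ℝ u x (X x) = -(H x (X x) (X x)) / φ x ^ 2 := by
      rw [h3]; field_simp
    rw [← h4, h5] at h2
    simp [h2]
    field_simp
    ring
  refine ⟨H x₀ (X x₀) (X x₀) * (φ x₀ ^ 2)⁻¹ - u x₀ ^ 2, fun x hx => ?_⟩
  have h1 := d.convex.is_const_of_fderivWithin_eq_zero (𝕜 := ℝ)
    (fun x hx => (hd x hx).differentiableAt.differentiableWithinAt)
    (fun x hx => by
      rw [fderivWithin_of_isOpen d.isOpen hx, (hd x hx).fderiv]) hx₀ hx
  have hp := d.pos x hx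
  rw [h1]
  field_simp
  ring

end IsSpacelikeData

end Plane

/-! ### Cosmological time -/

section Plane

theorem plane_decomp (v : EuclideanSpace ℝ (Fin 2)) :
    v = v 0 • EuclideanSpace.single 0 (1 : ℝ) + v 1 • EuclideanSpace.single 1 (1 : ℝ) := by
  ext i
  fin_cases i <;> simp

theorem linear_plane (L : EuclideanSpace ℝ (Fin 2) →L[ℝ] ℝ) (v : EuclideanSpace ℝ (Fin 2)) :
    L v = v 0 * L (EuclideanSpace.single 0 (1 : ℝ)) + v 1 * L (EuclideanSpace.single 1 (1 : ℝ)) := by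
  conv_lhs => rw [plane_decomp v, map_add, map_smul, map_smul, smul_eq_mul, smul_eq_mul]

theorem bilinear_plane (B : EuclideanSpace ℝ (Fin 2) →L[ℝ] EuclideanSpace ℝ (Fin 2) →L[ℝ] ℝ)
    (a b : EuclideanSpace ℝ (Fin 2)) :
    B a b = a 0 * b 0 * B (EuclideanSpace.single 0 (1 : ℝ)) (EuclideanSpace.single 0 (1 : ℝ)) +
      a 0 * b 1 * B (EuclideanSpace.single 0 (1 : ℝ)) (EuclideanSpace.single 1 (1 : ℝ)) +
      a 1 * b 0 * B (EuclideanSpace.single 1 (1 : ℝ)) (EuclideanSpace.single 0 (1 : ℝ)) +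
      a 1 * b 1 * B (EuclideanSpace.single 1 (1 : ℝ)) (EuclideanSpace.single 1 (1 : ℝ)) := by
  have h1 : ∀ a, B a b = (B.flip b) a := fun _ => rfl
  rw [h1, linear_plane (B.flip b) a, ← h1, ← h1, linear_plane (B _) b, linear_plane (B _) b]
  ring

/-- Minus the determinant of a symmetric bilinear form on the plane, which is positive for a
Lorentzian form. -/
def negDet (B : EuclideanSpace ℝ (Fin 2) →L[ℝ] EuclideanSpace ℝ (Fin 2) →L[ℝ] ℝ) : ℝ :=
  B (EuclideanSpace.single 0 (1 : ℝ)) (EuclideanSpace.single 1 (1 : ℝ)) ^ 2 -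
    B (EuclideanSpace.single 0 (1 : ℝ)) (EuclideanSpace.single 0 (1 : ℝ)) *
      B (EuclideanSpace.single 1 (1 : ℝ)) (EuclideanSpace.single 1 (1 : ℝ))

/-- The area form of the plane, contracted with `X`. -/
def areaForm (X : EuclideanSpace ℝ (Fin 2)) : EuclideanSpace ℝ (Fin 2) →L[ℝ] ℝ :=
  X 0 • EuclideanSpace.proj (𝕜 := ℝ) 1 - X 1 • EuclideanSpace.proj (𝕜 := ℝ) 0

theorem areaForm_apply (X a : EuclideanSpace ℝ (Fin 2)) :
    areaForm X a = X 0 * a 1 - X 1 * a 0 := by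
  simp [areaForm]

/-- The Gram determinant of `X, a` and `X, b` for a symmetric bilinear form of the plane. Divided by
`B X X`, it displays `B` as a combination of the squares of `B X` and of `areaForm X`. -/
theorem gram_plane (B : EuclideanSpace ℝ (Fin 2) →L[ℝ] EuclideanSpace ℝ (Fin 2) →L[ℝ] ℝ)
    (hB : ∀ a b, B a b = B b a) (X a b : EuclideanSpace ℝ (Fin 2)) :
    B X a * B X b - B X X * B a b = negDet B * (areaForm X a * areaForm X b) := by
  rw [areaForm_apply, areaForm_apply, negDet, bilinear_plane B X a, bilinear_plane B X b,
    bilinear_plane B X X, bilinear_plane B a b,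
    hB (EuclideanSpace.single 1 1) (EuclideanSpace.single 0 1)]
  ring

namespace IsSpacelikeData

variable {s : Set (EuclideanSpace ℝ (Fin 2))}
  {H : EuclideanSpace ℝ (Fin 2) →
      EuclideanSpace ℝ (Fin 2) →L[ℝ] EuclideanSpace ℝ (Fin 2) →L[ℝ] ℝ}
  {X : EuclideanSpace ℝ (Fin 2) → EuclideanSpace ℝ (Fin 2)}
  {φ u : EuclideanSpace ℝ (Fin 2) → ℝ} (d : IsSpacelikeData s H X φ u)
  {x : EuclideanSpace ℝ (Fin 2)}

include d

theorem negDet_pos (hx : x ∈ s) : 0 < negDet (H x) := by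
  obtain ⟨v, hv⟩ := d.timelike x hx
  have h1 := gram_plane (H x) (d.symm x hx) (X x) v v
  have h2 := d.spacelike x hx
  have h3 : 0 < negDet (H x) * (areaForm (X x) v * areaForm (X x) v) := by
    rw [← h1]
    nlinarith [mul_pos h2 (neg_pos.2 hv), mul_self_nonneg (H x (X x) v)]
  exact pos_of_mul_pos_left h3 (mul_self_nonneg _)

/-- The area form is invariant: the derivative of `negDet` along `X` is given by the divergence. -/
theorem hasFDerivAt_negDet (hx : x ∈ s) : ∃ L : EuclideanSpace ℝ (Fin 2) →L[ℝ] ℝ,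
    HasFDerivAt (fun x => negDet (H x)) L x ∧
    L (X x) = -2 * (fderiv ℝ X x (EuclideanSpace.single 0 1) 0 +
      fderiv ℝ X x (EuclideanSpace.single 1 1) 1) * negDet (H x) := by
  have hH := ((d.contDiffAt_H x hx).differentiableAt (by simp)).hasFDerivAt
  have hc : ∀ a b, HasFDerivAt (fun x => H x a b) _ x := fun a b =>
    (hH.clm_apply (hasFDerivAt_const a x)).clm_apply (hasFDerivAt_const b x)
  refine ⟨_, ((hc (EuclideanSpace.single 0 1) (EuclideanSpace.single 1 1)).pow 2).sub
    ((hc (EuclideanSpace.single 0 1) (EuclideanSpace.single 0 1)).mul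
      (hc (EuclideanSpace.single 1 1) (EuclideanSpace.single 1 1))), ?_⟩
  have k := d.killing x hx
  have k00 := k (EuclideanSpace.single 0 1) (EuclideanSpace.single 0 1)
  have k01 := k (EuclideanSpace.single 0 1) (EuclideanSpace.single 1 1)
  have k11 := k (EuclideanSpace.single 1 1) (EuclideanSpace.single 1 1)
  have hs := d.symm x hx (EuclideanSpace.single 1 1) (EuclideanSpace.single 0 1)
  have l1 : ∀ a b, H x (fderiv ℝ X x a) b = fderiv ℝ X x a 0 * H x (EuclideanSpace.single 0 1) b +
      fderiv ℝ X x a 1 * H x (EuclideanSpace.single 1 1) b := fun a b =>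
    linear_plane ((H x).flip b) _
  have l2 : ∀ a b, H x b (fderiv ℝ X x a) = fderiv ℝ X x a 0 * H x b (EuclideanSpace.single 0 1) +
      fderiv ℝ X x a 1 * H x b (EuclideanSpace.single 1 1) := fun a b => linear_plane (H x b) _
  rw [l1, l2] at k00 k01 k11
  rw [hs] at k00 k11
  unfold negDet
  simp
  linear_combination 2 * H x (EuclideanSpace.single 0 1) (EuclideanSpace.single 1 1) * k01 -
    H x (EuclideanSpace.single 1 1) (EuclideanSpace.single 1 1) * k00 -
    H x (EuclideanSpace.single 0 1) (EuclideanSpace.single 0 1) * k11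

/-- The factor that makes `areaForm X` a unit one-form, and its derivative along `X`. -/
theorem hasFDerivAt_scale (hx : x ∈ s) : ∃ L : EuclideanSpace ℝ (Fin 2) →L[ℝ] ℝ,
    HasFDerivAt (fun x => √(negDet (H x) / H x (X x) (X x))) L x ∧
    L (X x) = -√(negDet (H x) / H x (X x) (X x)) * (fderiv ℝ X x (EuclideanSpace.single 0 1) 0 +
      fderiv ℝ X x (EuclideanSpace.single 1 1) 1) := by
  obtain ⟨L, hL, -⟩ := d.hasFDerivAt_normSq hx
  obtain ⟨K, hK, hKX⟩ := d.hasFDerivAt_negDet hx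
  have hLX := d.fderiv_normSq_self hx
  rw [hL.fderiv] at hLX
  have hρ := d.spacelike x hx
  have hD := d.negDet_pos hx
  have h0 : 0 < negDet (H x) / H x (X x) (X x) := div_pos hD hρ
  have h1 := hK.mul ((hasDerivAt_inv hρ.ne').comp_hasFDerivAt x hL)
  have h1' : HasFDerivAt (fun x => negDet (H x) / H x (X x) (X x)) _ x :=
    h1.congr_of_eventuallyEq (Filter.Eventually.of_forall fun _ => div_eq_mul_inv _ _)
  refine ⟨_, h1'.sqrt h0.ne', ?_⟩
  have h2 := Real.sqrt_pos.2 h0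
  have h3 := Real.sq_sqrt h0.le
  simp [hKX, hLX]
  set r := √(negDet (H x) / H x (X x) (X x))
  have h4 : negDet (H x) = r ^ 2 * H x (X x) (X x) := by
    rw [h3]; field_simp
  rw [h4]
  field_simp

theorem contDiffAt_scale (hx : x ∈ s) :
    ContDiffAt ℝ ∞ (fun x => √(negDet (H x) / H x (X x) (X x))) x := by
  have hH := d.contDiffAt_H x hx
  have hX := d.contDiffAt_X x hx
  have hc : ∀ a b, ContDiffAt ℝ ∞ (fun x => H x a b) x := fun a b =>
    (hH.clm_apply contDiffAt_const).clm_apply contDiffAt_const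
  have h1 : ContDiffAt ℝ ∞ (fun x => negDet (H x)) x :=
    ((hc _ _).pow 2).sub ((hc _ _).mul (hc _ _))
  have h0 : 0 < negDet (H x) / H x (X x) (X x) := div_pos (d.negDet_pos hx) (d.spacelike x hx)
  exact (h1.div ((hH.clm_apply hX).clm_apply hX) (d.spacelike x hx).ne').sqrt h0.ne'

/-- The unit one-form annihilating `X` is closed, since it is invariant under `X`. Its primitive is
the cosmological time. -/
theorem exists_time : ∃ t : EuclideanSpace ℝ (Fin 2) → ℝ, ∀ x ∈ s,
    HasFDerivAt t (√(negDet (H x) / H x (X x) (X x)) • areaForm (X x)) x := by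
  have hX : ∀ x ∈ s, HasFDerivAt X (fderiv ℝ X x) x := fun x hx =>
    ((d.contDiffAt_X x hx).differentiableAt (by simp)).hasFDerivAt
  have hXi : ∀ x ∈ s, ∀ i, HasFDerivAt (fun x => X x i) _ x := fun x hx i =>
    (EuclideanSpace.proj (𝕜 := ℝ) i : EuclideanSpace ℝ (Fin 2) →L[ℝ] ℝ).hasFDerivAt.comp x (hX x hx)
  have hA : ∀ x ∈ s, HasFDerivAt (fun x => areaForm (X x)) _ x := fun x hx =>
    ((hXi x hx 0).smul_const (EuclideanSpace.proj (𝕜 := ℝ) 1 : EuclideanSpace ℝ (Fin 2) →L[ℝ] ℝ)).sub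
      ((hXi x hx 1).smul_const (EuclideanSpace.proj (𝕜 := ℝ) 0 : EuclideanSpace ℝ (Fin 2) →L[ℝ] ℝ))
  refine d.convex.exists_forall_hasFDerivAt_of_fderiv_symmetric d.isOpen (fun x hx => ?_)
    fun x hx a b => ?_
  · obtain ⟨L, hL, -⟩ := d.hasFDerivAt_scale hx
    exact (hL.smul (hA x hx)).differentiableAt.differentiableWithinAt
  · obtain ⟨L, hL, hLX⟩ := d.hasFDerivAt_scale hx
    have h1 : HasFDerivAt (fun x => √(negDet (H x) / H x (X x) (X x)) • areaForm (X x)) _ x :=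
      hL.smul (hA x hx)
    have l1 := linear_plane L a
    have l2 := linear_plane L b
    have l3 := linear_plane L (X x)
    have l4 : ∀ i v, fderiv ℝ X x v i = v 0 * fderiv ℝ X x (EuclideanSpace.single 0 1) i +
        v 1 * fderiv ℝ X x (EuclideanSpace.single 1 1) i := fun i v =>
      linear_plane ((EuclideanSpace.proj (𝕜 := ℝ) i).comp (fderiv ℝ X x)) v
    rw [h1.fderiv]
    simp [areaForm_apply]
    rw [l1, l2, l4 0 a, l4 0 b, l4 1 a, l4 1 b]
    rw [l3] at hLX
    linear_combination (a 0 * b 1 - a 1 * b 0) * hLX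

end IsSpacelikeData

end Plane

/-! ### The chart given by time and radius -/

section Plane

/-- A vector annihilated by `areaForm X` is proportional to `X`. -/
theorem smul_eq_of_areaForm_eq_zero {X v : EuclideanSpace ℝ (Fin 2)} (h : areaForm X v = 0)
    (i : Fin 2) : X i • v = v i • X := by
  rw [areaForm_apply] at h
  ext j
  fin_cases i <;> fin_cases j <;> simp <;> linarith

namespace IsSpacelikeData

variable {s : Set (EuclideanSpace ℝ (Fin 2))}
  {H : EuclideanSpace ℝ (Fin 2) →
      EuclideanSpace ℝ (Fin 2) →L[ℝ] EuclideanSpace ℝ (Fin 2) →L[ℝ] ℝ}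
  {X : EuclideanSpace ℝ (Fin 2) → EuclideanSpace ℝ (Fin 2)}
  {φ u : EuclideanSpace ℝ (Fin 2) → ℝ} (d : IsSpacelikeData s H X φ u)
  {x : EuclideanSpace ℝ (Fin 2)}

include d

theorem X_ne_zero (hx : x ∈ s) : X x ≠ 0 := by
  intro h0
  have := d.spacelike x hx
  rw [h0, map_zero] at this
  exact lt_irrefl _ this

theorem eq_zero_of_areaForm (hx : x ∈ s) {v : EuclideanSpace ℝ (Fin 2)}
    (hv : areaForm (X x) v = 0) (hv' : H x (X x) v = 0) : v = 0 := by
  ext i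
  have h1 := congrArg (H x (X x)) (smul_eq_of_areaForm_eq_zero hv i)
  rw [map_smul, map_smul, hv', smul_zero, smul_eq_mul, eq_comm, mul_eq_zero] at h1
  exact h1.resolve_right (d.spacelike x hx).ne'

theorem fderiv_normSq_of_areaForm (hx : x ∈ s) {v : EuclideanSpace ℝ (Fin 2)}
    (hv : areaForm (X x) v = 0) : fderiv ℝ (fun x => H x (X x) (X x)) x v = 0 := by
  obtain ⟨i, hi⟩ : ∃ i, X x i ≠ 0 := by
    by_contra! h0
    exact d.X_ne_zero hx (by ext i; exact h0 i)
  have h1 := congrArg (fderiv ℝ (fun x => H x (X x) (X x)) x) (smul_eq_of_areaForm_eq_zero hv i)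
  rw [map_smul, map_smul, d.fderiv_normSq_self hx, smul_zero] at h1
  exact (smul_eq_zero.1 h1).resolve_left hi

/-- Near each point, `(t, χ(u))` is a chart in which the base metric is `-dt² + a(t)² dχ²`, with
`a² = H(X, X)`, and the warping function is `a(t) S_k(χ)`. -/
theorem exists_flrw_chart {x₀ : EuclideanSpace ℝ (Fin 2)} (hx₀ : x₀ ∈ s) :
    ∃ (J : Set ℝ) (a : ℝ → ℝ) (k : ℝ) (Φ : OpenPartialHomeomorph (EuclideanSpace ℝ (Fin 2)) (ℝ × ℝ)),
      IsOpen J ∧ J.OrdConnected ∧ ContDiffOn ℝ ∞ a J ∧ (∀ t ∈ J, 0 < a t) ∧ x₀ ∈ Φ.source ∧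
      Φ.source ⊆ s ∧ (∀ z ∈ Φ.target, z.1 ∈ J ∧ 0 < z.2 ∧ (0 < k → z.2 < Real.pi / √k)) ∧
      ContDiffOn ℝ ∞ Φ Φ.source ∧ ContDiffOn ℝ ∞ Φ.symm Φ.target ∧
      ∀ x ∈ Φ.source, (∀ v w, H x v w = -((fderiv ℝ Φ x v).1 * (fderiv ℝ Φ x w).1) +
        a (Φ x).1 ^ 2 * ((fderiv ℝ Φ x v).2 * (fderiv ℝ Φ x w).2)) ∧
        φ x = a (Φ x).1 * Sk k (Φ x).2 := by
  obtain ⟨k, hk⟩ := d.exists_curvature hx₀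
  obtain ⟨t, ht⟩ := d.exists_time
  obtain ⟨χ, hχ⟩ := exists_radius k
  have hku : ∀ x ∈ s, 0 < k + u x ^ 2 := by
    intro x hx
    have h1 := d.spacelike x hx
    rw [hk x hx] at h1
    exact pos_of_mul_pos_right h1 (sq_nonneg _)
  set ρ : EuclideanSpace ℝ (Fin 2) → ℝ := fun x => H x (X x) (X x) with hρ
  set F : EuclideanSpace ℝ (Fin 2) → ℝ × ℝ := fun x => (t x, χ (u x)) with hF
  have hFd : ∀ x ∈ s, HasFDerivAt F ((√(negDet (H x) / H x (X x) (X x)) • areaForm (X x)).prod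
      (deriv χ (u x) • fderiv ℝ u x)) x := by
    intro x hx
    have h1 := ((hχ (u x) (hku x hx)).1.differentiableAt (by simp)).hasDerivAt
    have h2 := ((d.contDiffAt_u x hx).differentiableAt (by simp)).hasFDerivAt
    exact (ht x hx).prodMk (h1.comp_hasFDerivAt x h2)
  have hts : ContDiffOn ℝ ∞ t s := by
    rw [contDiffOn_infty_iff_fderiv_of_isOpen d.isOpen]
    refine ⟨fun x hx => (ht x hx).differentiableAt.differentiableWithinAt, fun x hx => ?_⟩
    have h1 : ContDiffAt ℝ ∞ (fun x => √(negDet (H x) / H x (X x) (X x)) • areaForm (X x)) x := by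
      have hXi : ∀ i, ContDiffAt ℝ ∞ (fun x => X x i) x := fun i =>
        (EuclideanSpace.proj (𝕜 := ℝ) i :
          EuclideanSpace ℝ (Fin 2) →L[ℝ] ℝ).contDiff.contDiffAt.comp x (d.contDiffAt_X x hx)
      exact (d.contDiffAt_scale hx).smul (((hXi 0).smul contDiffAt_const).sub
        ((hXi 1).smul contDiffAt_const))
    refine (h1.congr_of_eventuallyEq ?_).contDiffWithinAt
    filter_upwards [d.isOpen.mem_nhds hx] with y hy
    exact (ht y hy).fderiv
  have hFs : ∀ x ∈ s, ContDiffAt ℝ ∞ F x := fun x hx =>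
    (hts.contDiffAt (d.isOpen.mem_nhds hx)).prodMk
      ((hχ (u x) (hku x hx)).1.comp x (d.contDiffAt_u x hx))
  -- the derivative of `(t, χ)` is invertible
  have hequiv : ∀ x ∈ s, ∃ e : EuclideanSpace ℝ (Fin 2) ≃L[ℝ] ℝ × ℝ,
      HasFDerivAt F (e : EuclideanSpace ℝ (Fin 2) →L[ℝ] ℝ × ℝ) x ∧
      ∀ v, areaForm (X x) v = 0 ↔ (e v).1 = 0 := by
    intro x hx
    have hsc : √(negDet (H x) / H x (X x) (X x)) ≠ 0 :=
      (Real.sqrt_pos.2 (div_pos (d.negDet_pos hx) (d.spacelike x hx))).ne'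
    have hc : deriv χ (u x) ≠ 0 := by
      intro h0
      have h1 := (hχ (u x) (hku x hx)).2.2.2.2
      rw [h0] at h1
      norm_num at h1
    set L := (√(negDet (H x) / H x (X x) (X x)) • areaForm (X x)).prod
      (deriv χ (u x) • fderiv ℝ u x) with hL
    have hinj : Function.Injective L := by
      rw [injective_iff_map_eq_zero]
      intro v hv
      have h1 : √(negDet (H x) / H x (X x) (X x)) * areaForm (X x) v = 0 := congrArg Prod.fst hv
      have h2 : deriv χ (u x) * fderiv ℝ u x v = 0 := congrArg Prod.snd hv
      refine d.eq_zero_of_areaForm hx ((mul_eq_zero.1 h1).resolve_left hsc) ?_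
      rw [d.dual x hx, (mul_eq_zero.1 h2).resolve_left hc, mul_zero, neg_zero]
    have hsurj : Function.Surjective L :=
      (LinearMap.injective_iff_surjective_of_finrank_eq_finrank
        (f := (L : EuclideanSpace ℝ (Fin 2) →ₗ[ℝ] ℝ × ℝ)) (by simp)).1 hinj
    refine ⟨ContinuousLinearEquiv.ofBijective L (LinearMap.ker_eq_bot.2 hinj)
      (LinearMap.range_eq_top.2 hsurj), ?_, fun v => ?_⟩
    · rw [ContinuousLinearEquiv.coe_ofBijective]
      exact hFd x hx
    · rw [show ContinuousLinearEquiv.ofBijective L (LinearMap.ker_eq_bot.2 hinj)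
        (LinearMap.range_eq_top.2 hsurj) v = L v from
          DFunLike.congr_fun (ContinuousLinearEquiv.coe_ofBijective L (LinearMap.ker_eq_bot.2 hinj)
            (LinearMap.range_eq_top.2 hsurj)) v]
      change _ ↔ √(negDet (H x) / H x (X x) (X x)) * areaForm (X x) v = 0
      rw [mul_eq_zero, or_iff_right hsc]
  -- the metric is `-dt² + (X^♭)² / ρ`, and `(X^♭)² = φ⁴ du² = ρ² dχ²`
  have hmetric : ∀ x ∈ s, ∀ v w, H x v w = -((fderiv ℝ F x v).1 * (fderiv ℝ F x w).1) +
      ρ x * ((fderiv ℝ F x v).2 * (fderiv ℝ F x w).2) := by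
    intro x hx v w
    have hsp := d.spacelike x hx
    have hp := d.pos x hx
    have h1 := gram_plane (H x) (d.symm x hx) (X x) v w
    have h2 := Real.sq_sqrt (div_pos (d.negDet_pos hx) hsp).le
    have h3 := (hχ (u x) (hku x hx)).2.2.2.2
    have h4 := hk x hx
    rw [(hFd x hx).fderiv]
    change H x v w = -((√(negDet (H x) / H x (X x) (X x)) * areaForm (X x) v) *
      (√(negDet (H x) / H x (X x) (X x)) * areaForm (X x) w)) + H x (X x) (X x) *
        ((deriv χ (u x) * fderiv ℝ u x v) * (deriv χ (u x) * fderiv ℝ u x w))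
    rw [d.dual x hx, d.dual x hx] at h1
    have h5 : √(negDet (H x) / H x (X x) (X x)) ^ 2 * H x (X x) (X x) = negDet (H x) := by
      rw [h2]; field_simp
    apply mul_left_cancel₀ hsp.ne'
    have h6 : H x (X x) (X x) ^ 2 * deriv χ (u x) ^ 2 = φ x ^ 4 := by
      rw [h4]
      linear_combination φ x ^ 4 * h3
    linear_combination -h1 + (areaForm (X x) v * areaForm (X x) w) * h5 -
      (fderiv ℝ u x v * fderiv ℝ u x w) * h6
  obtain ⟨e₀, he₀, -⟩ := hequiv x₀ hx₀
  -- restrict the local inverse of `(t, χ)` to a rectangle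
  let Φ₁ := ((hFs x₀ hx₀).toOpenPartialHomeomorph F he₀ (by simp)).restrOpen s d.isOpen
  have hΦ₁ : ∀ x, Φ₁ x = F x := fun x => rfl
  have hx₁ : x₀ ∈ Φ₁.source :=
    ⟨(hFs x₀ hx₀).mem_toOpenPartialHomeomorph_source he₀ (by simp), hx₀⟩
  have hs₁ : Φ₁.source ⊆ s := fun x hx => hx.2
  obtain ⟨r, hr, hball⟩ := Metric.isOpen_iff.1 Φ₁.open_target (F x₀) (Φ₁.map_source hx₁)
  let Φ := (Φ₁.symm.restrOpen (Metric.ball (F x₀) r) Metric.isOpen_ball).symm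
  have hΦ : ∀ x, Φ x = F x := fun x => rfl
  have hΦc : (Φ : EuclideanSpace ℝ (Fin 2) → ℝ × ℝ) = F := rfl
  have hΦs : ∀ z, Φ.symm z = Φ₁.symm z := fun z => rfl
  have htarget : ∀ z, z ∈ Φ.target ↔ z ∈ Metric.ball (F x₀) r := by
    intro z
    exact ⟨fun h => h.2, fun h => ⟨hball h, h⟩⟩
  have hsource : Φ.source ⊆ s := by
    intro x hx
    rw [← Φ.left_inv hx, hΦs]
    exact hs₁ (Φ₁.map_target (hball ((htarget _).1 (Φ.map_source hx))))
  have hx₀' : x₀ ∈ Φ.source := by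
    have h1 := Φ.map_target ((htarget _).2 (Metric.mem_ball_self hr))
    rw [hΦs, ← hΦ₁, Φ₁.left_inv hx₁] at h1
    exact h1
  have hsymm : ContDiffOn ℝ ∞ Φ.symm Φ.target := by
    intro z hz
    obtain ⟨e, he, -⟩ := hequiv _ (hsource (Φ.map_target hz))
    exact (Φ.contDiffAt_symm hz he (hFs _ (hsource (Φ.map_target hz)))).contDiffWithinAt
  have hrect : ∀ τ c, (τ, c) ∈ Φ.target ↔ τ ∈ Metric.ball (t x₀) r ∧ c ∈ Metric.ball (χ (u x₀)) r := by
    intro τ c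
    rw [htarget]
    change (τ, c) ∈ Metric.ball ((t x₀, χ (u x₀)) : ℝ × ℝ) r ↔ _
    rw [← ball_prod_same]
    exact Iff.rfl
  have hρd : ∀ x ∈ s, HasFDerivAt ρ (fderiv ℝ ρ x) x := by
    intro x hx
    obtain ⟨L, hL, -⟩ := d.hasFDerivAt_normSq hx
    exact hL.differentiableAt.hasFDerivAt
  have hρs : ∀ x ∈ s, ContDiffAt ℝ ∞ ρ x := fun x hx =>
    ((d.contDiffAt_H x hx).clm_apply (d.contDiffAt_X x hx)).clm_apply (d.contDiffAt_X x hx)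
  -- the norm of `X` is a function of `t` alone
  have hconst : ∀ τ ∈ Metric.ball (t x₀) r, ∀ c ∈ Metric.ball (χ (u x₀)) r,
      ρ (Φ.symm (τ, c)) = ρ (Φ.symm (τ, χ (u x₀))) := by
    intro τ hτ c hc
    have hder : ∀ c ∈ Metric.ball (χ (u x₀)) r,
        HasDerivAt (fun c => ρ (Φ.symm (τ, c))) 0 c := by
      intro c hc
      have hz := (hrect τ c).2 ⟨hτ, hc⟩
      have hzs := hsource (Φ.map_target hz)
      obtain ⟨e, he, hes⟩ := hequiv _ hzs
      have h1 := Φ.hasFDerivAt_symm hz he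
      have h2 : HasDerivAt (fun c : ℝ => (τ, c)) ((0 : ℝ), (1 : ℝ)) c :=
        (hasDerivAt_const c τ).prodMk (hasDerivAt_id c)
      have h3 := ((hρd _ hzs).comp (τ, c) h1).comp_hasDerivAt c h2
      refine h3.congr_deriv ?_
      change fderiv ℝ ρ (Φ.symm (τ, c)) (e.symm ((0 : ℝ), (1 : ℝ))) = 0
      refine d.fderiv_normSq_of_areaForm hzs ((hes _).2 ?_)
      rw [e.apply_symm_apply]
    exact Metric.isOpen_ball.is_const_of_deriv_eq_zero (convex_ball _ _).isPreconnected
      (fun c hc => (hder c hc).differentiableAt.differentiableWithinAt)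
      (fun c hc => (hder c hc).deriv) hc (Metric.mem_ball_self hr)
  have hρx : ∀ x ∈ Φ.source, ρ (Φ.symm ((Φ x).1, χ (u x₀))) = ρ x := by
    intro x hx
    have h1 := (hrect (Φ x).1 (Φ x).2).1 (Φ.map_source hx)
    rw [← hconst _ h1.1 _ h1.2]
    exact congrArg ρ (Φ.left_inv hx)
  refine ⟨Metric.ball (t x₀) r, fun τ => √(ρ (Φ.symm (τ, χ (u x₀)))), k, Φ, Metric.isOpen_ball,
    (convex_ball _ _).ordConnected, ?_, ?_, hx₀', hsource, ?_, ?_, hsymm, ?_⟩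
  · intro τ hτ
    have hz := (hrect τ (χ (u x₀))).2 ⟨hτ, Metric.mem_ball_self hr⟩
    have hzs := hsource (Φ.map_target hz)
    have h1 : ContDiffAt ℝ ∞ (fun τ => Φ.symm (τ, χ (u x₀))) τ :=
      (hsymm.contDiffAt (Φ.open_target.mem_nhds hz)).comp τ (f := fun τ => (τ, χ (u x₀)))
        (contDiffAt_id.prodMk contDiffAt_const)
    have h2 : ContDiffAt ℝ ∞ (fun τ => ρ (Φ.symm (τ, χ (u x₀)))) τ :=
      ContDiffAt.comp (g := ρ) (f := fun τ => Φ.symm (τ, χ (u x₀))) τ (hρs _ hzs) h1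
    exact (h2.sqrt (d.spacelike _ hzs).ne').contDiffWithinAt
  · intro τ hτ
    have hz := (hrect τ (χ (u x₀))).2 ⟨hτ, Metric.mem_ball_self hr⟩
    exact Real.sqrt_pos.2 (d.spacelike _ (hsource (Φ.map_target hz)))
  · intro z hz
    have h1 := hsource (Φ.map_target hz)
    have h2 := hχ _ (hku _ h1)
    have h3 : (t (Φ.symm z), χ (u (Φ.symm z))) = z := Φ.right_inv hz
    have h4 : χ (u (Φ.symm z)) = z.2 := congrArg Prod.snd h3
    rw [h4] at h2
    exact ⟨((hrect z.1 z.2).1 hz).1, h2.2.1, h2.2.2.1⟩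
  · intro x hx
    exact (hFs x (hsource hx)).contDiffWithinAt
  · intro x hx
    have hxs := hsource hx
    refine ⟨fun v w => ?_, ?_⟩
    · beta_reduce
      rw [hρx x hx, Real.sq_sqrt (d.spacelike x hxs).le, hΦc]
      exact hmetric x hxs v w
    · beta_reduce
      rw [hρx x hx]
      change φ x = √(ρ x) * Sk k (χ (u x))
      rw [(hχ _ (hku x hxs)).2.2.2.1]
      have h1 : ρ x = φ x ^ 2 * (k + u x ^ 2) := hk x hxs
      have h2 := Real.sqrt_pos.2 (hku x hxs)
      rw [h1, Real.sqrt_mul (sq_nonneg _), Real.sqrt_sq (d.pos x hxs).le]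
      field_simp

end IsSpacelikeData

end Plane

/-! ### The local isometry with an FLRW spacetime -/

section FLRW

variable {N : Type*} [TopologicalSpace N] [ChartedSpace (EuclideanSpace ℝ (Fin 2)) N]
  [IsManifold (𝓡 2) ∞ N] {m : ℕ} {h : Tensor2 (𝓡 2) N} {f : N → ℝ}

/-- A Killing field with `W_X = 0` gives spacelike data on a coordinate ball around each point at
which it is spacelike, with `u = X(ln f)`. -/
theorem exists_isSpacelikeData (hh : IsLorentzian (𝓡 2) h) (hf : ContMDiff (𝓡 2) 𝓘(ℝ, ℝ) ∞ f)
    (hf_pos : ∀ p, 0 < f p) {X : VField (𝓡 2) N} (hX : IsKilling (𝓡 2) h X)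
    (hW : wField (𝓡 2) h f X = 0) {U : Set N} (hU : IsOpen U)
    (hsp : ∀ p ∈ U, 0 < h p (X p) (X p)) {p : N} (hp : p ∈ U) :
    ∃ s u, IsSpacelikeData s (coordMetric (𝓡 2) p h) (coordField (𝓡 2) p X)
      (fun x => f ((extChartAt (𝓡 2) p).symm x)) u ∧ extChartAt (𝓡 2) p p ∈ s ∧
      s ⊆ (extChartAt (𝓡 2) p).target ∧ ∀ x ∈ s, (extChartAt (𝓡 2) p).symm x ∈ U := by
  have hs := hh.isSmoothMetric
  have hopen : IsOpen ((extChartAt (𝓡 2) p).target ∩ (extChartAt (𝓡 2) p).symm ⁻¹' U) :=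
    (continuousOn_extChartAt_symm p).isOpen_inter_preimage (isOpen_extChartAt_target p) hU
  obtain ⟨r, hr, hball⟩ := Metric.isOpen_iff.1 hopen (extChartAt (𝓡 2) p p)
    ⟨mem_extChartAt_target p, by rw [Set.mem_preimage, extChartAt_to_inv]; exact hp⟩
  have ht : ∀ x ∈ Metric.ball (extChartAt (𝓡 2) p p) r, x ∈ (extChartAt (𝓡 2) p).target :=
    fun x hx => (hball hx).1
  have hH : ∀ x ∈ Metric.ball (extChartAt (𝓡 2) p p) r,
      ContDiffAt ℝ ∞ (coordMetric (𝓡 2) p h) x := fun x hx =>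
    (hs.contDiffOn p).contDiffAt ((isOpen_extChartAt_target p).mem_nhds (ht x hx))
  have hl := contMDiff_dirDeriv hX.1 (contMDiff_log hf hf_pos)
  refine ⟨Metric.ball (extChartAt (𝓡 2) p p) r, fun x => dirDeriv (𝓡 2) X
    (fun y => Real.log (f y)) ((extChartAt (𝓡 2) p).symm x), ?_, Metric.mem_ball_self hr,
    ht, fun x hx => (hball hx).2⟩
  exact
    { isOpen := Metric.isOpen_ball
      convex := convex_ball _ _
      contDiffAt_H := hH
      contDiffAt_X := fun x hx => (smoothFieldAt_iff p (ht x hx) X).1 (hX.1 _)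
      contDiffAt_φ := fun x hx =>
        (contMDiffAt_iff_contDiffAt_comp_symm (n := ⊤) p (ht x hx) f).1 (hf _)
      contDiffAt_u := fun x hx =>
        (contMDiffAt_iff_contDiffAt_comp_symm (n := ⊤) p (ht x hx) _).1 (hl _)
      symm := fun x _ a b => by rw [coordMetric_apply, coordMetric_apply, hh.symm]
      pos := fun x _ => hf_pos _
      killing := fun x hx a b => by
        have h1 := hX.coordKilling hs p (ht x hx) a b
        have h2 : HasFDerivAt (fun x => coordMetric (𝓡 2) p h x a b) _ x :=
          ((((hH x hx).differentiableAt (by simp)).hasFDerivAt).clm_apply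
            (hasFDerivAt_const a x)).clm_apply (hasFDerivAt_const b x)
        rw [h2.fderiv] at h1
        simpa using h1
      mul_eq := fun x hx => by
        rw [dirDeriv_log_eq p (ht x hx) hf hf_pos, div_mul_cancel₀ _ (hf_pos _).ne']
      dual := fun x hx a => by
        have h1 := metric_eq_of_wField_eq_zero hh hW ((extChartAt (𝓡 2) p).symm x)
          (frame (𝓡 2) p x a)
        rw [mvfderiv_apply_eq_fderiv p (ht x hx) _ ((hl _).mdifferentiableAt (by simp))] at h1
        rw [coordMetric_apply, frame_coordField p (ht x hx)]
        exact h1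
      spacelike := fun x hx => by
        rw [coordMetric_coordField p h (ht x hx)]
        exact hsp _ (hball hx).2
      timelike := fun x hx => by
        obtain ⟨v, hv, -⟩ := hh.signature ((extChartAt (𝓡 2) p).symm x)
        refine ⟨coframe (𝓡 2) p _ v, ?_⟩
        rw [coordMetric_apply, frame_coframe p (ht x hx)]
        exact hv }

theorem flrw_apply (a : ℝ → ℝ) (k : ℝ) (z : ℝ × ℝ) (b : Sph m) (v w : ℝ × ℝ)
    (v' w' : TangentSpace (𝓡 m) b) :
    flrw m a k (z, b) ((v, v') : (ℝ × ℝ) × TangentSpace (𝓡 m) b)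
      ((w, w') : (ℝ × ℝ) × TangentSpace (𝓡 m) b) =
      -(v.1 * w.1) + a z.1 ^ 2 * (v.2 * w.2) + (a z.1 * Sk k z.2) ^ 2 * roundMetric m b v' w' := by
  refine (warped_apply 𝓘(ℝ, ℝ × ℝ) (𝓡 m) (flrwBase a) (fun p => a p.1 * Sk k p.2) (roundMetric m)
    (z, b) ((v, v') : (ℝ × ℝ) × TangentSpace (𝓡 m) b)
      ((w, w') : (ℝ × ℝ) × TangentSpace (𝓡 m) b)).trans ?_
  have h1 : flrwBase a z v w = -(v.1 * w.1) + a z.1 ^ 2 * (v.2 * w.2) := by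
    change -(v.1 • w.1) + a z.1 ^ 2 • (v.2 • w.2) = _
    simp
  exact congrArg (· + (a z.1 * Sk k z.2) ^ 2 * roundMetric m b v' w') h1

/-- The local isometry is the product of the chart `(t, χ)` of the base with the identity of the
sphere. -/
theorem locallyFLRWOn_of_spacelike (hh : IsLorentzian (𝓡 2) h) (hf : ContMDiff (𝓡 2) 𝓘(ℝ, ℝ) ∞ f)
    (hf_pos : ∀ p, 0 < f p) {X : VField (𝓡 2) N} (hX : IsKilling (𝓡 2) h X)
    (hW : wField (𝓡 2) h f X = 0) {U : Set N} (hU : IsOpen U)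
    (hsp : ∀ p ∈ U, 0 < h p (X p) (X p)) :
    LocallyFLRWOn ((𝓡 2).prod (𝓡 m)) m (spherical m h f) (U ×ˢ Set.univ) := by
  have : IsManifold (𝓡 2) 1 N := IsManifold.of_le (n := ∞) (by norm_cast)
  rintro ⟨p, b₀⟩ ⟨hp, -⟩
  change p ∈ U at hp
  obtain ⟨s, u, d, hps, hst, hsU⟩ := exists_isSpacelikeData hh hf hf_pos hX hW hU hsp hp
  obtain ⟨J, a, k, Φ, hJ, hJ', ha, ha', hx₀, hΦs, hΦt, hΦc, hΦc', hΦ⟩ := d.exists_flrw_chart hps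
  let ψ : OpenPartialHomeomorph N (ℝ × ℝ) := (chartAt (EuclideanSpace ℝ (Fin 2)) p).trans Φ
  have hψ : ∀ y ∈ ψ.source, y ∈ (extChartAt (𝓡 2) p).source ∧ extChartAt (𝓡 2) p y ∈ Φ.source := by
    intro y hy
    rw [extChartAt_source]
    exact hy
  have hψs : ContMDiffOn (𝓡 2) 𝓘(ℝ, ℝ × ℝ) ∞ ψ ψ.source := by
    have h1 : ContMDiffOn (𝓡 2) 𝓘(ℝ, EuclideanSpace ℝ (Fin 2)) ∞ (extChartAt (𝓡 2) p) ψ.source :=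
      (contMDiffOn_extChartAt (x := p)).mono fun y hy => by
        rw [← extChartAt_source (𝓡 2)]; exact (hψ y hy).1
    exact ContMDiffOn.comp (g := Φ) hΦc.contMDiffOn h1 fun y hy => (hψ y hy).2
  have hψs' : ContMDiffOn 𝓘(ℝ, ℝ × ℝ) (𝓡 2) ∞ ψ.symm ψ.target := by
    refine ContMDiffOn.comp (g := (extChartAt (𝓡 2) p).symm) (f := Φ.symm)
      (t := (extChartAt (𝓡 2) p).target) (contMDiffOn_extChartAt_symm p)
      (hΦc'.contMDiffOn.mono fun z hz => hz.1) fun z hz => hst (hΦs (Φ.map_target hz.1))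
  refine ⟨J, a, k, ψ.prod (OpenPartialHomeomorph.refl (Sph m)), hJ, hJ', ha, ha', ?_, ?_, ?_, ?_, ?_,
    ?_⟩
  · exact ⟨⟨mem_chart_source _ p, hx₀⟩, trivial⟩
  · rintro ⟨y, b⟩ ⟨hy, -⟩
    refine ⟨?_, trivial⟩
    have h1 := hsU _ (hΦs (hψ y hy).2)
    rwa [(extChartAt (𝓡 2) p).left_inv (hψ y hy).1] at h1
  · rintro ⟨z, b⟩ ⟨hz, -⟩
    exact hΦt z hz.1
  · exact hψs.prodMap contMDiffOn_id
  · exact hψs'.prodMap contMDiffOn_id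
  · rintro ⟨y, b⟩ ⟨hy, -⟩
    obtain ⟨hy1, hy2⟩ := hψ y hy
    obtain ⟨e, he, rfl⟩ : ∃ e ∈ (extChartAt (𝓡 2) p).target, (extChartAt (𝓡 2) p).symm e = y :=
      ⟨_, (extChartAt (𝓡 2) p).map_source hy1, (extChartAt (𝓡 2) p).left_inv hy1⟩
    rw [(extChartAt (𝓡 2) p).right_inv he] at hy2
    have hΦd : HasFDerivAt Φ (fderiv ℝ Φ e) e :=
      ((hΦc.contDiffAt (Φ.open_source.mem_nhds hy2)).differentiableAt (by simp)).hasFDerivAt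
    have hd1 : HasMFDerivAt (𝓡 2) 𝓘(ℝ, EuclideanSpace ℝ (Fin 2)) (extChartAt (𝓡 2) p)
        ((extChartAt (𝓡 2) p).symm e) (coframe (𝓡 2) p ((extChartAt (𝓡 2) p).symm e)) :=
      ((contMDiffAt_extChartAt' (n := ∞) (by rwa [← extChartAt_source (𝓡 2)])).mdifferentiableAt
        (by simp)).hasMFDerivAt
    have hd2 : HasMFDerivAt 𝓘(ℝ, EuclideanSpace ℝ (Fin 2)) 𝓘(ℝ, ℝ × ℝ) Φ
        (extChartAt (𝓡 2) p ((extChartAt (𝓡 2) p).symm e)) (fderiv ℝ Φ e) := by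
      rw [(extChartAt (𝓡 2) p).right_inv he]
      exact hΦd.hasMFDerivAt
    have hd3 := hd2.comp _ hd1
    have hd4 := HasMFDerivAt.prodMap (p := ((extChartAt (𝓡 2) p).symm e, b)) (g := id) hd3
      (hasMFDerivAt_id (I := 𝓡 m) b)
    rw [hd3.mfderiv, mfderiv_id] at hd4
    have hd : ∀ v : TangentSpace ((𝓡 2).prod (𝓡 m)) ((extChartAt (𝓡 2) p).symm e, b),
        mfderiv ((𝓡 2).prod (𝓡 m)) (𝓘(ℝ, ℝ × ℝ).prod (𝓡 m))
          (ψ.prod (OpenPartialHomeomorph.refl (Sph m))) ((extChartAt (𝓡 2) p).symm e, b) v =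
        ((fderiv ℝ Φ e (coframe (𝓡 2) p ((extChartAt (𝓡 2) p).symm e) v.1), v.2) :
          (ℝ × ℝ) × TangentSpace (𝓡 m) b) := fun v => DFunLike.congr_fun hd4.mfderiv v
    have hval : (ψ.prod (OpenPartialHomeomorph.refl (Sph m))) ((extChartAt (𝓡 2) p).symm e, b) =
        (Φ e, b) := by
      have : Φ (extChartAt (𝓡 2) p ((extChartAt (𝓡 2) p).symm e)) = Φ e := by
        rw [(extChartAt (𝓡 2) p).right_inv he]
      exact Prod.ext this rfl
    ext v w
    obtain ⟨h1, h2⟩ := hΦ e hy2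
    have h3 : ∀ z : (ℝ × ℝ) × Sph m, z = (Φ e, b) → ∀ (v w : (ℝ × ℝ) × EuclideanSpace ℝ (Fin m)),
        flrw m a k z v w = flrw m a k (Φ e, b) v w := by rintro _ rfl v w; rfl
    rw [pullback_apply, hd v, hd w]
    refine (h3 _ hval _ _).trans ((flrw_apply a k (Φ e) b _ _ _ _).trans ?_)
    refine Eq.trans ?_ (warped_apply (𝓡 2) (𝓡 m) h f (roundMetric m) _ v w).symm
    have h4 : ∀ v w : TangentSpace (𝓡 2) ((extChartAt (𝓡 2) p).symm e),
        coordMetric (𝓡 2) p h e (coframe (𝓡 2) p _ v) (coframe (𝓡 2) p _ w) = h _ v w := by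
      intro v w
      rw [coordMetric_apply, frame_coframe p he, frame_coframe p he]
    rw [← h1, ← h2]
    exact congrArg (· + f ((extChartAt (𝓡 2) p).symm e) ^ 2 * roundMetric m b v.2 w.2) (h4 v.1 w.1)

end FLRW

/-! ### The dimension of the Killing algebra in the dependent case -/

section Final

variable {N : Type*} [TopologicalSpace N] [ChartedSpace (EuclideanSpace ℝ (Fin 2)) N]
  [IsManifold (𝓡 2) ∞ N] {m : ℕ} {h : Tensor2 (𝓡 2) N} {f : N → ℝ}

theorem card_xiZeta (m : ℕ) :
    Fintype.card (Fin (m + 1) ⊕ {p : Fin (m + 1) × Fin (m + 1) // p.1 < p.2}) =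
      (m + 1) * (m + 2) / 2 := by
  rw [Fintype.card_sum, Fintype.card_fin, card_pairs, Nat.add_sub_cancel]
  have : (m + 1) * (m + 2) = (m + 1) * m + 2 * (m + 1) := by ring
  omega

theorem xiZeta_mem (hh : IsLorentzian (𝓡 2) h) (hf : ContMDiff (𝓡 2) 𝓘(ℝ, ℝ) ∞ f)
    (hf_pos : ∀ p, 0 < f p) {X : VField (𝓡 2) N} (hX : IsKilling (𝓡 2) h X)
    (hW : wField (𝓡 2) h f X = 0) (s) :
    xiZeta m f X s ∈ killingAlgebra ((𝓡 2).prod (𝓡 m)) (spherical m h f) := by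
  rcases s with i | s
  · exact isKilling_xiField hh hf hf_pos hX hW i
  · exact isKilling_zetaField hh hf _ _

theorem le_rank_killingAlgebra [ConnectedSpace N] [NeZero m] (hh : IsLorentzian (𝓡 2) h)
    (hf : ContMDiff (𝓡 2) 𝓘(ℝ, ℝ) ∞ f)
    (hf_pos : ∀ p, 0 < f p) {X : VField (𝓡 2) N} (hX : IsKilling (𝓡 2) h X) (hX0 : X ≠ 0)
    (hW : wField (𝓡 2) h f X = 0) :
    (((m + 1) * (m + 2) / 2 : ℕ) : Cardinal) ≤
      Module.rank ℝ (killingAlgebra ((𝓡 2).prod (𝓡 m)) (spherical m h f)) := by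
  have hfin := finiteDimensional_killingAlgebra (isSmoothMetric_spherical hh.isSmoothMetric hf)
    (warped_symm hh.symm f (roundMetric_symm (m := m)))
    (warped_nondegenerate hh.nondegenerate hf_pos roundMetric_nondegenerate)
  have h1 : LinearIndependent ℝ (fun s => (⟨xiZeta m f X s, xiZeta_mem hh hf hf_pos hX hW s⟩ :
      killingAlgebra ((𝓡 2).prod (𝓡 m)) (spherical m h f))) :=
    LinearIndependent.of_comp (Submodule.subtype _) (linearIndependent_xiZeta hX0 f)
  have h2 := h1.fintype_card_le_finrank
  rw [card_xiZeta] at h2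
  rw [← Module.finrank_eq_rank]
  exact_mod_cast h2

end Final

end WarpedKilling

end

theorem mainTheorem4 (m : ℕ) (hm : 2 ≤ m)
    {N : Type*} [TopologicalSpace N] [T2Space N] [SecondCountableTopology N] [ConnectedSpace N]
    [ChartedSpace (EuclideanSpace ℝ (Fin 2)) N] [IsManifold (𝓡 2) ∞ N]
    (h : Tensor2 (𝓡 2) N) (hh : IsLorentzian (𝓡 2) h)
    (f : N → ℝ) (hf : ContMDiff (𝓡 2) 𝓘(ℝ, ℝ) ∞ f) (hf_pos : ∀ p, 0 < f p)
    (hdim : ((m * (m + 1) / 2 + 1 : ℕ) : Cardinal) ≤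
      Module.rank ℝ (killingAlgebra ((𝓡 2).prod (𝓡 m)) (spherical m h f))) :
    FiniteDimensional ℝ (killingAlgebra (𝓡 2) h) ∧
    1 ≤ Module.finrank ℝ (killingAlgebra (𝓡 2) h) ∧
    ∀ (n : ℕ) (X : Module.Basis (Fin n) ℝ (killingAlgebra (𝓡 2) h)),
      (LinearIndependent ℝ (fun a => wField (𝓡 2) h f (X a)) →
        ∃ α : Fin n → ℝ, α ≠ 0 ∧
          ∀ p, dirDeriv (𝓡 2) (∑ a, α a • (X a : VField (𝓡 2) N)) f p = 0) ∧
      (¬ LinearIndependent ℝ (fun a => wField (𝓡 2) h f (X a)) →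
        (((m + 1) * (m + 2) / 2 : ℕ) : Cardinal) ≤
          Module.rank ℝ (killingAlgebra ((𝓡 2).prod (𝓡 m)) (spherical m h f)) ∧
        ∀ σ : Fin n → ℝ, σ ≠ 0 → ∑ a, σ a • wField (𝓡 2) h f (X a) = 0 →
          (∀ s, xiZeta m f (∑ a, σ a • (X a : VField (𝓡 2) N)) s ∈
            killingAlgebra ((𝓡 2).prod (𝓡 m)) (spherical m h f)) ∧
          LinearIndependent ℝ (xiZeta m f (∑ a, σ a • (X a : VField (𝓡 2) N))) ∧
          ∀ U : Set N, IsOpen U →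
            (∀ p ∈ U, 0 < h p ((∑ a, σ a • (X a : VField (𝓡 2) N)) p)
              ((∑ a, σ a • (X a : VField (𝓡 2) N)) p)) →
            LocallyFLRWOn ((𝓡 2).prod (𝓡 m)) m (spherical m h f) (U ×ˢ Set.univ)) := by
  have hm0 : NeZero m := ⟨by omega⟩
  obtain ⟨V, hV, b₀, hb₀⟩ := exists_baseSlice_ne_zero hh hf hf_pos hdim
  have hfin := finiteDimensional_killingAlgebra hh.isSmoothMetric hh.symm hh.nondegenerate
  refine ⟨hfin, ?_, fun n X => ?_⟩
  · have : Nontrivial (killingAlgebra (𝓡 2) h) :=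
      ⟨⟨baseSlice V b₀, isKilling_baseSlice hh.isSmoothMetric hf hV b₀⟩, 0,
        fun h0 => hb₀ (congrArg Subtype.val h0)⟩
    exact Module.finrank_pos
  have hsum : ∀ σ : Fin n → ℝ, ((∑ a, σ a • X a : killingAlgebra (𝓡 2) h) : VField (𝓡 2) N) =
      ∑ a, σ a • (X a : VField (𝓡 2) N) := by
    intro σ
    rw [Submodule.coe_sum]
    rfl
  have hwsum : ∀ σ : Fin n → ℝ, wField (𝓡 2) h f (∑ a, σ a • (X a : VField (𝓡 2) N)) =
      ∑ a, σ a • wField (𝓡 2) h f (X a) := by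
    intro σ
    have h1 := map_sum (wLinear h hh.nondegenerate hf hf_pos) (fun a => σ a • X a) Finset.univ
    simp only [map_smul] at h1
    rw [← hsum]
    exact h1
  refine ⟨fun hli => ?_, fun hld => ?_⟩
  · have hinj : Function.Injective (wLinear h hh.nondegenerate hf hf_pos) := by
      rw [injective_iff_map_eq_zero]
      intro ξ hξ
      have h1 := hwsum (fun a => X.repr ξ a)
      rw [← hsum, X.sum_repr] at h1
      have h2 := Fintype.linearIndependent_iff.1 hli _ (h1.symm.trans hξ)
      rw [← X.sum_repr ξ]
      simp [h2]
    obtain ⟨ξ, hξ0, hξ⟩ := exists_killing_dirDeriv_eq_zero hm hh hf hf_pos hV hb₀ hinj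
    refine ⟨fun a => X.repr ξ a, fun h0 => hξ0 ?_, fun p => ?_⟩
    · rw [← X.sum_repr ξ]
      exact Finset.sum_eq_zero fun a _ => by rw [show X.repr ξ a = 0 from congrFun h0 a, zero_smul]
    · rw [← hsum, X.sum_repr]
      exact hξ p
  · have hne : ∀ σ : Fin n → ℝ, σ ≠ 0 → ∑ a, σ a • (X a : VField (𝓡 2) N) ≠ 0 := by
      intro σ hσ h0
      rw [← hsum, ZeroMemClass.coe_eq_zero] at h0
      exact hσ (funext fun a => Fintype.linearIndependent_iff.1 X.linearIndependent σ h0 a)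
    have hK : ∀ σ : Fin n → ℝ, IsKilling (𝓡 2) h (∑ a, σ a • (X a : VField (𝓡 2) N)) := by
      intro σ
      rw [← hsum]
      exact (∑ a, σ a • X a : killingAlgebra (𝓡 2) h).2
    refine ⟨?_, fun σ hσ hW => ?_⟩
    · obtain ⟨σ, hσ, i, hi⟩ := Fintype.not_linearIndependent_iff.1 hld
      have hσ0 : σ ≠ 0 := fun h0 => hi (congrFun h0 i)
      exact le_rank_killingAlgebra hh hf hf_pos (hK σ) (hne σ hσ0) ((hwsum σ).trans hσ)
    · have hW' := (hwsum σ).trans hW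
      exact ⟨xiZeta_mem hh hf hf_pos (hK σ) hW', linearIndependent_xiZeta (hne σ hσ) f,
        fun U hU hsp => locallyFLRWOn_of_spacelike hh hf hf_pos (hK σ) hW' hU hsp⟩
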